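/- **Setting.** Let $U\subset\mathbf R^n$ be open (a coordinate neighbourhood), $p(x,\xi)=\sum_{|\gamma|\le m}a^0_\gamma(x)\xi^\gamma$ with $a^0_\gamma\in C^\infty(U;\mathbf C)$, classically elliptic: $\big|\sum_{|\gamma|=m}a^0_\gamma(x)\xi^\gamma\big|\ge |\xi|^m/C$ locally uniformly in $x\in U$. Fix $z\in\mathbf C$ and $R\in\mathbf R$, put $s=|p-z|^2$ and $\langle\xi\rangle=(1+|\xi|^2)^{1/2}$, and $$\Lambda=\Lambda_\alpha(x,\xi)=\Big(\frac{\alpha+s}{1+s}\Big)^{1/2}.$$ All symbols are families of functions in $C^\infty(U\times\mathbf R^n)$ that may depend on parameters $(h,\alpha,w)$ with $0<h\le\alpha<1$, $w\in\mathbf C$, $|w|<R$, $\operatorname{Im}w\ne0$; no regularity in the parameters is required. * For a weight $M(\xi)$, $a\in S_{1,0}(M)$ means: for all $\gamma,\beta\in\mathbf N^n$, $\partial_x^\gamma\partial_\xi^\beta a=\mathcal O(1)\,M\langle\xi\rangle^{-|\beta|}$, locally uniformly in $x\in U$ and uniformly in $\xi$ and in the parameters. * For a (possibly parameter-dependent)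 weight $M(x,\xi)$, $b\in S_\Lambda(M)$ means: for all $\gamma,\beta\in\mathbf N^n$ there is $J\in\mathbf N$ such that $\partial_x^\gamma\partial_\xi^\beta b=\mathcal O(1)\,M\Lambda^{-|\gamma|-|\beta|}\langle\xi\rangle^{-|\beta|}|\operatorname{Im}w|^{-J}$, locally uniformly in $x\in U$ and uniformly in $\xi$ and in the parameters. * For $u\in C_0^\infty(U)$, $\mathrm{Op}_h(a)u(x)=(2\pi h)^{-n}\iint e^{\frac ih(x-y)\cdot\eta}a(x,\eta)u(y)\,dy\,d\eta$ (integrating first in $y$), and $D_x=\frac1i\partial_x$. **Proposition 4.5.** Let $m_1=\langle\xi\rangle^r$, $m_2=\langle\xi\rangle^k\Lambda^\ell$ with $r,k,\ell\in\mathbf R$, let $a\in S_{1,0}(m_1)$ and $b\in S_\Lambda(m_2)$, and assume that there is a compact set $K\subset U$, independent of the parameters, with $\operatorname{supp}b\subset K\times\mathbf R^n$. Let $$c(x,\xi)=e^{-\frac ihx\cdot\xi}\,\mathrm{Op}_h(a)\big(b(\cdot,\xi)e^{\frac ih(\cdot)\cdot\xi}\big)(x).$$ Then: 1. $\mathrm{Op}_h(b)$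 maps $C_0^\infty(U)$ to itself, and $\mathrm{Op}_h(a)\circ\mathrm{Op}_h(b)=\mathrm{Op}_h(c)$ as operators from $C_0^\infty(U)$ to functions on $U$, for every value of the parameters; 2. $c\in S_\Lambda(m_1m_2)$; 3. for every $N\in\mathbf N$, $$c=\sum_{|\beta|<N}\frac{h^{|\beta|}}{\beta!}\,\partial_\xi^\beta a\;D_x^\beta b+r_N,\qquad r_N\in S_\Lambda\Big(\frac{m_1m_2}{(\Lambda\langle\xi\rangle)^N}h^N\Big).$$ -/

import Mathlib

open MeasureTheory
open scoped ContDiff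

noncomputable section

namespace ExoticCalculus

/-- Euclidean space `ℝⁿ`, with the Euclidean norm and inner product. -/
abbrev Eucl (n : ℕ) : Type := EuclideanSpace ℝ (Fin n)

/-- The length `|γ|` of a multi-index. -/
def mlen {n : ℕ} (γ : Fin n → ℕ) : ℕ := ∑ i, γ i

/-- The factorial `γ!` of a multi-index. -/
def mfact {n : ℕ} (γ : Fin n → ℕ) : ℕ := ∏ i, (γ i).factorial

/-- The finite set of the multi-indices `γ` with `|γ| = k`. -/
def multiOfLen (n k : ℕ) : Finset (Fin n → ℕ) := Finset.piAntidiag Finset.univ k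

/-- The partial derivative `∂ᵢ f`. -/
def pderiv {n : ℕ} (i : Fin n) (f : Eucl n → ℂ) : Eucl n → ℂ :=
  fun x => fderiv ℝ f x (EuclideanSpace.single i 1)

/-- The iterated partial derivative `∂^γ f = ∂₁^{γ₁} ⋯ ∂ₙ^{γₙ} f`. -/
def mderiv {n : ℕ} (γ : Fin n → ℕ) (f : Eucl n → ℂ) : Eucl n → ℂ :=
  (List.finRange n).foldr (fun i g => (pderiv i)^[γ i] g) f

/-- The derivative `∂_x^γ a` of a function `a(x, ξ)`. -/
def dX {n : ℕ} (γ : Fin n → ℕ) (a : Eucl n → Eucl n → ℂ) : Eucl n → Eucl n → ℂ :=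
  fun x ξ => mderiv γ (fun y => a y ξ) x

/-- The derivative `∂_ξ^γ a` of a function `a(x, ξ)`. -/
def dXi {n : ℕ} (γ : Fin n → ℕ) (a : Eucl n → Eucl n → ℂ) : Eucl n → Eucl n → ℂ :=
  fun x ξ => mderiv γ (a x) ξ

/-- The derivative `D_x^γ a`, where `D = ∂ / i`. -/
def DX {n : ℕ} (γ : Fin n → ℕ) (a : Eucl n → Eucl n → ℂ) : Eucl n → Eucl n → ℂ :=
  fun x ξ => (1 / Complex.I) ^ mlen γ * dX γ a x ξ

/-- The Japanese bracket `⟨ξ⟩ = (1 + |ξ|²)^{1/2}`. -/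
def jap {n : ℕ} (ξ : Eucl n) : ℝ := Real.sqrt (1 + ‖ξ‖ ^ 2)

/-- The part `∑_{|γ| = j} coef_γ(x) ξ^γ`, homogeneous of degree `j` in `ξ`. -/
def homPart {n : ℕ} (coef : (Fin n → ℕ) → Eucl n → ℂ) (j : ℕ) (x ξ : Eucl n) : ℂ :=
  ∑ γ ∈ multiOfLen n j, coef γ x * ∏ i, ((ξ i : ℝ) : ℂ) ^ γ i

/-- The semiclassical principal symbol `p(x, ξ) = ∑_{|γ| ≤ m} coef_γ(x) ξ^γ`. -/
def polySymbol {n : ℕ} (m : ℕ) (coef : (Fin n → ℕ) → Eucl n → ℂ) (x ξ : Eucl n) : ℂ :=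
  ∑ j ∈ Finset.range (m + 1), homPart coef j x ξ

/-- Classical ellipticity, locally uniformly in `U`:
`|p_m(x, ξ)| ≥ |ξ|^m / C` for `x` in compact subsets of `U`. -/
def ClassicallyElliptic {n : ℕ} (U : Set (Eucl n)) (m : ℕ)
    (coef : (Fin n → ℕ) → Eucl n → ℂ) : Prop :=
  ∀ L : Set (Eucl n), IsCompact L → L ⊆ U →
    ∃ C : ℝ, 0 < C ∧ ∀ x ∈ L, ∀ ξ : Eucl n, 1 / C * ‖ξ‖ ^ m ≤ ‖homPart coef m x ξ‖

/-- `Λ = ((α + s) / (1 + s))^{1/2}` with `s = |p - z|²`. -/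
def Lam {n : ℕ} (p : Eucl n → Eucl n → ℂ) (z : ℂ) (α : ℝ) (x ξ : Eucl n) : ℝ :=
  Real.sqrt ((α + ‖p x ξ - z‖ ^ 2) / (1 + ‖p x ξ - z‖ ^ 2))

/-- The parameters `(h, α, w)`: `0 < h ≤ α < 1`, `w ∈ D(0, R)`, `Im w ≠ 0`. -/
structure Param (R : ℝ) where
  h : ℝ
  α : ℝ
  w : ℂ
  h_pos : 0 < h
  h_le : h ≤ α
  α_lt : α < 1
  norm_w : ‖w‖ < R
  im_w : w.im ≠ 0

/-- Families of functions of `(x, ξ)`, depending on the parameters `(h, α, w)`. -/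
abbrev SymbolFamily (n : ℕ) (R : ℝ) : Type := Param R → Eucl n → Eucl n → ℂ

/-- `a` is, for each value of the parameters, a smooth function on `T*U = U × ℝⁿ`. -/
def IsSmoothFamily {n : ℕ} {R : ℝ} (U : Set (Eucl n)) (a : SymbolFamily n R) : Prop :=
  ∀ q : Param R, ContDiffOn ℝ ∞ (fun v : Eucl n × Eucl n => a q v.1 v.2) (U ×ˢ Set.univ)

/-- The symbol space `S_{1,0}(M)` on `T*U`; the estimates are locally uniform in `x`, and
uniform in `ξ` and in all the parameters. -/
def MemS10 {n : ℕ} {R : ℝ} (U : Set (Eucl n)) (M : Eucl n → ℝ) (a : SymbolFamily n R) : Prop :=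
  IsSmoothFamily U a ∧
    ∀ γ β : Fin n → ℕ, ∀ L : Set (Eucl n), IsCompact L → L ⊆ U →
      ∃ C : ℝ, ∀ q : Param R, ∀ x ∈ L, ∀ ξ : Eucl n,
        ‖dX γ (dXi β (a q)) x ξ‖ ≤ C * M ξ * (jap ξ ^ mlen β)⁻¹

/-- The exotic symbol space `S_Λ(M)` on `T*U`, for `Λ` built from `p` and `z`: for all
multi-indices `γ, β` there is a `J`, independent of the compact set `L`, such that
`∂_x^γ ∂_ξ^β a = O(1) M Λ^{-|γ|-|β|} ⟨ξ⟩^{-|β|} |Im w|^{-J}`, uniformly for `x ∈ L`, for all `ξ`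
and for all values of the parameters. The weight `M` may depend on the parameters. -/
def MemSLam {n : ℕ} {R : ℝ} (U : Set (Eucl n)) (p : Eucl n → Eucl n → ℂ) (z : ℂ)
    (M : Param R → Eucl n → Eucl n → ℝ) (a : SymbolFamily n R) : Prop :=
  IsSmoothFamily U a ∧
    ∀ γ β : Fin n → ℕ, ∃ J : ℕ, ∀ L : Set (Eucl n), IsCompact L → L ⊆ U →
      ∃ C : ℝ, ∀ q : Param R, ∀ x ∈ L, ∀ ξ : Eucl n,
        ‖dX γ (dXi β (a q)) x ξ‖ ≤
          C * M q x ξ * (Lam p z q.α x ξ ^ (mlen γ + mlen β))⁻¹ *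
            (jap ξ ^ mlen β)⁻¹ * (|q.w.im| ^ J)⁻¹

/-- The oscillating exponential `e^{i x·ξ / h}`. -/
def osc {n : ℕ} (h : ℝ) (x ξ : Eucl n) : ℂ :=
  Complex.exp (Complex.I * ((inner ℝ x ξ / h : ℝ) : ℂ))

/-- The classical `h`-quantization
`Op_h(a) u(x) = (2πh)^{-n} ∬ e^{i (x - y)·η / h} a(x, η) u(y) dy dη`,
the integral in `y` being carried out first. For a symbol `a` of `S_{1,0}` type and
`u ∈ C_0^∞` both iterated integrals converge absolutely. -/
def Op {n : ℕ} (h : ℝ) (a : Eucl n → Eucl n → ℂ) (u : Eucl n → ℂ) (x : Eucl n) : ℂ :=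
  (((2 * Real.pi * h) ^ n : ℝ) : ℂ)⁻¹ *
    ∫ η : Eucl n, ∫ y : Eucl n, osc h (x - y) η * a x η * u y

/-- The space `C_0^∞(U)`, of functions on `ℝⁿ` (extended by `0` outside `U`). -/
def TestFun {n : ℕ} (U : Set (Eucl n)) (u : Eucl n → ℂ) : Prop :=
  ContDiff ℝ ∞ u ∧ HasCompactSupport u ∧ tsupport u ⊆ U

/-- The symbol of the composition `Op_h(a) ∘ Op_h(b)`:
`c(x, ξ) = e^{-i x·ξ / h} Op_h(a)(b(·, ξ) e^{i (·)·ξ / h})(x)`. -/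
def compSymbol {n : ℕ} {R : ℝ} (a b : SymbolFamily n R) : SymbolFamily n R :=
  fun q x ξ => osc q.h (-x) ξ * Op q.h (a q) (fun y => b q y ξ * osc q.h y ξ) x

/-- The partial sum `∑_{|β| < N} h^{|β|} / β! · ∂_ξ^β a · D_x^β b`. -/
def expansion {n : ℕ} {R : ℝ} (a b : SymbolFamily n R) (N : ℕ) : SymbolFamily n R :=
  fun q x ξ => ∑ j ∈ Finset.range N, ∑ β ∈ multiOfLen n j,
    ((q.h ^ j / (mfact β : ℝ) : ℝ) : ℂ) * dXi β (a q) x ξ * DX β (b q) x ξ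

end ExoticCalculus

end

open ExoticCalculus

/-!
# Composition of `S_{1,0}` symbols with exotic symbols

Written in terms of the Fourier transform, the composition symbol is
`c(x, ξ) = ∫ e^{2πi x·w} a(x, ξ + 2πh w) 𝓕(b(·, ξ))(w) dw` (`compSymbol_eq_amp`), an absolutely
convergent integral, since `b(·, ξ)` has compact support.

The estimates. After rescaling by `√h` around `x`, this is the pairing of
`φ(w) = a(x, ξ + 2π√h w)` with the Fourier transform of `g(y) = b(x + √h y, ξ)`. The Taylor
expansion of `φ` at `0` gives the terms of the asymptotic expansion, and the remainder is controlled
by finitely many derivatives of `φ`, of high order, and of `g`, with polynomial losses in `w` and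
`y` (`exists_taylor_pairing_bound`). These losses are harmless: `⟨ξ + 2π√h w⟩` is comparable to `⟨ξ⟩` up
to powers of `1 + |w|` (`jap_add_rpow_le`), and `Λ(x + √h y, ξ)` is comparable to `Λ(x, ξ)` up to
powers of `1 + |y|` (`exists_Lam_le`). The latter is where ellipticity enters: `p(y, ξ) - p(x, ξ)`
is `O(|x - y| ⟨ξ⟩^m)`, which is bounded in terms of `|x - y| (1 + |p - z|)`, while `Λ² ≥ α ≥ h`.
Derivatives of `g` cost `√h Λ⁻¹ ≤ 1`, and each derivative of `φ` gains `√h ⟨ξ⟩⁻¹`; expanding to the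
order `2N` gives the bound of order `h^N` on the remainder of order `N` (`exists_remainder_le`).

The derivatives. The symbol `c = c[a, b]` is smooth and obeys the Leibniz rule
`∂ c[a, b] = c[∂a, b] + c[a, ∂b]` for each partial derivative in `x` or `ξ` (`hasFDerivAt_amp`): the
function `e^{2πi x·w} 𝓕(b(·, ξ))(w)` is a convolution with `b(·, ξ)`, and differentiating it amounts
to differentiating `b`. The terms of the expansion obey the same rule, hence so does the remainder,
and the derivatives of the remainder are sums of remainders of symbols with shifted weights
(`RemClass`), so that the bound without derivatives yields all symbol estimates
(`memSLam_remainder`). The statement on `c` itself is the case `N = 0`.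

The operators. For a test function `u`, `Op_h(b) u` is a composition symbol evaluated at `ξ = 0`,
hence smooth, and supported in `K`. The composition formula (`Op_Op`) follows from Fubini's theorem,
applied to the absolutely convergent Fourier representations.
-/

noncomputable section

namespace ExoticCalculus

open scoped FourierTransform RealInnerProductSpace

/-! ### Iterated partial derivatives -/

/-- Composition of powers of a family of operators `T i`, indexed by a multi-index. -/
def mop {n : ℕ} {X : Type*} (T : Fin n → X → X) (γ : Fin n → ℕ) (f : X) : X :=
  (List.finRange n).foldr (fun i g => (T i)^[γ i] g) f

/-- `Q` preserves the class `S` and is compatible with the relation `r`. -/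
structure OpOn {X : Type*} (S : X → Prop) (r : X → X → Prop) (Q : X → X) : Prop where
  pres : ∀ f, S f → S (Q f)
  congr : ∀ f g, r f g → r (Q f) (Q g)

section Abstract

variable {n : ℕ} {X : Type*} {S : X → Prop} {r : X → X → Prop} {T : Fin n → X → X}

lemma OpOn.iterate {Q : X → X} (hQ : OpOn S r Q) (k : ℕ) : OpOn S r (Q^[k]) := by
  induction k with
  | zero => exact ⟨fun f h => h, fun f g h => h⟩
  | succ k ih =>
    refine ⟨fun f h => ?_, fun f g h => ?_⟩
    · rw [Function.iterate_succ_apply']; exact hQ.pres _ (ih.pres _ h)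
    · rw [Function.iterate_succ_apply', Function.iterate_succ_apply']
      exact hQ.congr _ _ (ih.congr _ _ h)

lemma OpOn.foldr (hT : ∀ i, OpOn S r (T i)) (γ : Fin n → ℕ) (l : List (Fin n)) :
    OpOn S r (fun f => l.foldr (fun i g => (T i)^[γ i] g) f) := by
  induction l with
  | nil => exact ⟨fun f h => h, fun f g h => h⟩
  | cons j l ih =>
    exact ⟨fun f h => ((hT j).iterate _).pres _ (ih.pres _ h),
      fun f g h => ((hT j).iterate _).congr _ _ (ih.congr _ _ h)⟩

lemma OpOn.mop (hT : ∀ i, OpOn S r (T i)) (γ : Fin n → ℕ) : OpOn S r (mop T γ) :=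
  OpOn.foldr hT γ _

lemma iterate_comm_of_comm [IsTrans X r] [Std.Refl r] {P Q : X → X} (hP : OpOn S r P)
    (hc : ∀ f, S f → r (Q (P f)) (P (Q f))) (k : ℕ) (f : X) (hf : S f) :
    r (Q (P^[k] f)) (P^[k] (Q f)) := by
  induction k with
  | zero => exact refl _
  | succ k ih =>
    rw [Function.iterate_succ_apply', Function.iterate_succ_apply']
    exact _root_.trans (hc _ ((hP.iterate k).pres _ hf)) (hP.congr _ _ ih)

lemma foldr_comm [IsTrans X r] [Std.Refl r] (hT : ∀ i, OpOn S r (T i)) {Q : X → X}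
    (hc : ∀ i f, S f → r (Q (T i f)) (T i (Q f))) (γ : Fin n → ℕ) (l : List (Fin n))
    (f : X) (hf : S f) :
    r (Q (l.foldr (fun i g => (T i)^[γ i] g) f)) (l.foldr (fun i g => (T i)^[γ i] g) (Q f)) := by
  induction l with
  | nil => exact refl _
  | cons j l ih =>
    exact _root_.trans (iterate_comm_of_comm (hT j) (hc j) _ _ ((OpOn.foldr hT γ l).pres _ hf))
      (((hT j).iterate _).congr _ _ ih)

lemma mop_comm [IsTrans X r] [Std.Refl r] (hT : ∀ i, OpOn S r (T i)) {Q : X → X}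
    (hc : ∀ i f, S f → r (Q (T i f)) (T i (Q f))) (γ : Fin n → ℕ) (f : X) (hf : S f) :
    r (Q (mop T γ f)) (mop T γ (Q f)) :=
  foldr_comm hT hc γ _ f hf

lemma foldr_add_single_of_notMem (γ : Fin n → ℕ) (i : Fin n) (l : List (Fin n)) (hi : i ∉ l)
    (f : X) : l.foldr (fun j g => (T j)^[(γ + Pi.single i 1 : Fin n → ℕ) j] g) f =
      l.foldr (fun j g => (T j)^[γ j] g) f := by
  induction l with
  | nil => rfl
  | cons j l ih =>
    simp only [List.mem_cons, not_or] at hi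
    simp only [List.foldr_cons, ih hi.2]
    simp [Ne.symm hi.1]

lemma mop_add_single [IsTrans X r] [Std.Refl r] (hT : ∀ i, OpOn S r (T i))
    (hc : ∀ i j f, S f → r (T i (T j f)) (T j (T i f))) (γ : Fin n → ℕ) (i : Fin n)
    (f : X) (hf : S f) :
    r (T i (mop T γ f)) (mop T (γ + Pi.single i 1) f) := by
  suffices h : ∀ l : List (Fin n), l.Nodup → i ∈ l →
      r (T i (l.foldr (fun i g => (T i)^[γ i] g) f))
        (l.foldr (fun j g => (T j)^[(γ + Pi.single i 1 : Fin n → ℕ) j] g) f) from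
    h _ (List.nodup_finRange n) (List.mem_finRange i)
  intro l hl hi
  induction l with
  | nil => simp at hi
  | cons j l ih =>
    rw [List.nodup_cons] at hl
    by_cases hij : i = j
    · subst hij
      have := foldr_add_single_of_notMem (T := T) γ i l hl.1 f
      simp only [List.foldr_cons, this]
      simp only [Pi.add_apply, Pi.single_eq_same, Function.iterate_succ_apply']
      exact refl _
    · have hi' : i ∈ l := by simpa [hij] using hi
      simp only [List.foldr_cons]
      have e : (γ + Pi.single i 1 : Fin n → ℕ) j = γ j := by simp [Ne.symm hij]
      rw [e]
      exact _root_.trans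
        (iterate_comm_of_comm (hT j) (hc i j) _ _ ((OpOn.foldr hT γ l).pres _ hf))
        (((hT j).iterate _).congr _ _ (ih hl.2 hi'))

lemma mop_zero (f : X) : mop T 0 f = f := by
  unfold mop
  induction List.finRange n with
  | nil => rfl
  | cons j l ih => simp

/-- A property graded by the order of differentiation passes from the `T i` to `mop T γ`. -/
lemma mop_induction (P : ℕ → X → Prop) (hP : ∀ i k f, P k f → P (k + 1) (T i f))
    (γ : Fin n → ℕ) (k : ℕ) (f : X) (hf : P k f) : P (k + mlen γ) (mop T γ f) := by
  have it : ∀ (i : Fin n) (m k : ℕ) (f : X), P k f → P (k + m) ((T i)^[m] f) := by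
    intro i m
    induction m with
    | zero => intro k f h; exact h
    | succ m ih =>
      intro k f h
      rw [Function.iterate_succ_apply']
      exact hP _ _ _ (ih k f h)
  have hs : mlen γ = ((List.finRange n).map γ).sum := by
    rw [mlen, ← List.ofFn_eq_map, List.sum_ofFn]
  rw [hs]; unfold mop
  induction List.finRange n with
  | nil => simpa using hf
  | cons j l ih =>
    simp only [List.foldr_cons, List.map_cons, List.sum_cons]
    rw [add_comm (γ j), ← add_assoc]
    exact it _ _ _ _ ih

end Abstract

lemma mlen_add_single {n : ℕ} (γ : Fin n → ℕ) (i : Fin n) :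
    mlen (γ + Pi.single i 1) = mlen γ + 1 := by
  simp [mlen, Finset.sum_add_distrib]

lemma exists_eq_add_single {n k : ℕ} (γ : Fin n → ℕ) (h : mlen γ = k + 1) :
    ∃ i δ, γ = δ + Pi.single i 1 ∧ mlen δ = k := by
  have : ∃ i, γ i ≠ 0 := by
    by_contra! hc
    simp [mlen, hc] at h
  obtain ⟨i, hi⟩ := this
  have e : γ = (γ - Pi.single i 1) + Pi.single i 1 := by
    funext j
    by_cases hj : j = i
    · subst hj; simp; omega
    · simp [hj]
  refine ⟨i, γ - Pi.single i 1, e, ?_⟩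
  rw [e, mlen_add_single] at h
  omega

section OneVariable

variable {n : ℕ} {U : Set (Eucl n)}

/-- The basis vector `eᵢ`. -/
abbrev bvec {n : ℕ} (i : Fin n) : Eucl n := EuclideanSpace.single i 1

instance : IsTrans (Eucl n → ℂ) (fun f g => Set.EqOn f g U) := ⟨fun _ _ _ h h' => h.trans h'⟩
instance : Std.Refl (fun f g : Eucl n → ℂ => Set.EqOn f g U) := ⟨fun f => Set.eqOn_refl f U⟩

lemma pderiv_eqOn (hU : IsOpen U) (i : Fin n) {f g : Eucl n → ℂ} (h : Set.EqOn f g U) :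
    Set.EqOn (pderiv i f) (pderiv i g) U := by
  intro x hx
  unfold pderiv
  rw [Filter.EventuallyEq.fderiv_eq (h.eventuallyEq_of_mem (hU.mem_nhds hx))]

lemma contDiffOn_pderiv (hU : IsOpen U) (i : Fin n) {f : Eucl n → ℂ} (hf : ContDiffOn ℝ ∞ f U) :
    ContDiffOn ℝ ∞ (pderiv i f) U :=
  (hf.fderiv_of_isOpen hU (by simp)).clm_apply contDiffOn_const

/-- Directional derivatives of a smooth function commute. -/
lemma fderiv_fderiv_comm {W : Type*} [NormedAddCommGroup W] [NormedSpace ℝ W] {s : Set W}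
    (hs : IsOpen s) {f : W → ℂ} (hf : ContDiffOn ℝ ∞ f s) {x : W} (hx : x ∈ s) (u v : W) :
    fderiv ℝ (fun y => fderiv ℝ f y u) x v = fderiv ℝ (fun y => fderiv ℝ f y v) x u := by
  have h1 : ContDiffAt ℝ ∞ f x := hf.contDiffAt (hs.mem_nhds hx)
  have h2 : DifferentiableAt ℝ (fderiv ℝ f) x :=
    (h1.fderiv_right (m := 1) (by norm_cast)).differentiableAt (by simp)
  have h3 := h1.isSymmSndFDerivAt (by simp; norm_cast)
  have e : ∀ u v : W, fderiv ℝ (fun y => fderiv ℝ f y u) x v = fderiv ℝ (fderiv ℝ f) x v u := by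
    intro u v
    rw [fderiv_clm_apply h2 (differentiableAt_const _)]
    simp
  rw [e, e, h3.eq]

lemma pderiv_comm (hU : IsOpen U) (i j : Fin n) {f : Eucl n → ℂ} (hf : ContDiffOn ℝ ∞ f U) :
    Set.EqOn (pderiv i (pderiv j f)) (pderiv j (pderiv i f)) U :=
  fun _ hx => fderiv_fderiv_comm hU hf hx _ _

lemma opOn_pderiv (hU : IsOpen U) (i : Fin n) :
    OpOn (fun f => ContDiffOn ℝ ∞ f U) (fun f g => Set.EqOn f g U) (pderiv i) :=
  ⟨fun _ h => contDiffOn_pderiv hU i h, fun _ _ h => pderiv_eqOn hU i h⟩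

lemma contDiff_pderiv (i : Fin n) {f : Eucl n → ℂ} (hf : ContDiff ℝ ∞ f) :
    ContDiff ℝ ∞ (pderiv i f) :=
  contDiffOn_univ.1 (contDiffOn_pderiv isOpen_univ i hf.contDiffOn)

lemma contDiff_mderiv (γ : Fin n → ℕ) {f : Eucl n → ℂ} (hf : ContDiff ℝ ∞ f) :
    ContDiff ℝ ∞ (mderiv γ f) :=
  contDiffOn_univ.1 ((OpOn.mop (opOn_pderiv isOpen_univ) γ).pres _ hf.contDiffOn)

lemma pderiv_mderiv (γ : Fin n → ℕ) (i : Fin n) {f : Eucl n → ℂ} (hf : ContDiff ℝ ∞ f) :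
    pderiv i (mderiv γ f) = mderiv (γ + Pi.single i 1) f := by
  have := mop_add_single (opOn_pderiv (n := n) isOpen_univ)
    (fun i j f hf => pderiv_comm isOpen_univ i j hf) γ i f hf.contDiffOn
  exact funext fun x => this (Set.mem_univ x)

lemma mderiv_pderiv (γ : Fin n → ℕ) (i : Fin n) {f : Eucl n → ℂ} (hf : ContDiff ℝ ∞ f) :
    mderiv γ (pderiv i f) = mderiv (γ + Pi.single i 1) f := by
  rw [← pderiv_mderiv γ i hf]
  have := mop_comm (opOn_pderiv (n := n) isOpen_univ)
    (fun j f hf => pderiv_comm isOpen_univ i j hf) γ f hf.contDiffOn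
  exact funext fun x => (this (Set.mem_univ x)).symm

lemma mderiv_zero (f : Eucl n → ℂ) : mderiv 0 f = f := mop_zero f

end OneVariable

section TwoVariables

variable {n : ℕ} {U : Set (Eucl n)}

/-- The partial derivative `∂_{xᵢ} a`. -/
def pX {n : ℕ} (i : Fin n) (a : Eucl n → Eucl n → ℂ) : Eucl n → Eucl n → ℂ :=
  fun x ξ => pderiv i (fun y => a y ξ) x

/-- The partial derivative `∂_{ξᵢ} a`. -/
def pXi {n : ℕ} (i : Fin n) (a : Eucl n → Eucl n → ℂ) : Eucl n → Eucl n → ℂ :=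
  fun x ξ => pderiv i (a x) ξ

lemma dX_eq_mop (γ : Fin n → ℕ) (a : Eucl n → Eucl n → ℂ) : dX γ a = mop pX γ a := by
  have it : ∀ (i : Fin n) (k : ℕ) (a : Eucl n → Eucl n → ℂ) (ξ : Eucl n),
      (fun x => (pX i)^[k] a x ξ) = (pderiv i)^[k] (fun x => a x ξ) := by
    intro i k a ξ
    induction k with
    | zero => rfl
    | succ k ih => rw [Function.iterate_succ_apply', Function.iterate_succ_apply', ← ih]; rfl
  suffices h : ∀ (l : List (Fin n)) (ξ : Eucl n),
      (fun x => l.foldr (fun i g => (pX i)^[γ i] g) a x ξ) =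
        l.foldr (fun i g => (pderiv i)^[γ i] g) (fun x => a x ξ) by
    funext x ξ; exact (congrFun (h (List.finRange n) ξ) x).symm
  intro l ξ
  induction l with
  | nil => rfl
  | cons j l ih => simp only [List.foldr_cons]; rw [it, ih]

lemma dXi_eq_mop (γ : Fin n → ℕ) (a : Eucl n → Eucl n → ℂ) : dXi γ a = mop pXi γ a := by
  have it : ∀ (i : Fin n) (k : ℕ) (a : Eucl n → Eucl n → ℂ) (x : Eucl n),
      (pXi i)^[k] a x = (pderiv i)^[k] (a x) := by
    intro i k a ξ
    induction k with
    | zero => rfl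
    | succ k ih => rw [Function.iterate_succ_apply', Function.iterate_succ_apply', ← ih]; rfl
  suffices h : ∀ (l : List (Fin n)) (x : Eucl n),
      (l.foldr (fun i g => (pXi i)^[γ i] g) a x) =
        l.foldr (fun i g => (pderiv i)^[γ i] g) (a x) by
    funext x ξ; exact (congrFun (h (List.finRange n) x) ξ).symm
  intro l ξ
  induction l with
  | nil => rfl
  | cons j l ih => simp only [List.foldr_cons]; rw [it, ih]

/-- Smoothness on `U × ℝⁿ`. -/
def Smooth2 {n : ℕ} (U : Set (Eucl n)) (a : Eucl n → Eucl n → ℂ) : Prop :=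
  ContDiffOn ℝ ∞ (fun v : Eucl n × Eucl n => a v.1 v.2) (U ×ˢ Set.univ)

/-- Equality on `U × ℝⁿ`. -/
def EqOn2 {n : ℕ} (U : Set (Eucl n)) (a b : Eucl n → Eucl n → ℂ) : Prop :=
  ∀ x ∈ U, ∀ ξ, a x ξ = b x ξ

instance : IsTrans (Eucl n → Eucl n → ℂ) (EqOn2 U) :=
  ⟨fun _ _ _ h h' x hx ξ => (h x hx ξ).trans (h' x hx ξ)⟩
instance : Std.Refl (EqOn2 (n := n) U) := ⟨fun _ _ _ _ => rfl⟩

lemma EqOn2.symm {a b : Eucl n → Eucl n → ℂ} (h : EqOn2 U a b) : EqOn2 U b a :=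
  fun x hx ξ => (h x hx ξ).symm

lemma EqOn2.smooth2 {a b : Eucl n → Eucl n → ℂ} (h : EqOn2 U a b) (hb : Smooth2 U b) :
    Smooth2 U a :=
  ContDiffOn.congr hb fun v hv => h v.1 hv.1 v.2

lemma Smooth2.contDiffAt (hU : IsOpen U) {a : Eucl n → Eucl n → ℂ} (ha : Smooth2 U a)
    {x : Eucl n} (hx : x ∈ U) (ξ : Eucl n) :
    ContDiffAt ℝ ∞ (fun v : Eucl n × Eucl n => a v.1 v.2) (x, ξ) :=
  ContDiffOn.contDiffAt ha ((hU.prod isOpen_univ).mem_nhds ⟨hx, Set.mem_univ _⟩)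

lemma Smooth2.differentiableAt (hU : IsOpen U) {a : Eucl n → Eucl n → ℂ} (ha : Smooth2 U a)
    {x : Eucl n} (hx : x ∈ U) (ξ : Eucl n) :
    DifferentiableAt ℝ (fun v : Eucl n × Eucl n => a v.1 v.2) (x, ξ) :=
  (ha.contDiffAt hU hx ξ).differentiableAt (by simp)

lemma pX_eq_fderiv {a : Eucl n → Eucl n → ℂ} {x ξ : Eucl n}
    (h : DifferentiableAt ℝ (fun v : Eucl n × Eucl n => a v.1 v.2) (x, ξ)) (i : Fin n) :
    pX i a x ξ = fderiv ℝ (fun v : Eucl n × Eucl n => a v.1 v.2) (x, ξ) (bvec i, 0) := by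
  have h1 : HasFDerivAt (fun y : Eucl n => (y, ξ)) ((ContinuousLinearMap.id ℝ (Eucl n)).prod 0) x :=
    (hasFDerivAt_id x).prodMk (hasFDerivAt_const ξ x)
  have h2 : fderiv ℝ (fun y => a y ξ) x = _ :=
    (HasFDerivAt.comp (g := fun v : Eucl n × Eucl n => a v.1 v.2) x h.hasFDerivAt h1).fderiv
  unfold pX pderiv
  rw [h2]
  simp

lemma pXi_eq_fderiv {a : Eucl n → Eucl n → ℂ} {x ξ : Eucl n}
    (h : DifferentiableAt ℝ (fun v : Eucl n × Eucl n => a v.1 v.2) (x, ξ)) (i : Fin n) :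
    pXi i a x ξ = fderiv ℝ (fun v : Eucl n × Eucl n => a v.1 v.2) (x, ξ) (0, bvec i) := by
  have h1 : HasFDerivAt (fun y : Eucl n => (x, y))
      ((0 : Eucl n →L[ℝ] Eucl n).prod (ContinuousLinearMap.id ℝ (Eucl n))) ξ :=
    (hasFDerivAt_const x ξ).prodMk (hasFDerivAt_id ξ)
  have h2 : fderiv ℝ (a x) ξ = _ :=
    (HasFDerivAt.comp (g := fun v : Eucl n × Eucl n => a v.1 v.2) ξ h.hasFDerivAt h1).fderiv
  unfold pXi pderiv
  rw [h2]
  simp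

lemma Smooth2.fderiv_apply (hU : IsOpen U) {a : Eucl n → Eucl n → ℂ} (ha : Smooth2 U a)
    (e : Eucl n × Eucl n) :
    ContDiffOn ℝ ∞ (fun v => fderiv ℝ (fun v : Eucl n × Eucl n => a v.1 v.2) v e)
      (U ×ˢ Set.univ) :=
  (ContDiffOn.fderiv_of_isOpen ha (hU.prod isOpen_univ) (by simp)).clm_apply contDiffOn_const

lemma Smooth2.pX (hU : IsOpen U) {a : Eucl n → Eucl n → ℂ} (ha : Smooth2 U a) (i : Fin n) :
    Smooth2 U (pX i a) :=
  (ha.fderiv_apply hU (bvec i, 0)).congr fun v hv =>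
    pX_eq_fderiv (ha.differentiableAt hU hv.1 v.2) i

lemma Smooth2.pXi (hU : IsOpen U) {a : Eucl n → Eucl n → ℂ} (ha : Smooth2 U a) (i : Fin n) :
    Smooth2 U (pXi i a) :=
  (ha.fderiv_apply hU (0, bvec i)).congr fun v hv =>
    pXi_eq_fderiv (ha.differentiableAt hU hv.1 v.2) i

lemma opOn_pX (hU : IsOpen U) (i : Fin n) : OpOn (Smooth2 U) (EqOn2 U) (pX i) :=
  ⟨fun _ h => h.pX hU i, fun _ _ h _ hx ξ => pderiv_eqOn hU i (fun y hy => h y hy ξ) hx⟩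

lemma opOn_pXi (hU : IsOpen U) (i : Fin n) : OpOn (Smooth2 U) (EqOn2 U) (pXi i) :=
  ⟨fun _ h => h.pXi hU i, fun f g h x hx _ => by
    unfold pXi; rw [show f x = g x from funext (h x hx)]⟩

/-- The partial derivative in the direction `e` of a function on the product. -/
def pdir {n : ℕ} (e : Eucl n × Eucl n) (a : Eucl n → Eucl n → ℂ) : Eucl n → Eucl n → ℂ :=
  fun x ξ => fderiv ℝ (fun v : Eucl n × Eucl n => a v.1 v.2) (x, ξ) e

lemma EqOn2.pdir (hU : IsOpen U) {a b : Eucl n → Eucl n → ℂ} (h : EqOn2 U a b)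
    (e : Eucl n × Eucl n) : EqOn2 U (pdir e a) (pdir e b) := by
  intro x hx ξ
  unfold ExoticCalculus.pdir
  have : (fun v : Eucl n × Eucl n => a v.1 v.2) =ᶠ[nhds (x, ξ)] fun v => b v.1 v.2 := by
    filter_upwards [(hU.prod isOpen_univ).mem_nhds (⟨hx, Set.mem_univ ξ⟩ : (x, ξ) ∈ U ×ˢ Set.univ)]
      with v hv using h v.1 hv.1 v.2
  rw [this.fderiv_eq]

lemma pX_eqOn_pdir (hU : IsOpen U) {a : Eucl n → Eucl n → ℂ} (ha : Smooth2 U a) (i : Fin n) :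
    EqOn2 U (pX i a) (pdir (bvec i, 0) a) :=
  fun _ hx ξ => pX_eq_fderiv (ha.differentiableAt hU hx ξ) i

lemma pXi_eqOn_pdir (hU : IsOpen U) {a : Eucl n → Eucl n → ℂ} (ha : Smooth2 U a) (i : Fin n) :
    EqOn2 U (pXi i a) (pdir (0, bvec i) a) :=
  fun _ hx ξ => pXi_eq_fderiv (ha.differentiableAt hU hx ξ) i

lemma Smooth2.pdir (hU : IsOpen U) {a : Eucl n → Eucl n → ℂ} (ha : Smooth2 U a)
    (e : Eucl n × Eucl n) : Smooth2 U (pdir e a) :=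
  ha.fderiv_apply hU e

lemma pdir_comm (hU : IsOpen U) {a : Eucl n → Eucl n → ℂ} (ha : Smooth2 U a)
    (e e' : Eucl n × Eucl n) : EqOn2 U (pdir e (pdir e' a)) (pdir e' (pdir e a)) :=
  fun _ hx _ => fderiv_fderiv_comm (hU.prod isOpen_univ) ha ⟨hx, Set.mem_univ _⟩ e' e

lemma comm_of_eqOn_pdir (hU : IsOpen U) {P Q : (Eucl n → Eucl n → ℂ) → Eucl n → Eucl n → ℂ}
    {e e' : Eucl n × Eucl n} (hP : ∀ a, Smooth2 U a → EqOn2 U (P a) (pdir e a))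
    (hQ : ∀ a, Smooth2 U a → EqOn2 U (Q a) (pdir e' a)) {a : Eucl n → Eucl n → ℂ}
    (ha : Smooth2 U a) : EqOn2 U (P (Q a)) (Q (P a)) := by
  have h1 : EqOn2 U (P (Q a)) (pdir e (pdir e' a)) :=
    _root_.trans (hP _ ((hQ a ha).smooth2 (ha.pdir hU e'))) ((hQ a ha).pdir hU e)
  have h2 : EqOn2 U (Q (P a)) (pdir e' (pdir e a)) :=
    _root_.trans (hQ _ ((hP a ha).smooth2 (ha.pdir hU e))) ((hP a ha).pdir hU e')
  exact _root_.trans h1 (_root_.trans (pdir_comm hU ha e e') h2.symm)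

lemma pX_pX_comm (hU : IsOpen U) (i j : Fin n) {a : Eucl n → Eucl n → ℂ} (ha : Smooth2 U a) :
    EqOn2 U (pX i (pX j a)) (pX j (pX i a)) :=
  comm_of_eqOn_pdir hU (fun _ h => pX_eqOn_pdir hU h i) (fun _ h => pX_eqOn_pdir hU h j) ha

lemma pX_pXi_comm (hU : IsOpen U) (i j : Fin n) {a : Eucl n → Eucl n → ℂ} (ha : Smooth2 U a) :
    EqOn2 U (pX i (pXi j a)) (pXi j (pX i a)) :=
  comm_of_eqOn_pdir hU (fun _ h => pX_eqOn_pdir hU h i) (fun _ h => pXi_eqOn_pdir hU h j) ha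

lemma pXi_pXi_comm (hU : IsOpen U) (i j : Fin n) {a : Eucl n → Eucl n → ℂ} (ha : Smooth2 U a) :
    EqOn2 U (pXi i (pXi j a)) (pXi j (pXi i a)) :=
  comm_of_eqOn_pdir hU (fun _ h => pXi_eqOn_pdir hU h i) (fun _ h => pXi_eqOn_pdir hU h j) ha

lemma Smooth2.dX (hU : IsOpen U) {a : Eucl n → Eucl n → ℂ} (ha : Smooth2 U a) (γ : Fin n → ℕ) :
    Smooth2 U (dX γ a) := by
  rw [dX_eq_mop]; exact (OpOn.mop (opOn_pX hU) γ).pres _ ha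

lemma Smooth2.dXi (hU : IsOpen U) {a : Eucl n → Eucl n → ℂ} (ha : Smooth2 U a)
    (γ : Fin n → ℕ) : Smooth2 U (dXi γ a) := by
  rw [dXi_eq_mop]; exact (OpOn.mop (opOn_pXi hU) γ).pres _ ha

lemma dX_congr (hU : IsOpen U) {a b : Eucl n → Eucl n → ℂ} (h : EqOn2 U a b) (γ : Fin n → ℕ) :
    EqOn2 U (dX γ a) (dX γ b) := by
  rw [dX_eq_mop, dX_eq_mop]; exact (OpOn.mop (opOn_pX hU) γ).congr _ _ h

lemma pX_dX (hU : IsOpen U) {a : Eucl n → Eucl n → ℂ} (ha : Smooth2 U a) (γ : Fin n → ℕ)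
    (i : Fin n) : EqOn2 U (pX i (dX γ a)) (dX γ (pX i a)) := by
  simp only [dX_eq_mop]
  exact mop_comm (opOn_pX hU) (fun j f hf => pX_pX_comm hU i j hf) γ a ha

lemma pX_dXi (hU : IsOpen U) {a : Eucl n → Eucl n → ℂ} (ha : Smooth2 U a) (γ : Fin n → ℕ)
    (i : Fin n) : EqOn2 U (pX i (dXi γ a)) (dXi γ (pX i a)) := by
  simp only [dXi_eq_mop]
  exact mop_comm (opOn_pXi hU) (fun j f hf => pX_pXi_comm hU i j hf) γ a ha

lemma pXi_dXi (hU : IsOpen U) {a : Eucl n → Eucl n → ℂ} (ha : Smooth2 U a) (γ : Fin n → ℕ)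
    (i : Fin n) : EqOn2 U (pXi i (dXi γ a)) (dXi γ (pXi i a)) := by
  simp only [dXi_eq_mop]
  exact mop_comm (opOn_pXi hU) (fun j f hf => pXi_pXi_comm hU i j hf) γ a ha

lemma dX_pX (hU : IsOpen U) {a : Eucl n → Eucl n → ℂ} (ha : Smooth2 U a) (γ : Fin n → ℕ)
    (i : Fin n) : EqOn2 U (dX γ (pX i a)) (dX (γ + Pi.single i 1) a) := by
  refine _root_.trans (pX_dX hU ha γ i).symm ?_
  simp only [dX_eq_mop]
  exact mop_add_single (opOn_pX hU) (fun i j f hf => pX_pX_comm hU i j hf) γ i a ha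

lemma dXi_pXi (hU : IsOpen U) {a : Eucl n → Eucl n → ℂ} (ha : Smooth2 U a) (γ : Fin n → ℕ)
    (i : Fin n) : EqOn2 U (dXi γ (pXi i a)) (dXi (γ + Pi.single i 1) a) := by
  refine _root_.trans (pXi_dXi hU ha γ i).symm ?_
  simp only [dXi_eq_mop]
  exact mop_add_single (opOn_pXi hU) (fun i j f hf => pXi_pXi_comm hU i j hf) γ i a ha

lemma dX_dXi_pX (hU : IsOpen U) {a : Eucl n → Eucl n → ℂ} (ha : Smooth2 U a)
    (γ β : Fin n → ℕ) (i : Fin n) :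
    EqOn2 U (dX γ (dXi β (pX i a))) (dX (γ + Pi.single i 1) (dXi β a)) :=
  _root_.trans (dX_congr hU (pX_dXi hU ha β i).symm γ) (dX_pX hU (ha.dXi hU β) γ i)

lemma dX_dXi_pXi (hU : IsOpen U) {a : Eucl n → Eucl n → ℂ} (ha : Smooth2 U a)
    (γ β : Fin n → ℕ) (i : Fin n) :
    EqOn2 U (dX γ (dXi β (pXi i a))) (dX γ (dXi (β + Pi.single i 1) a)) :=
  dX_congr hU (dXi_pXi hU ha β i) γ

end TwoVariables

/-! ### Bounds on all derivatives up to a given order -/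

section Bounds

variable {n : ℕ}

lemma pderiv_add {f g : Eucl n → ℂ} (hf : ContDiff ℝ ∞ f) (hg : ContDiff ℝ ∞ g) (i : Fin n) :
    pderiv i (fun x => f x + g x) = fun x => pderiv i f x + pderiv i g x := by
  funext x
  unfold pderiv
  rw [fderiv_fun_add (hf.differentiable (by simp) x) (hg.differentiable (by simp) x)]
  rfl

lemma pderiv_sub {f g : Eucl n → ℂ} (hf : ContDiff ℝ ∞ f) (hg : ContDiff ℝ ∞ g) (i : Fin n) :
    pderiv i (fun x => f x - g x) = fun x => pderiv i f x - pderiv i g x := by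
  funext x
  unfold pderiv
  rw [fderiv_fun_sub (hf.differentiable (by simp) x) (hg.differentiable (by simp) x)]
  rfl

lemma pderiv_sum {ι : Type*} (s : Finset ι) {f : ι → Eucl n → ℂ}
    (hf : ∀ j ∈ s, ContDiff ℝ ∞ (f j)) (i : Fin n) :
    pderiv i (fun x => ∑ j ∈ s, f j x) = fun x => ∑ j ∈ s, pderiv i (f j) x := by
  funext x
  unfold pderiv
  rw [fderiv_fun_sum (fun j hj => (hf j hj).differentiable (by simp) x)]
  simp

lemma pderiv_mul {f g : Eucl n → ℂ} (hf : ContDiff ℝ ∞ f) (hg : ContDiff ℝ ∞ g) (i : Fin n) :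
    pderiv i (fun x => f x * g x) = fun x => pderiv i f x * g x + f x * pderiv i g x := by
  funext x
  unfold pderiv
  rw [fderiv_fun_mul (hf.differentiable (by simp) x) (hg.differentiable (by simp) x)]
  simp; ring

lemma pderiv_const_mul {f : Eucl n → ℂ} (hf : ContDiff ℝ ∞ f) (c : ℂ) (i : Fin n) :
    pderiv i (fun x => c * f x) = fun x => c * pderiv i f x := by
  funext x
  unfold pderiv
  rw [fderiv_const_mul (hf.differentiable (by simp) x)]
  simp

lemma pderiv_const (c : ℂ) (i : Fin n) : pderiv i (fun _ : Eucl n => c) = fun _ => 0 := by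
  funext x
  simp [pderiv]

/-- `Bd D W C f`: all iterated partial derivatives of `f`, of order at most `D`, are bounded by
`C * W`. -/
def Bd : ℕ → (Eucl n → ℝ) → ℝ → (Eucl n → ℂ) → Prop
  | 0, W, C, f => ∀ x, ‖f x‖ ≤ C * W x
  | D + 1, W, C, f => (∀ x, ‖f x‖ ≤ C * W x) ∧ ∀ i, Bd D W C (pderiv i f)

lemma Bd.le {D : ℕ} {W : Eucl n → ℝ} {C : ℝ} {f : Eucl n → ℂ} (h : Bd D W C f) (x : Eucl n) :
    ‖f x‖ ≤ C * W x := by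
  cases D with
  | zero => exact h x
  | succ D => exact h.1 x

lemma Bd.mono {D : ℕ} {W W' : Eucl n → ℝ} {C C' : ℝ} {f : Eucl n → ℂ} (h : Bd D W C f)
    (hW : ∀ x, C * W x ≤ C' * W' x) : Bd D W' C' f := by
  induction D generalizing f with
  | zero => exact fun x => (h x).trans (hW x)
  | succ D ih => exact ⟨fun x => (h.1 x).trans (hW x), fun i => ih (h.2 i)⟩

lemma Bd.pred {D : ℕ} {W : Eucl n → ℝ} {C : ℝ} {f : Eucl n → ℂ} (h : Bd (D + 1) W C f) :
    Bd D W C f := by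
  induction D generalizing f with
  | zero => exact h.1
  | succ D ih => exact ⟨h.1, fun i => ih (h.2 i)⟩

lemma Bd.of_le {D D' : ℕ} {W : Eucl n → ℝ} {C : ℝ} {f : Eucl n → ℂ} (h : Bd D W C f)
    (hD : D' ≤ D) : Bd D' W C f := by
  induction D, hD using Nat.le_induction with
  | base => exact h
  | succ D _ ih => exact ih h.pred

lemma Bd.add {D : ℕ} {W : Eucl n → ℝ} {C C' : ℝ} {f g : Eucl n → ℂ} (hf : ContDiff ℝ ∞ f)
    (hg : ContDiff ℝ ∞ g) (h : Bd D W C f) (h' : Bd D W C' g) :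
    Bd D W (C + C') (fun x => f x + g x) := by
  have key : ∀ x, ‖f x‖ ≤ C * W x → ‖g x‖ ≤ C' * W x → ‖f x + g x‖ ≤ (C + C') * W x := by
    intro x h1 h2
    rw [add_mul]; exact (norm_add_le _ _).trans (add_le_add h1 h2)
  induction D generalizing f g with
  | zero => exact fun x => key x (h x) (h' x)
  | succ D ih =>
    refine ⟨fun x => key x (h.1 x) (h'.1 x), fun i => ?_⟩
    rw [pderiv_add hf hg]
    refine ih (contDiff_pderiv i hf) (contDiff_pderiv i hg) (h.2 i) (h'.2 i) ?_
    intro x h1 h2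
    rw [add_mul]; exact (norm_add_le _ _).trans (add_le_add h1 h2)

lemma Bd.const_mul {D : ℕ} {W : Eucl n → ℝ} {C : ℝ} {f : Eucl n → ℂ} (hf : ContDiff ℝ ∞ f)
    (c : ℂ) (h : Bd D W C f) : Bd D W (‖c‖ * C) (fun x => c * f x) := by
  induction D generalizing f with
  | zero =>
    intro x
    rw [norm_mul, mul_assoc]
    exact mul_le_mul_of_nonneg_left (h x) (norm_nonneg _)
  | succ D ih =>
    refine ⟨fun x => ?_, fun i => ?_⟩
    · rw [norm_mul, mul_assoc]
      exact mul_le_mul_of_nonneg_left (h.1 x) (norm_nonneg _)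
    · rw [pderiv_const_mul hf]
      exact ih (contDiff_pderiv i hf) (h.2 i)

lemma Bd.zero (D : ℕ) (W : Eucl n → ℝ) : Bd D W 0 (fun _ => 0) := by
  induction D with
  | zero => intro x; simp
  | succ D ih => exact ⟨fun x => by simp, fun i => by rw [pderiv_const]; exact ih⟩

lemma Bd.sum {ι : Type*} (s : Finset ι) {D : ℕ} {W : Eucl n → ℝ} {C : ι → ℝ}
    {f : ι → Eucl n → ℂ} (hf : ∀ j ∈ s, ContDiff ℝ ∞ (f j)) (h : ∀ j ∈ s, Bd D W (C j) (f j)) :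
    Bd D W (∑ j ∈ s, C j) (fun x => ∑ j ∈ s, f j x) := by
  classical
  induction s using Finset.induction_on with
  | empty => simpa using Bd.zero D W
  | insert a s ha ih =>
    simp only [Finset.sum_insert ha]
    exact Bd.add (hf a (by simp)) (ContDiff.sum fun j hj => hf j (by simp [hj]))
      (h a (by simp)) (ih (fun j hj => hf j (by simp [hj])) (fun j hj => h j (by simp [hj])))

/-- The Leibniz formula produces at most `2 ^ D` terms. -/
lemma Bd.mul {D : ℕ} {W W' : Eucl n → ℝ} {C C' : ℝ} {f g : Eucl n → ℂ} (hf : ContDiff ℝ ∞ f)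
    (hg : ContDiff ℝ ∞ g) (h : Bd D W C f) (h' : Bd D W' C' g) :
    Bd D (fun x => W x * W' x) (2 ^ D * (C * C')) (fun x => f x * g x) := by
  have key : ∀ (f g : Eucl n → ℂ) x, ‖f x‖ ≤ C * W x → ‖g x‖ ≤ C' * W' x →
      ‖f x * g x‖ ≤ (C * C') * (W x * W' x) := by
    intro f g x h1 h2
    rw [norm_mul, mul_mul_mul_comm]
    exact mul_le_mul h1 h2 (norm_nonneg _) ((norm_nonneg _).trans h1)
  induction D generalizing f g with
  | zero => intro x; simpa using key f g x (h x) (h' x)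
  | succ D ih =>
    refine ⟨fun x => (key f g x (h.1 x) (h'.1 x)).trans ?_, fun i => ?_⟩
    · have h0 := (norm_nonneg _).trans (key f g x (h.1 x) (h'.1 x))
      have h2 : (1 : ℝ) ≤ 2 ^ (D + 1) := one_le_pow₀ (by norm_num)
      exact (le_mul_of_one_le_left h0 h2).trans (le_of_eq (by ring))
    · rw [pderiv_mul hf hg]
      have h1 := ih (contDiff_pderiv i hf) hg (h.2 i) h'.pred
      have h2 := ih hf (contDiff_pderiv i hg) h.pred (h'.2 i)
      refine (Bd.add ((contDiff_pderiv i hf).mul hg) (hf.mul (contDiff_pderiv i hg)) h1 h2).mono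
        fun x => le_of_eq ?_
      ring

lemma Bd.of_mderiv {D : ℕ} {W : Eucl n → ℝ} {C : ℝ} {f : Eucl n → ℂ} (hf : ContDiff ℝ ∞ f)
    (h : ∀ γ : Fin n → ℕ, mlen γ ≤ D → ∀ x, ‖mderiv γ f x‖ ≤ C * W x) : Bd D W C f := by
  induction D generalizing f with
  | zero =>
    intro x
    have := h 0 (by simp [mlen]) x
    rwa [mderiv_zero] at this
  | succ D ih =>
    refine ⟨fun x => ?_, fun i => ih (contDiff_pderiv i hf) fun γ hγ x => ?_⟩
    · have := h 0 (by simp [mlen]) x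
      rwa [mderiv_zero] at this
    · rw [mderiv_pderiv γ i hf]
      exact h _ (by rw [mlen_add_single]; omega) x

/-- The operator `1 - Δ / (4π²)`, which the Fourier transform, normalized with `e^{-2πi x·w}`, turns
into multiplication by `1 + |w|²`. -/
def opL (f : Eucl n → ℂ) : Eucl n → ℂ :=
  fun x => f x + (-(1 / (4 * Real.pi ^ 2) : ℝ) : ℂ) * ∑ i, pderiv i (pderiv i f) x

lemma contDiff_opL {f : Eucl n → ℂ} (hf : ContDiff ℝ ∞ f) : ContDiff ℝ ∞ (opL f) :=
  hf.add (contDiff_const.mul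
    (ContDiff.sum fun i _ => contDiff_pderiv i (contDiff_pderiv i hf)))

lemma contDiff_opL_iterate {f : Eucl n → ℂ} (hf : ContDiff ℝ ∞ f) (s : ℕ) :
    ContDiff ℝ ∞ (opL^[s] f) := by
  induction s with
  | zero => exact hf
  | succ s ih => rw [Function.iterate_succ_apply']; exact contDiff_opL ih

lemma Bd.opL {D : ℕ} {W : Eucl n → ℝ} {C : ℝ} {f : Eucl n → ℂ} (hf : ContDiff ℝ ∞ f)
    (h : Bd (D + 2) W C f) : Bd D W ((1 + n) * C) (opL f) := by
  have h1 : Bd D W (∑ _i : Fin n, C) (fun x => ∑ i, pderiv i (pderiv i f) x) :=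
    Bd.sum _ (fun i _ => contDiff_pderiv i (contDiff_pderiv i hf)) fun i _ => (h.2 i).2 i
  have h2 := h1.const_mul (ContDiff.sum fun i _ => contDiff_pderiv i (contDiff_pderiv i hf))
    (-(1 / (4 * Real.pi ^ 2) : ℝ) : ℂ)
  refine ((h.of_le (by omega)).add hf (contDiff_const.mul
    (ContDiff.sum fun i _ => contDiff_pderiv i (contDiff_pderiv i hf))) h2).mono fun x => ?_
  have h0 : 0 ≤ C * W x := (norm_nonneg _).trans (h.le x)
  have h3 : ‖(-(1 / (4 * Real.pi ^ 2) : ℝ) : ℂ)‖ ≤ 1 := by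
    rw [norm_neg, Complex.norm_real, Real.norm_of_nonneg (by positivity),
      div_le_one (by positivity)]
    nlinarith [Real.pi_gt_three]
  have h4 := mul_le_mul_of_nonneg_right h3 (mul_nonneg (Nat.cast_nonneg (α := ℝ) n) h0)
  simp only [Finset.sum_const, Finset.card_univ, Fintype.card_fin, nsmul_eq_mul]
  nlinarith

lemma Bd.opL_iterate {D s : ℕ} {W : Eucl n → ℝ} {C : ℝ} {f : Eucl n → ℂ} (hf : ContDiff ℝ ∞ f)
    (h : Bd (D + 2 * s) W C f) : Bd D W ((1 + n) ^ s * C) (ExoticCalculus.opL^[s] f) := by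
  induction s generalizing f C with
  | zero => simpa using h
  | succ s ih =>
    rw [Function.iterate_succ_apply]
    refine (ih (contDiff_opL hf) (Bd.opL hf (h.of_le (by omega)))).mono fun x => le_of_eq ?_
    ring

/-- The coordinate `wᵢ`, as a complex valued function. -/
def coordC (i : Fin n) (w : Eucl n) : ℂ := (w i : ℝ)

/-- The function `(1 + |w|²)⁻¹`, as a complex valued function. -/
def invJ (w : Eucl n) : ℂ := ((1 + ‖w‖ ^ 2)⁻¹ : ℝ)

lemma contDiff_coordC (i : Fin n) : ContDiff ℝ ∞ (coordC (n := n) i) :=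
  Complex.ofRealCLM.contDiff.comp (EuclideanSpace.proj (𝕜 := ℝ) i).contDiff

lemma pderiv_coordC (i j : Fin n) :
    pderiv j (coordC (n := n) i) = fun _ => if i = j then 1 else 0 := by
  funext w
  have : HasFDerivAt (coordC (n := n) i)
      (Complex.ofRealCLM.comp (EuclideanSpace.proj (𝕜 := ℝ) i)) w :=
    (Complex.ofRealCLM.comp (EuclideanSpace.proj (𝕜 := ℝ) i)).hasFDerivAt
  unfold pderiv
  rw [this.fderiv]
  by_cases h : i = j <;> simp [h]

lemma contDiff_invJ : ContDiff ℝ ∞ (invJ (n := n)) :=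
  Complex.ofRealCLM.contDiff.comp
    ((contDiff_const.add (contDiff_norm_sq ℝ)).inv fun w => by positivity)

lemma pderiv_invJ (j : Fin n) :
    pderiv j (invJ (n := n)) = fun w => -2 * ((coordC j w * invJ w) * invJ w) := by
  funext w
  have h1 : HasFDerivAt (fun w : Eucl n => 1 + ‖w‖ ^ 2) (2 • (innerSL ℝ) w) w :=
    (hasStrictFDerivAt_norm_sq w).hasFDerivAt.const_add 1
  have h2 := Complex.ofRealCLM.hasFDerivAt.comp w
    ((hasDerivAt_inv (x := 1 + ‖w‖ ^ 2) (by positivity)).comp_hasFDerivAt w h1)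
  have h3 : fderiv ℝ (invJ (n := n)) w = _ := h2.fderiv
  unfold pderiv
  rw [h3]
  have : (1 + (‖w‖ : ℂ) ^ 2) ≠ 0 := by
    have : (1 + ‖w‖ ^ 2 : ℝ) ≠ 0 := by positivity
    exact_mod_cast this
  simp [invJ, coordC, EuclideanSpace.inner_single_right]
  field_simp

/-- As `∂ⱼ (1 + |w|²)⁻¹ = -2 wⱼ (1 + |w|²)⁻²`, the induction has to carry the functions
`wᵢ (1 + |w|²)⁻¹` along. -/
lemma Bd.invJ_aux (D : ℕ) : ∃ C, 0 ≤ C ∧ Bd D (fun _ : Eucl n => 1) C invJ ∧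
    ∀ i, Bd D (fun _ : Eucl n => 1) C (fun w => coordC i w * invJ w) := by
  have b1 : ∀ w : Eucl n, ‖invJ w‖ ≤ 1 := by
    intro w
    rw [invJ, Complex.norm_real, Real.norm_of_nonneg (by positivity)]
    exact inv_le_one_of_one_le₀ (by nlinarith [norm_nonneg w])
  have b2 : ∀ (i : Fin n) (w : Eucl n), ‖coordC i w * invJ w‖ ≤ 1 := by
    intro i w
    rw [norm_mul, invJ, coordC, Complex.norm_real, Complex.norm_real,
      Real.norm_of_nonneg (by positivity : (0:ℝ) ≤ (1 + ‖w‖ ^ 2)⁻¹), ← div_eq_mul_inv,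
      div_le_one (by positivity)]
    have : ‖w i‖ ≤ ‖w‖ := PiLp.norm_apply_le w i
    nlinarith [sq_nonneg (‖w‖ - 1), norm_nonneg w]
  have s1 : ContDiff ℝ ∞ (invJ (n := n)) := contDiff_invJ
  have s2 : ∀ i : Fin n, ContDiff ℝ ∞ (fun w : Eucl n => coordC i w * invJ w) :=
    fun i => (contDiff_coordC i).mul contDiff_invJ
  induction D with
  | zero => exact ⟨1, zero_le_one, fun w => by simpa using b1 w, fun i w => by simpa using b2 i w⟩
  | succ D ih =>
    obtain ⟨C, hC0, hC1, hC2⟩ := ih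
    refine ⟨1 + C + 2 * (2 ^ D * (C * C)), by positivity, ⟨fun w => ?_, fun j => ?_⟩,
      fun i => ⟨fun w => ?_, fun j => ?_⟩⟩
    · have := b1 w
      have : 0 ≤ 2 ^ D * (C * C) := by positivity
      linarith
    · rw [pderiv_invJ]
      refine (Bd.const_mul ((s2 j).mul s1) (-2) (Bd.mul (s2 j) s1 (hC2 j) hC1)).mono fun x => ?_
      simp
      linarith
    · have := b2 i w
      have : 0 ≤ 2 ^ D * (C * C) := by positivity
      linarith
    · rw [pderiv_mul (contDiff_coordC i) s1, pderiv_invJ, pderiv_coordC]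
      have h1 : Bd D (fun _ : Eucl n => 1) C (fun w => (if i = j then 1 else 0 : ℂ) * invJ w) :=
        (Bd.const_mul s1 _ hC1).mono fun x => by split_ifs <;> simp [hC0]
      have h2 : Bd D (fun _ : Eucl n => 1) (2 * (2 ^ D * (C * C))) _ :=
        (Bd.const_mul ((s2 i).mul (s2 j)) (-2)
        (Bd.mul (s2 i) (s2 j) (hC2 i) (hC2 j))).mono (fun x => by simp)
      have e : (fun w : Eucl n => (if i = j then 1 else 0 : ℂ) * invJ w +
          coordC i w * (-2 * ((coordC j w * invJ w) * invJ w))) =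
          fun w => (if i = j then 1 else 0 : ℂ) * invJ w +
            -2 * ((coordC i w * invJ w) * (coordC j w * invJ w)) := by
        funext w; ring
      rw [e]
      refine (h1.add (contDiff_const.mul s1) (contDiff_const.mul ((s2 i).mul (s2 j))) h2).mono
        fun x => ?_
      simp

lemma Bd.invJ (D : ℕ) : ∃ C, 0 ≤ C ∧ Bd D (fun w : Eucl n => (1 + ‖w‖ ^ 2)⁻¹) C invJ := by
  have b1 : ∀ w : Eucl n, ‖ExoticCalculus.invJ w‖ = (1 + ‖w‖ ^ 2)⁻¹ := by
    intro w
    rw [ExoticCalculus.invJ, Complex.norm_real, Real.norm_of_nonneg (by positivity)]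
  induction D with
  | zero => exact ⟨1, zero_le_one, fun w => by simp [b1]⟩
  | succ D ih =>
    obtain ⟨C, hC, h⟩ := ih
    obtain ⟨C', hC', -, h'⟩ := Bd.invJ_aux (n := n) D
    refine ⟨1 + 2 * (2 ^ D * (C' * C)), by positivity, fun w => ?_, fun j => ?_⟩
    · rw [b1]
      exact le_mul_of_one_le_left (by positivity)
        (by linarith [show 0 ≤ 2 ^ D * (C' * C) by positivity])
    · rw [pderiv_invJ]
      refine (Bd.const_mul (((contDiff_coordC j).mul contDiff_invJ).mul contDiff_invJ) (-2)
        (Bd.mul ((contDiff_coordC j).mul contDiff_invJ) contDiff_invJ (h' j) h)).mono fun x => ?_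
      simp only [one_mul, norm_neg, Complex.norm_ofNat]
      exact mul_le_mul_of_nonneg_right (by linarith) (by positivity)

lemma Bd.invJ_pow (D s : ℕ) :
    ∃ C, 0 ≤ C ∧
      Bd D (fun w : Eucl n => ((1 + ‖w‖ ^ 2) ^ s)⁻¹) C (fun w => ExoticCalculus.invJ w ^ s) := by
  induction s with
  | zero =>
    refine ⟨1, zero_le_one, ?_⟩
    cases D with
    | zero => intro x; simp
    | succ D =>
      refine ⟨fun x => by simp, fun i => ?_⟩
      simp only [pow_zero]
      rw [pderiv_const]
      exact (Bd.zero D (fun _ => 0)).mono fun x => by simp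
  | succ s ih =>
    obtain ⟨C, hC, h⟩ := ih
    obtain ⟨C', hC', h'⟩ := Bd.invJ (n := n) D
    refine ⟨2 ^ D * (C * C'), by positivity, ?_⟩
    simp only [pow_succ, mul_inv]
    exact Bd.mul (contDiff_invJ.pow s) contDiff_invJ h h'

end Bounds

/-! ### Fourier transforms and oscillatory pairings -/

section Fourier

variable {n : ℕ}

/-- All iterated partial derivatives of `f` of order at most `D` are integrable. -/
def IntD : ℕ → (Eucl n → ℂ) → Prop
  | 0, f => Integrable f
  | D + 1, f => Integrable f ∧ ∀ i, IntD D (pderiv i f)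

lemma IntD.integrable {D : ℕ} {f : Eucl n → ℂ} (h : IntD D f) : Integrable f := by
  cases D with
  | zero => exact h
  | succ D => exact h.1

lemma IntD.pred {D : ℕ} {f : Eucl n → ℂ} (h : IntD (D + 1) f) : IntD D f := by
  induction D generalizing f with
  | zero => exact h.1
  | succ D ih => exact ⟨h.1, fun i => ih (h.2 i)⟩

lemma IntD.of_bd {D : ℕ} {W : Eucl n → ℝ} {C : ℝ} {f : Eucl n → ℂ} (hf : ContDiff ℝ ∞ f)
    (hW : Integrable W) (h : Bd D W C f) : IntD D f := by
  have key : ∀ {f : Eucl n → ℂ}, ContDiff ℝ ∞ f → (∀ x, ‖f x‖ ≤ C * W x) → Integrable f :=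
    fun hf h => (hW.const_mul C).mono' hf.continuous.aestronglyMeasurable
      (Filter.Eventually.of_forall h)
  induction D generalizing f with
  | zero => exact key hf h
  | succ D ih => exact ⟨key hf h.1, fun i => ih (contDiff_pderiv i hf) (h.2 i)⟩

lemma hasCompactSupport_pderiv {f : Eucl n → ℂ} (h : HasCompactSupport f) (i : Fin n) :
    HasCompactSupport (pderiv i f) :=
  h.fderiv_apply ℝ _

lemma IntD.of_hasCompactSupport (D : ℕ) {f : Eucl n → ℂ} (hf : ContDiff ℝ ∞ f)
    (h : HasCompactSupport f) : IntD D f := by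
  induction D generalizing f with
  | zero => exact hf.continuous.integrable_of_hasCompactSupport h
  | succ D ih => exact ⟨hf.continuous.integrable_of_hasCompactSupport h,
      fun i => ih (contDiff_pderiv i hf) (hasCompactSupport_pderiv h i)⟩

lemma IntD.add {D : ℕ} {f g : Eucl n → ℂ} (hf : ContDiff ℝ ∞ f)
    (hg : ContDiff ℝ ∞ g) (h : IntD D f) (h' : IntD D g) : IntD D (fun x => f x + g x) := by
  induction D generalizing f g with
  | zero => exact Integrable.add h h'
  | succ D ih =>
    refine ⟨Integrable.add h.1 h'.1, fun i => ?_⟩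
    rw [pderiv_add hf hg]
    exact ih (contDiff_pderiv i hf) (contDiff_pderiv i hg) (h.2 i) (h'.2 i)

lemma IntD.const_mul {D : ℕ} {f : Eucl n → ℂ} (hf : ContDiff ℝ ∞ f) (c : ℂ) (h : IntD D f) :
    IntD D (fun x => c * f x) := by
  induction D generalizing f with
  | zero => exact Integrable.const_mul h c
  | succ D ih =>
    refine ⟨Integrable.const_mul h.1 c, fun i => ?_⟩
    rw [pderiv_const_mul hf]
    exact ih (contDiff_pderiv i hf) (h.2 i)

lemma IntD.zero (D : ℕ) : IntD D (fun _ : Eucl n => 0) := by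
  induction D with
  | zero => exact integrable_zero _ _ _
  | succ D ih => exact ⟨integrable_zero _ _ _, fun i => by rw [pderiv_const]; exact ih⟩

lemma IntD.sum {ι : Type*} (s : Finset ι) {D : ℕ} {f : ι → Eucl n → ℂ}
    (hf : ∀ j ∈ s, ContDiff ℝ ∞ (f j)) (h : ∀ j ∈ s, IntD D (f j)) :
    IntD D (fun x => ∑ j ∈ s, f j x) := by
  classical
  induction s using Finset.induction_on with
  | empty => simpa using IntD.zero D
  | insert a s ha ih =>
    simp only [Finset.sum_insert ha]
    exact IntD.add (hf a (by simp)) (ContDiff.sum fun j hj => hf j (by simp [hj]))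
      (h a (by simp)) (ih (fun j hj => hf j (by simp [hj])) (fun j hj => h j (by simp [hj])))

lemma IntD.opL {D : ℕ} {f : Eucl n → ℂ} (hf : ContDiff ℝ ∞ f) (h : IntD (D + 2) f) :
    IntD D (opL f) :=
  IntD.add hf (contDiff_const.mul
    (ContDiff.sum fun i _ => contDiff_pderiv i (contDiff_pderiv i hf))) h.pred.pred
    (IntD.const_mul (ContDiff.sum fun i _ => contDiff_pderiv i (contDiff_pderiv i hf)) _
      (IntD.sum _ (fun i _ => contDiff_pderiv i (contDiff_pderiv i hf)) fun i _ => (h.2 i).2 i))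

lemma norm_clm_le (T : Eucl n →L[ℝ] ℂ) : ‖T‖ ≤ ∑ i, ‖T (bvec i)‖ := by
  refine T.opNorm_le_bound (Finset.sum_nonneg fun _ _ => norm_nonneg _) fun x => ?_
  have : x = ∑ i, x i • (bvec i : Eucl n) := by
    ext j; simp [Pi.single_apply]
  conv_lhs => rw [this]
  rw [map_sum, Finset.sum_mul]
  refine (norm_sum_le _ _).trans (Finset.sum_le_sum fun i _ => ?_)
  rw [map_smul, norm_smul, mul_comm]
  exact mul_le_mul_of_nonneg_left (PiLp.norm_apply_le x i) (norm_nonneg _)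

lemma IntD.integrable_fderiv {f : Eucl n → ℂ} (hf : ContDiff ℝ ∞ f) (h : IntD 1 f) :
    Integrable (fderiv ℝ f) := by
  have h1 : Integrable (fun x => ∑ i, ‖pderiv i f x‖) :=
    integrable_finsetSum _ fun i _ => (h.2 i).integrable.norm
  exact h1.mono' (hf.continuous_fderiv (by simp)).aestronglyMeasurable
    (Filter.Eventually.of_forall fun x => norm_clm_le _)

lemma fourier_pderiv {f : Eucl n → ℂ} (hf : ContDiff ℝ ∞ f) (h : IntD 1 f) (i : Fin n)
    (w : Eucl n) : 𝓕 (pderiv i f) w = (2 * Real.pi * Complex.I * coordC i w) * 𝓕 f w := by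
  have h1 := Real.fourier_fderiv h.1 (hf.differentiable (by simp)) (h.integrable_fderiv hf)
  have h2 := Real.fourier_continuousLinearMap_apply (a := bvec i) (v := w) (h.integrable_fderiv hf)
  have h3 : 𝓕 (pderiv i f) w = 𝓕 (fderiv ℝ f) w (bvec i) := h2.symm
  have h4 : (innerSL ℝ) w (bvec i) = w i := by
    rw [innerSL_apply_apply, EuclideanSpace.inner_single_right]; simp
  rw [h3, h1]
  simp [VectorFourier.fourierSMulRight_apply, h4, coordC]
  ring

lemma fourier_add' {f g : Eucl n → ℂ} (hf : Integrable f) (hg : Integrable g) (w : Eucl n) :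
    𝓕 (fun x => f x + g x) w = 𝓕 f w + 𝓕 g w := by
  simp only [Real.fourier_eq, smul_add]
  exact integral_add ((Real.fourierIntegral_convergent_iff w).2 hf)
    ((Real.fourierIntegral_convergent_iff w).2 hg)

lemma fourier_const_mul' (c : ℂ) (f : Eucl n → ℂ) (w : Eucl n) :
    𝓕 (fun x => c * f x) w = c * 𝓕 f w := by
  simp only [Real.fourier_eq]
  rw [← integral_const_mul]
  congr 1; funext x
  simp only [Circle.smul_def, smul_eq_mul]; ring

lemma fourier_sum' {ι : Type*} (s : Finset ι) {f : ι → Eucl n → ℂ}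
    (hf : ∀ j ∈ s, Integrable (f j)) (w : Eucl n) :
    𝓕 (fun x => ∑ j ∈ s, f j x) w = ∑ j ∈ s, 𝓕 (f j) w := by
  simp only [Real.fourier_eq, Finset.smul_sum]
  exact integral_finsetSum _ fun j hj => (Real.fourierIntegral_convergent_iff w).2 (hf j hj)

lemma fourier_opL {f : Eucl n → ℂ} (hf : ContDiff ℝ ∞ f) (h : IntD 2 f) (w : Eucl n) :
    𝓕 (opL f) w = ((1 + ‖w‖ ^ 2 : ℝ) : ℂ) * 𝓕 f w := by
  have h2 : ∀ i, IntD 1 (pderiv i f) := h.2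
  unfold opL
  rw [fourier_add' h.1
    ((integrable_finsetSum _ fun i _ => ((h2 i).2 i).integrable).const_mul _),
    fourier_const_mul', fourier_sum' _ (fun i _ => ((h2 i).2 i).integrable)]
  have : ∀ i, 𝓕 (pderiv i (pderiv i f)) w =
      (2 * Real.pi * Complex.I * coordC i w) * ((2 * Real.pi * Complex.I * coordC i w) * 𝓕 f w) :=
    fun i => by rw [fourier_pderiv (contDiff_pderiv i hf) (h2 i), fourier_pderiv hf h.pred]
  simp only [this]
  have e : ∀ i, (2 * Real.pi * Complex.I * coordC i w) *
      ((2 * Real.pi * Complex.I * coordC i w) * 𝓕 f w) =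
      (-(4 * Real.pi ^ 2) * 𝓕 f w) * ((w i ^ 2 : ℝ) : ℂ) := by
    intro i
    simp only [coordC, Complex.ofReal_pow]
    linear_combination (4 * Real.pi ^ 2 * (w i : ℂ) ^ 2 * 𝓕 f w) * Complex.I_sq
  simp only [e]
  rw [← Finset.mul_sum, ← Complex.ofReal_sum, EuclideanSpace.norm_sq_eq]
  simp only [Real.norm_eq_abs, sq_abs]
  have hp : (Real.pi : ℂ) ≠ 0 := by exact_mod_cast Real.pi_ne_zero
  push_cast
  field_simp

lemma fourier_opL_iterate {s : ℕ} {f : Eucl n → ℂ} (hf : ContDiff ℝ ∞ f) (h : IntD (2 * s) f)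
    (w : Eucl n) : 𝓕 (opL^[s] f) w = ((1 + ‖w‖ ^ 2 : ℝ) : ℂ) ^ s * 𝓕 f w := by
  induction s generalizing f with
  | zero => simp
  | succ s ih =>
    have h' : IntD (2 * s + 2) f := h
    have h2 : IntD 2 f := by
      have : ∀ k, IntD (k + 2) f → IntD 2 f := by
        intro k
        induction k with
        | zero => exact fun h => h
        | succ k ihk => exact fun h => ihk h.pred
      exact this _ h'
    rw [Function.iterate_succ_apply, ih (contDiff_opL hf) (IntD.opL hf h'), fourier_opL hf h2]
    ring

/-- Decay of the Fourier transform. -/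
lemma norm_fourier_le {s : ℕ} {f : Eucl n → ℂ} (hf : ContDiff ℝ ∞ f) (h : IntD (2 * s) f)
    (w : Eucl n) : ‖𝓕 f w‖ ≤ (∫ x, ‖opL^[s] f x‖) * ((1 + ‖w‖ ^ 2) ^ s)⁻¹ := by
  have h1 := fourier_opL_iterate hf h w
  have h2 : ‖𝓕 (opL^[s] f) w‖ ≤ ∫ x, ‖opL^[s] f x‖ :=
    VectorFourier.norm_fourierIntegral_le_integral_norm _ _ _ _ _
  rw [h1, norm_mul, norm_pow, Complex.norm_real, Real.norm_of_nonneg (by positivity)] at h2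
  rw [← div_eq_mul_inv, le_div_iff₀ (by positivity)]
  linarith

lemma one_add_norm_pow_mul_le {P s : ℕ} (h : P + n + 1 ≤ 2 * s) (w : Eucl n) :
    (1 + ‖w‖) ^ P * ((1 + ‖w‖ ^ 2) ^ s)⁻¹ ≤ 2 ^ s * (1 + ‖w‖) ^ (-(n + 1 : ℝ)) := by
  have h0 : (0 : ℝ) < 1 + ‖w‖ := by positivity
  have e : (1 + ‖w‖) ^ (-(n + 1 : ℝ)) = ((1 + ‖w‖) ^ (n + 1))⁻¹ := by
    rw [Real.rpow_neg h0.le]; congr 1; exact_mod_cast Real.rpow_natCast (1 + ‖w‖) (n + 1)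
  rw [e, ← div_eq_mul_inv, ← div_eq_mul_inv, div_le_div_iff₀ (by positivity) (by positivity),
    ← pow_add, ← mul_pow]
  calc (1 + ‖w‖) ^ (P + (n + 1)) ≤ (1 + ‖w‖) ^ (2 * s) :=
        pow_le_pow_right₀ (by linarith [norm_nonneg w]) (by omega)
    _ = ((1 + ‖w‖) ^ 2) ^ s := pow_mul _ _ _
    _ ≤ _ := pow_le_pow_left₀ (by positivity) (by nlinarith [sq_nonneg (1 - ‖w‖)]) _

lemma integrable_weight {P s : ℕ} (h : P + n + 1 ≤ 2 * s) :
    Integrable (fun w : Eucl n => (1 + ‖w‖) ^ P * ((1 + ‖w‖ ^ 2) ^ s)⁻¹) := by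
  have h1 : Integrable (fun w : Eucl n => (1 + ‖w‖) ^ (-(n + 1 : ℝ))) :=
    integrable_one_add_norm (by simp)
  refine (h1.const_mul (2 ^ s)).mono' ?_ (Filter.Eventually.of_forall fun w => ?_)
  · refine Continuous.aestronglyMeasurable ?_
    refine Continuous.mul (by fun_prop) (Continuous.inv₀ (by fun_prop) fun w => by positivity)
  · rw [Real.norm_of_nonneg (by positivity)]
    exact one_add_norm_pow_mul_le h w

lemma continuous_fourier {f : Eucl n → ℂ} (hf : Integrable f) : Continuous (𝓕 f) :=
  VectorFourier.fourierIntegral_continuous Real.continuous_fourierChar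
    (by exact continuous_inner) hf

/-- `∫ 𝓕 f g = ∫ f 𝓕 g`. -/
lemma integral_fourier_mul_flip {f g : Eucl n → ℂ} (hf : Integrable f) (hg : Integrable g) :
    ∫ w, 𝓕 f w * g w = ∫ x, f x * 𝓕 g x := by
  have := VectorFourier.integral_fourierIntegral_smul_eq_flip (μ := volume) (ν := volume)
    (L := innerₗ (Eucl n)) Real.continuous_fourierChar (by exact continuous_inner) hf hg
  simp only [smul_eq_mul, flip_innerₗ] at this
  exact this

/-- The oscillatory integral estimate: `∫ φ 𝓕 g` is controlled by finitely many derivatives of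
`φ` and of `g`, both of which may grow polynomially. -/
theorem exists_pairing_bound (n P Q : ℕ) : ∃ (D : ℕ) (C : ℝ), 0 ≤ C ∧
    ∀ (φ g : Eucl n → ℂ) (A B : ℝ), ContDiff ℝ ∞ φ → ContDiff ℝ ∞ g → HasCompactSupport g →
      Bd D (fun w => (1 + ‖w‖) ^ P) A φ → Bd D (fun y => (1 + ‖y‖) ^ Q) B g →
      ‖∫ w, φ w * 𝓕 g w‖ ≤ C * A * B := by
  -- the exponents with `(1 + |y|)^Q (1 + |y|²)^{-M}` and `(1 + |w|)^P (1 + |w|²)^{-s}` integrable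
  set M := Q + n + 1 with hM
  set s := P + n + 1 with hs
  obtain ⟨Cρ, hCρ, hρ⟩ := Bd.invJ_pow (n := n) (2 * M) s
  have hW1 : Integrable (fun w : Eucl n => (1 + ‖w‖) ^ P * ((1 + ‖w‖ ^ 2) ^ s)⁻¹) :=
    integrable_weight (by omega)
  have hW2 : Integrable (fun w : Eucl n => (1 + ‖w‖) ^ Q * ((1 + ‖w‖ ^ 2) ^ M)⁻¹) :=
    integrable_weight (by omega)
  set I1 := ∫ w : Eucl n, (1 + ‖w‖) ^ P * ((1 + ‖w‖ ^ 2) ^ s)⁻¹ with hI1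
  set I2 := ∫ w : Eucl n, (1 + ‖w‖) ^ Q * ((1 + ‖w‖ ^ 2) ^ M)⁻¹ with hI2
  have hI1' : 0 ≤ I1 := integral_nonneg fun w => by positivity
  have hI2' : 0 ≤ I2 := integral_nonneg fun w => by positivity
  refine ⟨2 * M + 2 * s, ((1 + n) ^ M * (2 ^ (2 * M) * Cρ) * I1) * ((1 + n) ^ s * I2),
    by positivity, ?_⟩
  intro φ g A B hφ hg hgc hA hB
  -- `∫ φ 𝓕 g = ∫ ψ 𝓕 G = ∫ 𝓕 ψ G`, where `ψ` is integrable with its derivatives, so that `𝓕 ψ`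
  -- decays and compensates the growth of `G`
  set ψ : Eucl n → ℂ := fun w => φ w * invJ w ^ s with hψ
  have ψs : ContDiff ℝ ∞ ψ := hφ.mul (contDiff_invJ.pow s)
  have ψb : Bd (2 * M) (fun w => (1 + ‖w‖) ^ P * ((1 + ‖w‖ ^ 2) ^ s)⁻¹)
      (2 ^ (2 * M) * (A * Cρ)) ψ := Bd.mul hφ (contDiff_invJ.pow s) (hA.of_le (by omega)) hρ
  have ψi : IntD (2 * M) ψ := IntD.of_bd ψs hW1 ψb
  set G := opL^[s] g with hG
  have Gs : ContDiff ℝ ∞ G := contDiff_opL_iterate hg s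
  have gi : IntD (2 * s) g := IntD.of_hasCompactSupport _ hg hgc
  have Gi : Integrable G := by
    have : ∀ (s : ℕ) (f : Eucl n → ℂ), ContDiff ℝ ∞ f → IntD (2 * s) f →
        Integrable (opL^[s] f) := by
      intro s
      induction s with
      | zero => intro f _ h; exact h
      | succ s ih =>
        intro f hf h
        rw [Function.iterate_succ_apply]
        exact ih _ (contDiff_opL hf) (IntD.opL hf h)
    exact this s g hg gi
  have Gb : ∀ y, ‖G y‖ ≤ ((1 + n) ^ s * B) * (1 + ‖y‖) ^ Q :=
    fun y => (Bd.opL_iterate (D := 0) hg (hB.of_le (by omega))).le y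
  have e1 : ∫ w, φ w * 𝓕 g w = ∫ y, 𝓕 ψ y * G y := by
    rw [integral_fourier_mul_flip ψi.integrable Gi]
    congr 1; funext w
    rw [hG, fourier_opL_iterate hg gi, hψ]
    have : (((1 + ‖w‖ ^ 2 : ℝ)) : ℂ) ≠ 0 := by
      exact_mod_cast (by positivity : (1 + ‖w‖ ^ 2 : ℝ) ≠ 0)
    simp only [invJ, Complex.ofReal_inv]
    rw [mul_assoc, ← mul_assoc (_ ^ s), ← mul_pow, inv_mul_cancel₀ this, one_pow, one_mul]
  have A0 : 0 ≤ A := by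
    have := (norm_nonneg _).trans (hA.le 0); simpa using this
  have B0 : 0 ≤ B := by
    have := (norm_nonneg _).trans (hB.le 0); simpa using this
  have Lb : ∀ x, ‖opL^[M] ψ x‖ ≤ ((1 + n) ^ M * (2 ^ (2 * M) * (A * Cρ))) *
      ((1 + ‖x‖) ^ P * ((1 + ‖x‖ ^ 2) ^ s)⁻¹) :=
    fun x => (Bd.opL_iterate (D := 0) ψs (ψb.of_le (by omega))).le x
  have Ib : ∫ x, ‖opL^[M] ψ x‖ ≤ ((1 + n) ^ M * (2 ^ (2 * M) * (A * Cρ))) * I1 := by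
    rw [hI1, ← integral_const_mul]
    exact integral_mono_of_nonneg (Filter.Eventually.of_forall fun x => norm_nonneg _)
      (hW1.const_mul _) (Filter.Eventually.of_forall Lb)
  rw [e1]
  calc ‖∫ y, 𝓕 ψ y * G y‖ ≤ ∫ y, ((((1 + n) ^ M * (2 ^ (2 * M) * (A * Cρ))) * I1) *
        ((1 + n) ^ s * B)) * ((1 + ‖y‖) ^ Q * ((1 + ‖y‖ ^ 2) ^ M)⁻¹) := by
        refine norm_integral_le_of_norm_le (hW2.const_mul _)
          (Filter.Eventually.of_forall fun y => ?_)
        rw [norm_mul]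
        have h1 := (norm_fourier_le ψs ψi y).trans
          (mul_le_mul_of_nonneg_right Ib (by positivity))
        refine (mul_le_mul h1 (Gb y) (norm_nonneg _) (by positivity)).trans (le_of_eq ?_)
        ring
    _ = _ := by rw [integral_const_mul, ← hI2]; ring

/-- The monomial `w^β`. -/
def mono (β : Fin n → ℕ) (w : Eucl n) : ℂ := ∏ i, coordC i w ^ β i

lemma mono_add_single (β : Fin n → ℕ) (i : Fin n) (w : Eucl n) :
    mono (β + Pi.single i 1) w = coordC i w * mono β w := by
  unfold mono
  simp only [Pi.add_apply, pow_add, Finset.prod_mul_distrib]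
  rw [mul_comm, Finset.prod_eq_single i]
  · simp
  · intro j _ hj; simp [hj]
  · simp

lemma contDiff_mono (β : Fin n → ℕ) : ContDiff ℝ ∞ (mono (n := n) β) :=
  contDiff_prod fun i _ => (contDiff_coordC i).pow _

lemma norm_mono_le (β : Fin n → ℕ) (w : Eucl n) : ‖mono β w‖ ≤ (1 + ‖w‖) ^ mlen β := by
  unfold mono mlen
  rw [norm_prod, ← Finset.prod_pow_eq_pow_sum]
  refine Finset.prod_le_prod (fun _ _ => norm_nonneg _) fun i _ => ?_
  rw [norm_pow]
  refine pow_le_pow_left₀ (norm_nonneg _) ?_ _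
  rw [coordC, Complex.norm_real]
  linarith [PiLp.norm_apply_le w i]

lemma hasCompactSupport_mderiv {f : Eucl n → ℂ} (h : HasCompactSupport f) (β : Fin n → ℕ) :
    HasCompactSupport (mderiv β f) :=
  mop_induction (T := pderiv (n := n)) (fun _ f => HasCompactSupport f)
    (fun i _ _ h => hasCompactSupport_pderiv h i) β 0 f h

lemma fourier_mderiv {f : Eucl n → ℂ} (hf : ContDiff ℝ ∞ f) (h : HasCompactSupport f)
    (β : Fin n → ℕ) (w : Eucl n) :
    𝓕 (mderiv β f) w = (2 * Real.pi * Complex.I) ^ mlen β * mono β w * 𝓕 f w := by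
  obtain ⟨k, hk⟩ : ∃ k, mlen β = k := ⟨_, rfl⟩
  induction k generalizing β with
  | zero =>
    have : β = 0 := by
      funext i
      simp only [mlen, Finset.sum_eq_zero_iff] at hk
      exact hk i (Finset.mem_univ i)
    subst this
    simp [mderiv_zero, mono, mlen]
  | succ k ih =>
    obtain ⟨i, δ, rfl, hδ⟩ := exists_eq_add_single β hk
    rw [← pderiv_mderiv δ i hf, fourier_pderiv (contDiff_mderiv δ hf)
      (IntD.of_hasCompactSupport 1 (contDiff_mderiv δ hf) (hasCompactSupport_mderiv h δ)),
      ih δ hδ, mlen_add_single, mono_add_single]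
    ring

lemma exists_norm_fourier_le {f : Eucl n → ℂ} (hf : ContDiff ℝ ∞ f) (h : HasCompactSupport f)
    (s : ℕ) : ∃ C, 0 ≤ C ∧ ∀ w, ‖𝓕 f w‖ ≤ C * ((1 + ‖w‖ ^ 2) ^ s)⁻¹ :=
  ⟨_, integral_nonneg fun _ => norm_nonneg _,
    norm_fourier_le hf (IntD.of_hasCompactSupport _ hf h)⟩

lemma integrable_mul_fourier {f φ : Eucl n → ℂ} (hf : ContDiff ℝ ∞ f) (h : HasCompactSupport f)
    (hφ : Continuous φ) {C : ℝ} {P : ℕ} (hC : ∀ w, ‖φ w‖ ≤ C * (1 + ‖w‖) ^ P) :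
    Integrable (fun w => φ w * 𝓕 f w) := by
  obtain ⟨C', hC', h'⟩ := exists_norm_fourier_le hf h (P + n + 1)
  refine ((integrable_weight (n := n) (P := P) (s := P + n + 1) (by omega)).const_mul
    (C * C')).mono' ?_ (Filter.Eventually.of_forall fun w => ?_)
  · exact (hφ.mul (continuous_fourier
      (hf.continuous.integrable_of_hasCompactSupport h))).aestronglyMeasurable
  · rw [norm_mul]
    refine (mul_le_mul (hC w) (h' w) (norm_nonneg _) ((norm_nonneg _).trans (hC w))).trans
      (le_of_eq (by ring))

lemma integrable_fourier {f : Eucl n → ℂ} (hf : ContDiff ℝ ∞ f) (h : HasCompactSupport f) :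
    Integrable (𝓕 f) := by
  have := integrable_mul_fourier (φ := fun _ => 1) (C := 1) (P := 0) hf h continuous_const
    (by simp)
  simpa using this

lemma integral_fourier_eq {f : Eucl n → ℂ} (hf : ContDiff ℝ ∞ f) (h : HasCompactSupport f) :
    ∫ w, 𝓕 f w = f 0 := by
  have := congrFun (hf.continuous.fourierInv_fourier_eq
    (hf.continuous.integrable_of_hasCompactSupport h) (integrable_fourier hf h)) 0
  rw [Real.fourierInv_eq] at this
  simpa using this

lemma integral_mono_mul_fourier {f : Eucl n → ℂ} (hf : ContDiff ℝ ∞ f) (h : HasCompactSupport f)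
    (β : Fin n → ℕ) :
    ∫ w, mono β w * 𝓕 f w = ((2 * Real.pi * Complex.I) ^ mlen β)⁻¹ * mderiv β f 0 := by
  have hp : (2 * Real.pi * Complex.I : ℂ) ≠ 0 := Complex.two_pi_I_ne_zero
  rw [← integral_fourier_eq (contDiff_mderiv β hf) (hasCompactSupport_mderiv h β)]
  simp only [fourier_mderiv hf h, mul_assoc]
  rw [integral_const_mul, ← mul_assoc]
  simp only [← mul_assoc]
  rw [inv_mul_cancel₀ (pow_ne_zero _ hp), one_mul]

end Fourier

/-! ### Taylor expansion of a pairing -/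

section Taylor

variable {n : ℕ}

lemma mem_multiOfLen {k : ℕ} {β : Fin n → ℕ} : β ∈ multiOfLen n k ↔ mlen β = k := by
  simp [multiOfLen, mlen, Finset.mem_piAntidiag]

lemma eq_zero_of_mlen {γ : Fin n → ℕ} (h : mlen γ = 0) : γ = 0 := by
  funext i
  simp only [mlen, Finset.sum_eq_zero_iff] at h
  exact h i (Finset.mem_univ i)

lemma mderiv_mderiv (γ δ : Fin n → ℕ) {f : Eucl n → ℂ} (hf : ContDiff ℝ ∞ f) :
    mderiv δ (mderiv γ f) = mderiv (γ + δ) f := by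
  obtain ⟨k, hk⟩ : ∃ k, mlen δ = k := ⟨_, rfl⟩
  induction k generalizing δ with
  | zero =>
    obtain rfl := eq_zero_of_mlen hk
    simp [mderiv_zero]
  | succ k ih =>
    obtain ⟨i, δ', rfl, hδ'⟩ := exists_eq_add_single δ hk
    rw [← pderiv_mderiv δ' i (contDiff_mderiv γ hf), ih δ' hδ', pderiv_mderiv _ i hf, add_assoc]

lemma mderiv_sub {f g : Eucl n → ℂ} (hf : ContDiff ℝ ∞ f) (hg : ContDiff ℝ ∞ g)
    (γ : Fin n → ℕ) :
    mderiv γ (fun x => f x - g x) = fun x => mderiv γ f x - mderiv γ g x := by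
  obtain ⟨k, hk⟩ : ∃ k, mlen γ = k := ⟨_, rfl⟩
  induction k generalizing γ with
  | zero =>
    obtain rfl := eq_zero_of_mlen hk
    simp [mderiv_zero]
  | succ k ih =>
    obtain ⟨i, δ, rfl, hδ⟩ := exists_eq_add_single γ hk
    rw [← pderiv_mderiv δ i (hf.sub hg), ih δ hδ, ← pderiv_mderiv δ i hf, ← pderiv_mderiv δ i hg,
      pderiv_sub (contDiff_mderiv δ hf) (contDiff_mderiv δ hg)]

lemma mderiv_const_mul {f : Eucl n → ℂ} (hf : ContDiff ℝ ∞ f) (c : ℂ) (γ : Fin n → ℕ) :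
    mderiv γ (fun x => c * f x) = fun x => c * mderiv γ f x := by
  obtain ⟨k, hk⟩ : ∃ k, mlen γ = k := ⟨_, rfl⟩
  induction k generalizing γ with
  | zero =>
    obtain rfl := eq_zero_of_mlen hk
    simp [mderiv_zero]
  | succ k ih =>
    obtain ⟨i, δ, rfl, hδ⟩ := exists_eq_add_single γ hk
    rw [← pderiv_mderiv δ i (contDiff_const.mul hf), ih δ hδ, ← pderiv_mderiv δ i hf,
      pderiv_const_mul (contDiff_mderiv δ hf)]

lemma mderiv_sum {ι : Type*} (s : Finset ι) {f : ι → Eucl n → ℂ}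
    (hf : ∀ j ∈ s, ContDiff ℝ ∞ (f j)) (γ : Fin n → ℕ) :
    mderiv γ (fun x => ∑ j ∈ s, f j x) = fun x => ∑ j ∈ s, mderiv γ (f j) x := by
  obtain ⟨k, hk⟩ : ∃ k, mlen γ = k := ⟨_, rfl⟩
  induction k generalizing γ with
  | zero =>
    obtain rfl := eq_zero_of_mlen hk
    simp [mderiv_zero]
  | succ k ih =>
    obtain ⟨i, δ, rfl, hδ⟩ := exists_eq_add_single γ hk
    rw [← pderiv_mderiv δ i (ContDiff.sum hf), ih δ hδ,
      pderiv_sum _ (fun j hj => contDiff_mderiv δ (hf j hj))]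
    funext x
    exact Finset.sum_congr rfl fun j hj => by rw [← pderiv_mderiv δ i (hf j hj)]

lemma pderiv_mono (i : Fin n) (β : Fin n → ℕ) :
    pderiv i (mono β) = fun w => (β i : ℂ) * mono (β - Pi.single i 1) w := by
  obtain ⟨k, hk⟩ : ∃ k, mlen β = k := ⟨_, rfl⟩
  induction k generalizing β with
  | zero =>
    obtain rfl := eq_zero_of_mlen hk
    have : mono (0 : Fin n → ℕ) = fun _ => 1 := by funext w; simp [mono]
    rw [this, pderiv_const]; simp
  | succ k ih =>
    obtain ⟨j, δ, rfl, hδ⟩ := exists_eq_add_single β hk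
    have e : mono (δ + Pi.single j 1) = fun w => coordC j w * mono δ w :=
      funext fun w => mono_add_single δ j w
    rw [e, pderiv_mul (contDiff_coordC j) (contDiff_mono δ), ih δ hδ, pderiv_coordC]
    funext w
    by_cases hij : j = i
    · subst hij
      have e1 : δ + Pi.single j 1 - Pi.single j 1 = δ := by funext l; simp
      rw [e1]
      simp only [if_true, one_mul, Pi.add_apply, Pi.single_eq_same, Nat.cast_add, Nat.cast_one]
      by_cases h0 : δ j = 0
      · simp [h0]
      · have e2 : δ = (δ - Pi.single j 1) + Pi.single j 1 := by
          funext l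
          by_cases hl : l = j
          · subst hl; simp; omega
          · simp [hl]
        have e3 : mono δ w = coordC j w * mono (δ - Pi.single j 1) w := by
          conv_lhs => rw [e2]
          rw [mono_add_single]
        rw [e3]; ring
    · have e1 : (δ + Pi.single j 1 : Fin n → ℕ) i = δ i := by simp [Ne.symm hij]
      rw [e1]
      by_cases h0 : δ i = 0
      · simp [h0, hij]
      · have e2 : δ + Pi.single j 1 - Pi.single i 1 = (δ - Pi.single i 1) + Pi.single j 1 := by
          funext l
          by_cases hl : l = i
          · subst hl; simp [Ne.symm hij]
          · simp [hl]
        rw [e2, mono_add_single]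
        simp [hij]; ring

lemma mfact_pos (β : Fin n → ℕ) : 0 < mfact β := Finset.prod_pos fun _ _ => Nat.factorial_pos _

lemma mfact_add_single (β : Fin n → ℕ) (i : Fin n) :
    mfact (β + Pi.single i 1) = (β i + 1) * mfact β := by
  unfold mfact
  rw [← Finset.mul_prod_erase _ _ (Finset.mem_univ i),
    ← Finset.mul_prod_erase Finset.univ (fun i => (β i).factorial) (Finset.mem_univ i)]
  simp only [Pi.add_apply, Pi.single_eq_same, Nat.factorial_succ, mul_assoc]
  congr 2
  exact Finset.prod_congr rfl fun j hj => by simp [(Finset.mem_erase.1 hj).1]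

/-- The normalized monomial `w^β / β!`. -/
def nmono (β : Fin n → ℕ) (w : Eucl n) : ℂ := (mfact β : ℂ)⁻¹ * mono β w

lemma contDiff_nmono (β : Fin n → ℕ) : ContDiff ℝ ∞ (nmono (n := n) β) :=
  contDiff_const.mul (contDiff_mono β)

lemma pderiv_nmono_add_single (i : Fin n) (β : Fin n → ℕ) :
    pderiv i (nmono (β + Pi.single i 1)) = nmono β := by
  unfold nmono
  rw [pderiv_const_mul (contDiff_mono _), pderiv_mono, mfact_add_single]
  have e1 : β + Pi.single i 1 - Pi.single i 1 = β := by funext l; simp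
  rw [e1]
  funext w
  have h1 : (mfact β : ℂ) ≠ 0 := by exact_mod_cast (mfact_pos β).ne'
  have h2 : ((β i : ℂ) + 1) ≠ 0 := by exact_mod_cast Nat.succ_ne_zero (β i)
  simp
  field_simp

lemma pderiv_nmono_of_eq_zero (i : Fin n) (β : Fin n → ℕ) (h : β i = 0) :
    pderiv i (nmono β) = fun _ => 0 := by
  unfold nmono
  rw [pderiv_const_mul (contDiff_mono _), pderiv_mono]
  simp [h]

lemma mderiv_zero_fun (γ : Fin n → ℕ) : mderiv γ (fun _ : Eucl n => (0 : ℂ)) = fun _ => 0 := by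
  have := mderiv_const_mul (f := fun _ : Eucl n => (0 : ℂ)) contDiff_const 0 γ
  simpa using this

lemma exists_eq_add_single_of_ne_zero (β : Fin n → ℕ) (i : Fin n) (h : β i ≠ 0) :
    ∃ δ : Fin n → ℕ, β = δ + Pi.single i 1 := by
  refine ⟨β - Pi.single i 1, ?_⟩
  funext j
  by_cases hj : j = i
  · subst hj; simp; omega
  · simp [hj]

/-- The normalized monomials are dual to the derivatives at `0`. -/
lemma mderiv_nmono_zero (γ β : Fin n → ℕ) :
    mderiv γ (nmono β) 0 = if γ = β then 1 else 0 := by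
  obtain ⟨k, hk⟩ : ∃ k, mlen γ = k := ⟨_, rfl⟩
  induction k generalizing γ β with
  | zero =>
    obtain rfl := eq_zero_of_mlen hk
    rw [mderiv_zero]
    split_ifs with h
    · subst h; simp [nmono, mono, mfact]
    · have : ∃ i, β i ≠ 0 := by
        by_contra! hc
        exact h (funext fun i => (hc i).symm)
      obtain ⟨i, hi⟩ := this
      unfold nmono mono
      rw [Finset.prod_eq_zero (Finset.mem_univ i), mul_zero]
      simp [coordC, hi]
  | succ k ih =>
    obtain ⟨i, δ, rfl, hδ⟩ := exists_eq_add_single γ hk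
    rw [← mderiv_pderiv δ i (contDiff_nmono β)]
    by_cases h0 : β i = 0
    · rw [pderiv_nmono_of_eq_zero i β h0, mderiv_zero_fun, if_neg]
      intro h
      have := congrFun h i
      simp [h0] at this
    · obtain ⟨β', rfl⟩ := exists_eq_add_single_of_ne_zero β i h0
      rw [pderiv_nmono_add_single, ih δ β' hδ]
      simp

lemma mderiv_nmono_of_lt (γ β : Fin n → ℕ) (h : mlen β < mlen γ) :
    mderiv γ (nmono β) = fun _ => 0 := by
  obtain ⟨k, hk⟩ : ∃ k, mlen γ = k := ⟨_, rfl⟩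
  induction k generalizing γ β with
  | zero => omega
  | succ k ih =>
    obtain ⟨i, δ, rfl, hδ⟩ := exists_eq_add_single γ hk
    rw [← mderiv_pderiv δ i (contDiff_nmono β)]
    by_cases h0 : β i = 0
    · rw [pderiv_nmono_of_eq_zero i β h0, mderiv_zero_fun]
    · obtain ⟨β', rfl⟩ := exists_eq_add_single_of_ne_zero β i h0
      rw [pderiv_nmono_add_single]
      rw [mlen_add_single, mlen_add_single] at h
      exact ih δ β' (by omega) hδ

/-- The Taylor polynomial of `φ` at `0`, of degree less than `N`. -/
def taylorPoly (N : ℕ) (φ : Eucl n → ℂ) (w : Eucl n) : ℂ :=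
  ∑ j ∈ Finset.range N, ∑ β ∈ multiOfLen n j, mderiv β φ 0 * nmono β w

lemma contDiff_taylorPoly (N : ℕ) (φ : Eucl n → ℂ) : ContDiff ℝ ∞ (taylorPoly N φ) :=
  ContDiff.sum fun _ _ => ContDiff.sum fun β _ => contDiff_const.mul (contDiff_nmono β)

lemma mderiv_taylorPoly (N : ℕ) (φ : Eucl n → ℂ) (γ : Fin n → ℕ) (w : Eucl n) :
    mderiv γ (taylorPoly N φ) w =
      ∑ j ∈ Finset.range N, ∑ β ∈ multiOfLen n j, mderiv β φ 0 * mderiv γ (nmono β) w := by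
  unfold taylorPoly
  rw [mderiv_sum _ (fun _ _ => ContDiff.sum fun β _ => contDiff_const.mul (contDiff_nmono β))]
  refine Finset.sum_congr rfl fun j _ => ?_
  rw [mderiv_sum _ (fun β _ => contDiff_const.mul (contDiff_nmono β))]
  exact Finset.sum_congr rfl fun β _ => by rw [mderiv_const_mul (contDiff_nmono β)]

lemma mderiv_taylorPoly_zero (N : ℕ) (φ : Eucl n → ℂ) (γ : Fin n → ℕ) (h : mlen γ < N) :
    mderiv γ (taylorPoly N φ) 0 = mderiv γ φ 0 := by
  rw [mderiv_taylorPoly]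
  simp only [mderiv_nmono_zero]
  rw [Finset.sum_eq_single (mlen γ), Finset.sum_eq_single γ]
  · simp
  · intro β _ hβ; simp [Ne.symm hβ]
  · intro h; exact absurd (mem_multiOfLen.2 rfl) h
  · intro j _ hj
    refine Finset.sum_eq_zero fun β hβ => ?_
    rw [if_neg, mul_zero]
    rintro rfl
    exact hj (mem_multiOfLen.1 hβ).symm
  · intro h'; exact absurd (Finset.mem_range.2 h) h'

lemma mderiv_taylorPoly_of_le (N : ℕ) (φ : Eucl n → ℂ) (γ : Fin n → ℕ) (h : N ≤ mlen γ)
    (w : Eucl n) : mderiv γ (taylorPoly N φ) w = 0 := by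
  rw [mderiv_taylorPoly]
  refine Finset.sum_eq_zero fun j hj => Finset.sum_eq_zero fun β hβ => ?_
  rw [mderiv_nmono_of_lt, mul_zero]
  rw [mem_multiOfLen.1 hβ]
  exact (Finset.mem_range.1 hj).trans_le h

/-- Integration of bounds on the derivatives of order at least `j`, for a function vanishing to
the order `j` at `0`. -/
lemma Bd.of_vanishing {D P : ℕ} {A : ℝ} (j : ℕ) {f : Eucl n → ℂ} (hf : ContDiff ℝ ∞ f)
    (h0 : ∀ γ, mlen γ < j → mderiv γ f 0 = 0)
    (h1 : ∀ γ, mlen γ = j → Bd D (fun w => (1 + ‖w‖) ^ P) A (mderiv γ f)) (hA : 0 ≤ A) :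
    Bd (D + j) (fun w => (1 + ‖w‖) ^ (P + j)) ((1 + n) ^ j * A) f := by
  induction j generalizing f with
  | zero =>
    have := h1 0 (by simp [mlen])
    rw [mderiv_zero] at this
    simpa using this
  | succ j ih =>
    have key : ∀ i, Bd (D + j) (fun w => (1 + ‖w‖) ^ (P + j)) ((1 + n) ^ j * A) (pderiv i f) := by
      intro i
      refine ih (contDiff_pderiv i hf) (fun γ hγ => ?_) (fun γ hγ => ?_)
      · rw [mderiv_pderiv γ i hf]
        exact h0 _ (by rw [mlen_add_single]; omega)
      · rw [mderiv_pderiv γ i hf]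
        exact h1 _ (by rw [mlen_add_single]; omega)
    refine ⟨fun w => ?_, fun i => (key i).mono fun w => ?_⟩
    · have hb : ∀ x ∈ Metric.closedBall (0 : Eucl n) ‖w‖,
          ‖fderiv ℝ f x‖ ≤ n * (((1 + n) ^ j * A) * (1 + ‖w‖) ^ (P + j)) := by
        intro x hx
        refine (norm_clm_le _).trans ?_
        calc ∑ i, ‖fderiv ℝ f x (bvec i)‖ ≤
              ∑ _i : Fin n, (((1 + n) ^ j * A) * (1 + ‖w‖) ^ (P + j)) := by
              refine Finset.sum_le_sum fun i _ => ((key i).le x).trans ?_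
              have : ‖x‖ ≤ ‖w‖ := by simpa using hx
              gcongr
          _ = _ := by simp
      have h2 := (convex_closedBall (0 : Eucl n) ‖w‖).norm_image_sub_le_of_norm_fderiv_le
        (fun x _ => hf.differentiable (by simp) x) hb (x := 0) (y := w) (by simp) (by simp)
      have h3 : f 0 = 0 := by
        have := h0 0 (by simp [mlen]); rwa [mderiv_zero] at this
      rw [h3, sub_zero, sub_zero] at h2
      refine h2.trans ?_
      have h4 : ‖w‖ ≤ 1 + ‖w‖ := by linarith
      calc n * (((1 + n) ^ j * A) * (1 + ‖w‖) ^ (P + j)) * ‖w‖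
          ≤ (1 + n) * (((1 + n) ^ j * A) * (1 + ‖w‖) ^ (P + j)) * (1 + ‖w‖) := by
            gcongr; linarith
        _ = _ := by ring
    · have h4 : (1 : ℝ) ≤ 1 + ‖w‖ := by linarith [norm_nonneg w]
      have h5 : (1 : ℝ) ≤ 1 + n := by linarith [Nat.cast_nonneg (α := ℝ) n]
      gcongr <;> first | assumption | omega

lemma exists_norm_taylorPoly_le (N : ℕ) (φ : Eucl n → ℂ) :
    ∃ C, ∀ w, ‖taylorPoly N φ w‖ ≤ C * (1 + ‖w‖) ^ N := by
  refine ⟨∑ j ∈ Finset.range N, ∑ β ∈ multiOfLen n j, ‖mderiv β φ 0‖ * ‖(mfact β : ℂ)⁻¹‖,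
    fun w => ?_⟩
  rw [Finset.sum_mul]
  refine (norm_sum_le _ _).trans (Finset.sum_le_sum fun j hj => ?_)
  rw [Finset.sum_mul]
  refine (norm_sum_le _ _).trans (Finset.sum_le_sum fun β hβ => ?_)
  rw [nmono, norm_mul, norm_mul, mul_assoc]
  have h1 : ‖mono β w‖ ≤ (1 + ‖w‖) ^ N := (norm_mono_le β w).trans
    (pow_le_pow_right₀ (by linarith [norm_nonneg w]) (by
      rw [mem_multiOfLen.1 hβ]; exact (Finset.mem_range.1 hj).le))
  gcongr

/-- The expansion of `∫ φ 𝓕 g` obtained from the Taylor expansion of `φ` at `0`, with an estimate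
of the remainder by the derivatives of `φ` of order at least `N`. -/
theorem exists_taylor_pairing_bound (n N P Q : ℕ) : ∃ (D : ℕ) (C : ℝ), 0 ≤ C ∧
    ∀ (φ g : Eucl n → ℂ) (A B : ℝ), ContDiff ℝ ∞ φ → ContDiff ℝ ∞ g → HasCompactSupport g →
      0 ≤ A →
      (∀ γ, N ≤ mlen γ → mlen γ ≤ N + D → ∀ w, ‖mderiv γ φ w‖ ≤ A * (1 + ‖w‖) ^ P) →
      (∀ γ, mlen γ ≤ D → ∀ y, ‖mderiv γ g y‖ ≤ B * (1 + ‖y‖) ^ Q) →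
      ‖(∫ w, φ w * 𝓕 g w) - ∑ j ∈ Finset.range N, ∑ β ∈ multiOfLen n j,
        mderiv β φ 0 * ((mfact β : ℂ)⁻¹ * (((2 * Real.pi * Complex.I) ^ j)⁻¹ * mderiv β g 0))‖
        ≤ C * A * B := by
  obtain ⟨D, C, hC, h⟩ := exists_pairing_bound n (P + N) Q
  refine ⟨D, C * (1 + n) ^ N, by positivity, ?_⟩
  intro φ g A B hφ hg hgc hA0 hA hB
  have hT := contDiff_taylorPoly N φ
  have hR := hφ.sub hT
  have hRb : Bd (D + N) (fun w => (1 + ‖w‖) ^ (P + N)) ((1 + n) ^ N * A)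
      (fun w => φ w - taylorPoly N φ w) := by
    refine Bd.of_vanishing N hR (fun γ hγ => ?_) (fun γ hγ => ?_) hA0
    · rw [mderiv_sub hφ hT]
      beta_reduce
      rw [mderiv_taylorPoly_zero N φ γ hγ, sub_self]
    · refine Bd.of_mderiv (contDiff_mderiv γ hR) fun δ hδ w => ?_
      have hl : mlen (γ + δ) = mlen γ + mlen δ := by simp [mlen, Finset.sum_add_distrib]
      rw [mderiv_mderiv γ δ hR, mderiv_sub hφ hT]
      beta_reduce
      rw [mderiv_taylorPoly_of_le N φ _ (by omega), sub_zero]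
      exact hA _ (by omega) (by omega) w
  have hgB : Bd D (fun y => (1 + ‖y‖) ^ Q) B g := Bd.of_mderiv hg hB
  have h1 := h _ g _ B hR hg hgc (hRb.of_le (by omega)) hgB
  obtain ⟨CT, hCT⟩ := exists_norm_taylorPoly_le N φ
  have iT := integrable_mul_fourier hg hgc hT.continuous hCT
  have iR := integrable_mul_fourier hg hgc hR.continuous hRb.le
  have e1 : ∫ w, φ w * 𝓕 g w =
      (∫ w, (φ w - taylorPoly N φ w) * 𝓕 g w) + ∫ w, taylorPoly N φ w * 𝓕 g w := by
    rw [← integral_add iR iT]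
    congr 1; funext w; ring
  have e2 : ∫ w, taylorPoly N φ w * 𝓕 g w = ∑ j ∈ Finset.range N, ∑ β ∈ multiOfLen n j,
      mderiv β φ 0 * ((mfact β : ℂ)⁻¹ *
        (((2 * Real.pi * Complex.I) ^ j)⁻¹ * mderiv β g 0)) := by
    have im : ∀ β : Fin n → ℕ, Integrable (fun w => mderiv β φ 0 * nmono β w * 𝓕 g w) := by
      intro β
      have := (integrable_mul_fourier hg hgc (contDiff_mono β).continuous (C := 1)
        (P := mlen β) (fun w => by simpa using norm_mono_le β w)).const_mul
          (mderiv β φ 0 * (mfact β : ℂ)⁻¹)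
      refine this.congr (Filter.Eventually.of_forall fun w => ?_)
      simp only [nmono]; ring
    unfold taylorPoly
    simp only [Finset.sum_mul]
    rw [integral_finsetSum _ fun j _ => integrable_finsetSum _ fun β _ => im β]
    refine Finset.sum_congr rfl fun j _ => ?_
    rw [integral_finsetSum _ fun β _ => im β]
    refine Finset.sum_congr rfl fun β hβ => ?_
    rw [← mem_multiOfLen.1 hβ, ← integral_mono_mul_fourier hg hgc β, ← mul_assoc,
      ← integral_const_mul]
    congr 1; funext w
    simp only [nmono]; ring
  rw [e1, e2, add_sub_cancel_right]
  refine h1.trans (le_of_eq (by ring))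

end Taylor

/-! ### The weights `⟨ξ⟩` and `Λ` -/

section Weights

variable {n : ℕ}

lemma one_le_jap (ξ : Eucl n) : 1 ≤ jap ξ := by
  rw [jap]; exact Real.one_le_sqrt.2 (by nlinarith [norm_nonneg ξ])

lemma jap_pos (ξ : Eucl n) : 0 < jap ξ := zero_lt_one.trans_le (one_le_jap ξ)

lemma jap_sq (ξ : Eucl n) : jap ξ ^ 2 = 1 + ‖ξ‖ ^ 2 := Real.sq_sqrt (by positivity)

lemma norm_le_jap (ξ : Eucl n) : ‖ξ‖ ≤ jap ξ :=
  Real.le_sqrt_of_sq_le (by linarith)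

lemma jap_le_one_add (ξ : Eucl n) : jap ξ ≤ 1 + ‖ξ‖ :=
  Real.sqrt_le_iff.2 ⟨by positivity, by nlinarith [norm_nonneg ξ]⟩

lemma jap_add_le (ξ η : Eucl n) : jap (ξ + η) ≤ jap ξ * (1 + ‖η‖) := by
  have h1 : jap (ξ + η) ≤ jap ξ + ‖η‖ := by
    refine Real.sqrt_le_iff.2 ⟨add_nonneg (jap_pos ξ).le (norm_nonneg η), ?_⟩
    have h := pow_le_pow_left₀ (norm_nonneg _) (norm_add_le ξ η) 2
    have h2 := mul_le_mul_of_nonneg_right (norm_le_jap ξ) (norm_nonneg η)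
    nlinarith [jap_sq ξ]
  nlinarith [mul_le_mul_of_nonneg_right (one_le_jap ξ) (norm_nonneg η)]

/-- Quantities comparable up to the factor `t` have powers comparable up to a power of `t`. -/
lemma rpow_le_of_comparable {x y t : ℝ} (hx : 0 < x) (hy : 0 < y) (ht : 1 ≤ t)
    (h1 : x ≤ y * t) (h2 : y ≤ x * t) (r : ℝ) : x ^ r ≤ y ^ r * t ^ ⌈|r|⌉₊ := by
  have ht0 : 0 < t := by linarith
  have h3 : x ^ r ≤ y ^ r * t ^ |r| := by
    rcases le_total 0 r with hr | hr
    · rw [abs_of_nonneg hr, ← Real.mul_rpow hy.le ht0.le]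
      exact Real.rpow_le_rpow hx.le h1 hr
    · rw [abs_of_nonpos hr, Real.rpow_neg ht0.le, ← div_eq_mul_inv,
        ← Real.div_rpow hy.le ht0.le]
      refine Real.rpow_le_rpow_of_nonpos (by positivity) ?_ hr
      rwa [div_le_iff₀ ht0]
  refine h3.trans (mul_le_mul_of_nonneg_left ?_ (by positivity))
  rw [← Real.rpow_natCast]
  exact Real.rpow_le_rpow_of_exponent_le ht (Nat.le_ceil _)

/-- Peetre's inequality. -/
lemma jap_add_rpow_le (ξ η : Eucl n) (r : ℝ) :
    jap (ξ + η) ^ r ≤ jap ξ ^ r * (1 + ‖η‖) ^ ⌈|r|⌉₊ := by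
  refine rpow_le_of_comparable (jap_pos _) (jap_pos _) (by linarith [norm_nonneg η])
    (jap_add_le ξ η) ?_ r
  have := jap_add_le (ξ + η) (-η)
  rwa [add_neg_cancel_right, norm_neg] at this

variable {p : Eucl n → Eucl n → ℂ} {z : ℂ} {α : ℝ}

lemma Lam_pos (h0 : 0 < α) (x ξ : Eucl n) : 0 < Lam p z α x ξ :=
  Real.sqrt_pos.2 (by positivity)

lemma Lam_sq (h0 : 0 < α) (x ξ : Eucl n) :
    Lam p z α x ξ ^ 2 = (α + ‖p x ξ - z‖ ^ 2) / (1 + ‖p x ξ - z‖ ^ 2) :=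
  Real.sq_sqrt (by positivity)

lemma Lam_le_one (h1 : α < 1) (x ξ : Eucl n) : Lam p z α x ξ ≤ 1 := by
  refine Real.sqrt_le_one.2 ?_
  rw [div_le_one (by positivity)]; linarith

lemma le_Lam_sq (h0 : 0 < α) (h1 : α < 1) (x ξ : Eucl n) : α ≤ Lam p z α x ξ ^ 2 := by
  rw [Lam_sq h0, le_div_iff₀ (by positivity)]
  nlinarith [sq_nonneg ‖p x ξ - z‖]

lemma sqrt_le_Lam {h : ℝ} (h0 : 0 < α) (h1 : α < 1) (hh : h ≤ α) (x ξ : Eucl n) :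
    Real.sqrt h ≤ Lam p z α x ξ :=
  Real.sqrt_le_iff.2 ⟨(Lam_pos h0 x ξ).le, hh.trans (le_Lam_sq h0 h1 x ξ)⟩

/-- The slow variation of `Λ`, on the scale `√h`, in terms of bounds on `p`. -/
lemma Lam_le_of_bounds {h J K C₁ C₂ d : ℝ} {x y ξ : Eucl n} (h0 : 0 < h) (hh : h ≤ α)
    (h1 : α < 1) (hJ : 1 ≤ J) (hC₁ : 0 ≤ C₁) (hC₂ : 0 ≤ C₂) (hd : 0 ≤ d)
    (hlip : ‖p y ξ - p x ξ‖ ≤ K * d * J) (hup : 1 + ‖p x ξ - z‖ ^ 2 ≤ C₁ * J ^ 2)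
    (hlow : J ^ 2 ≤ C₂ * (1 + ‖p y ξ - z‖ ^ 2)) :
    Lam p z α y ξ ≤
      Real.sqrt (2 * C₁ * C₂ + 2 * K ^ 2 * C₂) * Lam p z α x ξ * (1 + d / Real.sqrt h) := by
  have hα : 0 < α := h0.trans_le hh
  have hX := Lam_pos (p := p) (z := z) hα x ξ
  have hs : 0 < Real.sqrt h := Real.sqrt_pos.2 h0
  have hJ0 : 0 < J := by linarith
  set s := ‖p x ξ - z‖
  set t := ‖p y ξ - z‖
  have ht : t ≤ s + K * d * J := by
    have : p y ξ - z = (p x ξ - z) + (p y ξ - p x ξ) := by ring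
    calc t = ‖(p x ξ - z) + (p y ξ - p x ξ)‖ := by rw [← this]
      _ ≤ _ := (norm_add_le _ _).trans (by gcongr)
  have ht2 : t ^ 2 ≤ 2 * s ^ 2 + 2 * (K * d * J) ^ 2 := by
    have := pow_le_pow_left₀ (norm_nonneg _) ht 2
    nlinarith [sq_nonneg (s - K * d * J)]
  have e1 : Lam p z α y ξ ^ 2 ≤ (2 * C₁ * C₂ + 2 * K ^ 2 * C₂) *
      (Lam p z α x ξ ^ 2 * (1 + (d / Real.sqrt h) ^ 2)) := by
    have a1 : Lam p z α y ξ ^ 2 * J ^ 2 ≤ C₂ * (2 * (α + s ^ 2) + 2 * (K * d * J) ^ 2) := by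
      rw [Lam_sq hα, div_mul_eq_mul_div, div_le_iff₀ (by positivity)]
      have b1 : α + t ^ 2 ≤ 2 * (α + s ^ 2) + 2 * (K * d * J) ^ 2 := by linarith
      calc (α + t ^ 2) * J ^ 2 ≤ (2 * (α + s ^ 2) + 2 * (K * d * J) ^ 2) *
            (C₂ * (1 + t ^ 2)) := by gcongr
        _ = _ := by ring
    have a2 : α + s ^ 2 ≤ Lam p z α x ξ ^ 2 * (C₁ * J ^ 2) := by
      calc α + s ^ 2 = Lam p z α x ξ ^ 2 * (1 + s ^ 2) := by
            rw [Lam_sq hα]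
            have : 1 + s ^ 2 ≠ 0 := by positivity
            field_simp
            rfl
        _ ≤ _ := by gcongr
    have a3 : d ^ 2 ≤ Lam p z α x ξ ^ 2 * (d / Real.sqrt h) ^ 2 := by
      rw [div_pow, Real.sq_sqrt h0.le, mul_div_assoc', le_div_iff₀ h0, mul_comm]
      gcongr
      exact hh.trans (le_Lam_sq hα h1 x ξ)
    have a4 : Lam p z α y ξ ^ 2 * J ^ 2 ≤ ((2 * C₁ * C₂ + 2 * K ^ 2 * C₂) *
      (Lam p z α x ξ ^ 2 * (1 + (d / Real.sqrt h) ^ 2))) * J ^ 2 := by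
      have b2 : C₂ * (2 * (α + s ^ 2)) ≤ C₂ * (2 * (Lam p z α x ξ ^ 2 * (C₁ * J ^ 2))) := by gcongr
      have b3 : C₂ * (2 * (K * d * J) ^ 2) ≤
          C₂ * (2 * (K ^ 2 * (Lam p z α x ξ ^ 2 * (d / Real.sqrt h) ^ 2) * J ^ 2)) := by
        rw [mul_pow, mul_pow]; gcongr
      have b4 : 0 ≤ 2 * C₁ * C₂ * (Lam p z α x ξ ^ 2 * (d / Real.sqrt h) ^ 2) * J ^ 2 := by
        positivity
      have b5 : 0 ≤ 2 * K ^ 2 * C₂ * Lam p z α x ξ ^ 2 * J ^ 2 := by positivity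
      nlinarith
    exact le_of_mul_le_mul_right a4 (by positivity)
  have e2 : 0 ≤ d / Real.sqrt h := by positivity
  refine (pow_le_pow_iff_left₀ (Lam_pos hα y ξ).le (by positivity) two_ne_zero).1 ?_
  rw [mul_pow, mul_pow, Real.sq_sqrt (by positivity), mul_assoc]
  refine e1.trans ?_
  gcongr
  nlinarith

end Weights

/-! ### Ellipticity, and the slow variation of `Λ` -/

section Elliptic

variable {n : ℕ} {U : Set (Eucl n)} {m : ℕ} {coef : (Fin n → ℕ) → Eucl n → ℂ}

lemma norm_mono_le_jap (γ : Fin n → ℕ) (ξ : Eucl n) : ‖mono γ ξ‖ ≤ jap ξ ^ mlen γ := by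
  unfold mono mlen
  rw [norm_prod, ← Finset.prod_pow_eq_pow_sum]
  refine Finset.prod_le_prod (fun _ _ => norm_nonneg _) fun i _ => ?_
  rw [norm_pow]
  refine pow_le_pow_left₀ (norm_nonneg _) ?_ _
  rw [coordC, Complex.norm_real]
  exact (PiLp.norm_apply_le ξ i).trans (norm_le_jap ξ)

lemma exists_lipschitz_of_compact (hU : IsOpen U) {f : Eucl n → ℂ} (hf : ContDiffOn ℝ ∞ f U)
    {L : Set (Eucl n)} (hL : IsCompact L) (hLU : L ⊆ U) :
    ∃ C, 0 ≤ C ∧ ∀ x ∈ L, ∀ y ∈ L, ‖f y - f x‖ ≤ C * ‖y - x‖ := by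
  have : LocallyLipschitzOn L f := by
    intro x hx
    have h1 : ContDiffAt ℝ 1 f x := (hf.contDiffAt (hU.mem_nhds (hLU hx))).of_le (by norm_cast)
    obtain ⟨K, t, ht, hK⟩ := h1.exists_lipschitzOnWith
    exact ⟨K, t, mem_nhdsWithin_of_mem_nhds ht, hK⟩
  obtain ⟨K, hK⟩ := this.exists_lipschitzOnWith_of_compact hL
  exact ⟨K, K.2, fun x hx y hy => hK.norm_sub_le hy hx⟩

lemma homPart_bounds (hU : IsOpen U) {j : ℕ} (hcoef : ∀ γ, mlen γ = j → ContDiffOn ℝ ∞ (coef γ) U)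
    {L : Set (Eucl n)} (hL : IsCompact L) (hLU : L ⊆ U) :
    ∃ C, 0 ≤ C ∧ ∀ x ∈ L, ∀ ξ, ‖homPart coef j x ξ‖ ≤ C * jap ξ ^ j ∧
      ∀ y ∈ L, ‖homPart coef j y ξ - homPart coef j x ξ‖ ≤ C * ‖y - x‖ * jap ξ ^ j := by
  have h1 : ∀ γ, ∃ C, 0 ≤ C ∧ (γ ∈ multiOfLen n j → ∀ x ∈ L, ‖coef γ x‖ ≤ C ∧
      ∀ y ∈ L, ‖coef γ y - coef γ x‖ ≤ C * ‖y - x‖) := by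
    intro γ
    by_cases hγ : γ ∈ multiOfLen n j
    · have hs := hcoef γ (mem_multiOfLen.1 hγ)
      obtain ⟨C, hC⟩ := hL.exists_bound_of_continuousOn (hs.continuousOn.mono hLU)
      obtain ⟨C', hC', h⟩ := exists_lipschitz_of_compact hU hs hL hLU
      refine ⟨|C| + C', by positivity, fun _ x hx => ⟨?_, fun y hy => ?_⟩⟩
      · linarith [hC x hx, le_abs_self C]
      · refine (h x hx y hy).trans ?_
        gcongr
        linarith [abs_nonneg C]
    · exact ⟨0, le_rfl, fun h => absurd h hγ⟩
  choose C hC0 hC using h1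
  refine ⟨∑ γ ∈ multiOfLen n j, C γ, Finset.sum_nonneg fun γ _ => hC0 γ,
    fun x hx ξ => ⟨?_, fun y hy => ?_⟩⟩
  · unfold homPart
    rw [Finset.sum_mul]
    refine (norm_sum_le _ _).trans (Finset.sum_le_sum fun γ hγ => ?_)
    rw [norm_mul, ← mem_multiOfLen.1 hγ]
    exact mul_le_mul ((hC γ hγ x hx).1) (norm_mono_le_jap γ ξ) (norm_nonneg _) (hC0 γ)
  · unfold homPart
    rw [← Finset.sum_sub_distrib, Finset.sum_mul, Finset.sum_mul]
    refine (norm_sum_le _ _).trans (Finset.sum_le_sum fun γ hγ => ?_)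
    rw [← sub_mul, norm_mul, ← mem_multiOfLen.1 hγ]
    exact mul_le_mul ((hC γ hγ x hx).2 y hy) (norm_mono_le_jap γ ξ) (norm_nonneg _)
      (mul_nonneg (hC0 γ) (norm_nonneg _))

lemma polySymbol_bounds (hU : IsOpen U) {m k : ℕ} (hk : k ≤ m)
    (hcoef : ∀ γ, mlen γ ≤ m → ContDiffOn ℝ ∞ (coef γ) U)
    {L : Set (Eucl n)} (hL : IsCompact L) (hLU : L ⊆ U) :
    ∃ C, 0 ≤ C ∧ ∀ x ∈ L, ∀ ξ, ‖polySymbol k coef x ξ‖ ≤ C * jap ξ ^ k ∧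
      ∀ y ∈ L, ‖polySymbol k coef y ξ - polySymbol k coef x ξ‖ ≤ C * ‖y - x‖ * jap ξ ^ k := by
  have h1 : ∀ j, ∃ C, 0 ≤ C ∧ (j ∈ Finset.range (k + 1) → ∀ x ∈ L, ∀ ξ,
      ‖homPart coef j x ξ‖ ≤ C * jap ξ ^ j ∧
      ∀ y ∈ L, ‖homPart coef j y ξ - homPart coef j x ξ‖ ≤ C * ‖y - x‖ * jap ξ ^ j) := by
    intro j
    by_cases hj : j ∈ Finset.range (k + 1)
    · obtain ⟨C, hC0, hC⟩ := homPart_bounds hU (j := j) (coef := coef) (fun γ hγ => hcoef γ (by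
        rw [hγ]; exact (Finset.mem_range_succ_iff.1 hj).trans hk)) hL hLU
      exact ⟨C, hC0, fun _ => hC⟩
    · exact ⟨0, le_rfl, fun h => absurd h hj⟩
  choose C hC0 hC using h1
  have hp : ∀ j ∈ Finset.range (k + 1), ∀ ξ : Eucl n, jap ξ ^ j ≤ jap ξ ^ k := fun j hj ξ =>
    pow_le_pow_right₀ (one_le_jap ξ) (Finset.mem_range_succ_iff.1 hj)
  refine ⟨∑ j ∈ Finset.range (k + 1), C j, Finset.sum_nonneg fun γ _ => hC0 γ,
    fun x hx ξ => ⟨?_, fun y hy => ?_⟩⟩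
  · unfold polySymbol
    rw [Finset.sum_mul]
    refine (norm_sum_le _ _).trans (Finset.sum_le_sum fun j hj => ?_)
    exact ((hC j hj x hx ξ).1).trans (mul_le_mul_of_nonneg_left (hp j hj ξ) (hC0 j))
  · unfold polySymbol
    rw [← Finset.sum_sub_distrib, Finset.sum_mul, Finset.sum_mul]
    refine (norm_sum_le _ _).trans (Finset.sum_le_sum fun j hj => ?_)
    exact ((hC j hj x hx ξ).2 y hy).trans
      (mul_le_mul_of_nonneg_left (hp j hj ξ) (mul_nonneg (hC0 j) (norm_nonneg _)))

/-- Ellipticity: `⟨ξ⟩^m ≤ C (1 + |p - z|)`. -/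
lemma jap_pow_le_of_elliptic (hU : IsOpen U)
    (hcoef : ∀ γ, mlen γ ≤ m → ContDiffOn ℝ ∞ (coef γ) U)
    (hell : ClassicallyElliptic U m coef) (z : ℂ) {L : Set (Eucl n)} (hL : IsCompact L)
    (hLU : L ⊆ U) :
    ∃ C, 0 ≤ C ∧ ∀ x ∈ L, ∀ ξ, jap ξ ^ m ≤ C * (1 + ‖polySymbol m coef x ξ - z‖) := by
  cases m with
  | zero => exact ⟨1, zero_le_one, fun x _ ξ => by simp⟩
  | succ m =>
    obtain ⟨C₀, hC₀, h0⟩ := hell L hL hLU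
    obtain ⟨C₁, hC₁, h1⟩ := polySymbol_bounds hU (Nat.le_succ m) hcoef hL hLU
    -- beyond the threshold `T` the lower order terms are absorbed by the principal part
    set T := 2 * (2 ^ (m + 1) * C₀ * C₁) with hT
    refine ⟨T ^ (m + 1) + 2 * (2 ^ (m + 1) * (1 + C₀ * ‖z‖)) + 2 * (2 ^ (m + 1) * C₀),
      by positivity, fun x hx ξ => ?_⟩
    set t := ‖polySymbol (m + 1) coef x ξ - z‖ with ht
    have ht0 : 0 ≤ t := norm_nonneg _
    have hT0 : 0 ≤ T := by positivity
    by_cases hj : jap ξ ≤ T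
    · have := pow_le_pow_left₀ (jap_pos ξ).le hj (m + 1)
      have a1 : 0 ≤ 2 * (2 ^ (m + 1) * (1 + C₀ * ‖z‖)) + 2 * (2 ^ (m + 1) * C₀) := by positivity
      nlinarith [pow_nonneg hT0 (m + 1), mul_nonneg (pow_nonneg hT0 (m + 1)) ht0, mul_nonneg a1 ht0]
    · push Not at hj
      have b1 : ‖ξ‖ ^ (m + 1) ≤ C₀ * ‖homPart coef (m + 1) x ξ‖ := by
        have := h0 x hx ξ
        rwa [one_div, inv_mul_le_iff₀ hC₀] at this
      have b2 : ‖homPart coef (m + 1) x ξ‖ ≤ t + ‖z‖ + C₁ * jap ξ ^ m := by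
        have e : homPart coef (m + 1) x ξ =
            (polySymbol (m + 1) coef x ξ - z) + z - polySymbol m coef x ξ := by
          unfold polySymbol
          rw [Finset.sum_range_succ _ (m + 1)]; ring
        rw [e]
        refine (norm_sub_le _ _).trans (add_le_add (norm_add_le _ _) (h1 x hx ξ).1)
      have b3 : jap ξ ^ (m + 1) ≤ 2 ^ (m + 1) * (1 + ‖ξ‖ ^ (m + 1)) := by
        rcases le_total ‖ξ‖ 1 with h | h
        · have : jap ξ ≤ 2 := (jap_le_one_add ξ).trans (by linarith)
          refine (pow_le_pow_left₀ (jap_pos ξ).le this _).trans ?_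
          exact le_mul_of_one_le_right (by positivity)
            (by linarith [pow_nonneg (norm_nonneg ξ) (m + 1)])
        · have : jap ξ ≤ 2 * ‖ξ‖ := (jap_le_one_add ξ).trans (by linarith)
          refine (pow_le_pow_left₀ (jap_pos ξ).le this _).trans ?_
          rw [mul_pow]
          gcongr; linarith
      have b4 : 2 ^ (m + 1) * (C₀ * (C₁ * jap ξ ^ m)) ≤ jap ξ ^ (m + 1) / 2 := by
        have : T * jap ξ ^ m ≤ jap ξ ^ (m + 1) := by
          rw [pow_succ, mul_comm]
          exact mul_le_mul_of_nonneg_left hj.le (pow_nonneg (jap_pos ξ).le _)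
        rw [hT] at this
        linarith
      have b5 : jap ξ ^ (m + 1) ≤ 2 ^ (m + 1) * (1 + C₀ * (t + ‖z‖ + C₁ * jap ξ ^ m)) :=
        b3.trans (by gcongr; exact b1.trans (by gcongr))
      have b6 : jap ξ ^ (m + 1) ≤ 2 * (2 ^ (m + 1) * (1 + C₀ * ‖z‖)) +
          2 * (2 ^ (m + 1) * C₀) * t := by nlinarith
      have a1 : 0 ≤ 2 * (2 ^ (m + 1) * (1 + C₀ * ‖z‖)) := by positivity
      have a2 : 0 ≤ 2 * (2 ^ (m + 1) * C₀) := by positivity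
      nlinarith [pow_nonneg hT0 (m + 1), mul_nonneg (pow_nonneg hT0 (m + 1)) ht0, mul_nonneg a1 ht0]

/-- `Λ` varies slowly on the scale `√h`, uniformly in `ξ` and in the parameters. -/
theorem exists_Lam_le (hU : IsOpen U)
    (hcoef : ∀ γ, mlen γ ≤ m → ContDiffOn ℝ ∞ (coef γ) U)
    (hell : ClassicallyElliptic U m coef) (z : ℂ) {L : Set (Eucl n)} (hL : IsCompact L)
    (hLU : L ⊆ U) :
    ∃ C, 1 ≤ C ∧ ∀ x ∈ L, ∀ y ∈ L, ∀ ξ, ∀ h α : ℝ, 0 < h → h ≤ α → α < 1 →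
      Lam (polySymbol m coef) z α y ξ ≤
        Lam (polySymbol m coef) z α x ξ * (C * (1 + ‖y - x‖ / Real.sqrt h)) := by
  obtain ⟨C₂, hC₂, h2⟩ := jap_pow_le_of_elliptic hU hcoef hell z hL hLU
  obtain ⟨C₁, hC₁, h1⟩ := polySymbol_bounds hU le_rfl hcoef hL hLU
  refine ⟨1 + Real.sqrt (2 * (1 + (C₁ + ‖z‖) ^ 2) * (2 * C₂ ^ 2) + 2 * C₁ ^ 2 * (2 * C₂ ^ 2)),
    by linarith [Real.sqrt_nonneg (2 * (1 + (C₁ + ‖z‖) ^ 2) * (2 * C₂ ^ 2) +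
      2 * C₁ ^ 2 * (2 * C₂ ^ 2))], fun x hx y hy ξ h α h0 hh hα => ?_⟩
  have hJ : 1 ≤ jap ξ ^ m := one_le_pow₀ (one_le_jap ξ)
  have := Lam_le_of_bounds (p := polySymbol m coef) (z := z) (x := x) (y := y) (ξ := ξ)
    (J := jap ξ ^ m) (K := C₁) (C₁ := 1 + (C₁ + ‖z‖) ^ 2) (C₂ := 2 * C₂ ^ 2) (d := ‖y - x‖)
    h0 hh hα hJ (by positivity) (by positivity) (norm_nonneg _) ((h1 x hx ξ).2 y hy) ?_ ?_
  · refine this.trans ?_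
    have a1 := Lam_pos (p := polySymbol m coef) (z := z) (h0.trans_le hh) x ξ
    have a2 : 0 ≤ ‖y - x‖ / Real.sqrt h := by positivity
    rw [mul_comm (Real.sqrt _) (Lam _ _ _ _ _), mul_assoc]
    gcongr
    linarith
  · have b1 : ‖polySymbol m coef x ξ - z‖ ≤ (C₁ + ‖z‖) * jap ξ ^ m := by
      refine (norm_sub_le _ _).trans ?_
      have := (h1 x hx ξ).1
      nlinarith [norm_nonneg z, mul_le_mul_of_nonneg_left hJ (norm_nonneg z)]
    have b2 := pow_le_pow_left₀ (norm_nonneg _) b1 2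
    rw [mul_pow] at b2
    nlinarith
  · have b1 := pow_le_pow_left₀ (by positivity) (h2 y hy ξ) 2
    refine b1.trans ?_
    rw [mul_pow, mul_comm 2 (C₂ ^ 2), mul_assoc]
    gcongr
    nlinarith [sq_nonneg (1 - ‖polySymbol m coef y ξ - z‖)]

end Elliptic

/-! ### Differentiation in the symbol classes -/

section Classes

variable {n : ℕ} {R : ℝ} {U : Set (Eucl n)} {p : Eucl n → Eucl n → ℂ} {z : ℂ} {r k l : ℝ}
  {a b : SymbolFamily n R}

lemma MemS10.smooth (ha : MemS10 U (fun ξ => jap ξ ^ r) a) (q : Param R) : Smooth2 U (a q) :=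
  ha.1 q

lemma MemS10.pX (hU : IsOpen U) (ha : MemS10 U (fun ξ => jap ξ ^ r) a) (i : Fin n) :
    MemS10 U (fun ξ => jap ξ ^ r) (fun q => pX i (a q)) := by
  refine ⟨fun q => (ha.smooth q).pX hU i, fun γ β L hL hLU => ?_⟩
  obtain ⟨C, hC⟩ := ha.2 (γ + Pi.single i 1) β L hL hLU
  refine ⟨C, fun q x hx ξ => ?_⟩
  rw [dX_dXi_pX hU (ha.smooth q) γ β i x (hLU hx) ξ]
  exact hC q x hx ξ

lemma MemS10.pXi (hU : IsOpen U) (ha : MemS10 U (fun ξ => jap ξ ^ r) a) (i : Fin n) :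
    MemS10 U (fun ξ => jap ξ ^ (r - 1)) (fun q => pXi i (a q)) := by
  refine ⟨fun q => (ha.smooth q).pXi hU i, fun γ β L hL hLU => ?_⟩
  obtain ⟨C, hC⟩ := ha.2 γ (β + Pi.single i 1) L hL hLU
  refine ⟨C, fun q x hx ξ => ?_⟩
  rw [dX_dXi_pXi hU (ha.smooth q) γ β i x (hLU hx) ξ]
  refine (hC q x hx ξ).trans (le_of_eq ?_)
  beta_reduce
  rw [mlen_add_single, Real.rpow_sub_one (jap_pos ξ).ne', pow_succ, mul_inv]
  ring

/-- The weight `⟨ξ⟩^k Λ^l`. -/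
def wt (p : Eucl n → Eucl n → ℂ) (z : ℂ) (R k l : ℝ) : Param R → Eucl n → Eucl n → ℝ :=
  fun q x ξ => jap ξ ^ k * Lam p z q.α x ξ ^ l

lemma Param.α_pos (q : Param R) : 0 < q.α := q.h_pos.trans_le q.h_le

lemma wt_pos (q : Param R) (x ξ : Eucl n) : 0 < wt p z R k l q x ξ :=
  mul_pos (Real.rpow_pos_of_pos (jap_pos ξ) _) (Real.rpow_pos_of_pos (Lam_pos q.α_pos x ξ) _)

lemma MemSLam.smooth {M : Param R → Eucl n → Eucl n → ℝ} (hb : MemSLam U p z M b) (q : Param R) :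
    Smooth2 U (b q) :=
  hb.1 q

lemma MemSLam.pX (hU : IsOpen U) (hb : MemSLam U p z (wt p z R k l) b) (i : Fin n) :
    MemSLam U p z (wt p z R k (l - 1)) (fun q => pX i (b q)) := by
  refine ⟨fun q => (hb.smooth q).pX hU i, fun γ β => ?_⟩
  obtain ⟨J, hJ⟩ := hb.2 (γ + Pi.single i 1) β
  refine ⟨J, fun L hL hLU => ?_⟩
  obtain ⟨C, hC⟩ := hJ L hL hLU
  refine ⟨C, fun q x hx ξ => ?_⟩
  rw [dX_dXi_pX hU (hb.smooth q) γ β i x (hLU hx) ξ]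
  refine (hC q x hx ξ).trans (le_of_eq ?_)
  rw [mlen_add_single, wt, wt, Real.rpow_sub_one (Lam_pos q.α_pos x ξ).ne', add_right_comm,
    pow_succ, mul_inv]
  ring

lemma MemSLam.pXi (hU : IsOpen U) (hb : MemSLam U p z (wt p z R k l) b) (i : Fin n) :
    MemSLam U p z (wt p z R (k - 1) (l - 1)) (fun q => pXi i (b q)) := by
  refine ⟨fun q => (hb.smooth q).pXi hU i, fun γ β => ?_⟩
  obtain ⟨J, hJ⟩ := hb.2 γ (β + Pi.single i 1)
  refine ⟨J, fun L hL hLU => ?_⟩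
  obtain ⟨C, hC⟩ := hJ L hL hLU
  refine ⟨C, fun q x hx ξ => ?_⟩
  rw [dX_dXi_pXi hU (hb.smooth q) γ β i x (hLU hx) ξ]
  refine (hC q x hx ξ).trans (le_of_eq ?_)
  rw [mlen_add_single, wt, wt, Real.rpow_sub_one (Lam_pos q.α_pos x ξ).ne',
    Real.rpow_sub_one (jap_pos ξ).ne', ← add_assoc, pow_succ, pow_succ, mul_inv, mul_inv]
  ring

lemma MemSLam.weaken (hb : MemSLam U p z (wt p z R k l) b) :
    MemSLam U p z (wt p z R k (l - 1)) b := by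
  refine ⟨hb.1, fun γ β => ?_⟩
  obtain ⟨J, hJ⟩ := hb.2 γ β
  refine ⟨J, fun L hL hLU => ?_⟩
  obtain ⟨C, hC⟩ := hJ L hL hLU
  refine ⟨|C|, fun q x hx ξ => (hC q x hx ξ).trans ?_⟩
  have hΛ := Lam_pos (p := p) (z := z) q.α_pos x ξ
  have h1 : wt p z R k l q x ξ ≤ wt p z R k (l - 1) q x ξ := by
    unfold wt
    refine mul_le_mul_of_nonneg_left ?_ (Real.rpow_pos_of_pos (jap_pos ξ) _).le
    exact Real.rpow_le_rpow_of_exponent_ge hΛ (Lam_le_one q.α_lt x ξ) (by linarith)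
  have h2 := (wt_pos (p := p) (z := z) (k := k) (l := l) q x ξ).le
  have h3 := (jap_pos ξ).le
  gcongr
  exact le_abs_self C

/-- `b(x, ξ) = 0` for `x ∉ K`. -/
def SuppIn (K : Set (Eucl n)) (b : Eucl n → Eucl n → ℂ) : Prop := ∀ x ξ, x ∉ K → b x ξ = 0

variable {K : Set (Eucl n)}

lemma SuppIn.pX (hK : IsClosed K) {b : Eucl n → Eucl n → ℂ} (hb : SuppIn K b) (i : Fin n) :
    SuppIn K (pX i b) := by
  intro x ξ hx
  unfold ExoticCalculus.pX
  have := pderiv_eqOn hK.isOpen_compl i (f := fun y => b y ξ) (g := fun _ => 0)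
    (fun y hy => hb y ξ hy) hx
  rw [this, pderiv_const]

lemma SuppIn.pXi {b : Eucl n → Eucl n → ℂ} (hb : SuppIn K b) (i : Fin n) :
    SuppIn K (pXi i b) := by
  intro x ξ hx
  unfold ExoticCalculus.pXi
  have : b x = fun _ => 0 := funext fun ξ => hb x ξ hx
  rw [this, pderiv_const]

lemma SuppIn.dX (hK : IsClosed K) {b : Eucl n → Eucl n → ℂ} (hb : SuppIn K b) (γ : Fin n → ℕ) :
    SuppIn K (dX γ b) := by
  rw [dX_eq_mop]
  exact mop_induction (T := ExoticCalculus.pX (n := n)) (fun _ b => SuppIn K b)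
    (fun i _ _ h => h.pX hK i) γ 0 b hb

/-- A smooth function on `U × ℝⁿ`, supported in `K × ℝⁿ` with `K ⊆ U` closed, is smooth. -/
lemma SuppIn.contDiff (hU : IsOpen U) (hK : IsClosed K) (hKU : K ⊆ U)
    {b : Eucl n → Eucl n → ℂ} (hb : SuppIn K b) (hs : Smooth2 U b) : Smooth2 Set.univ b := by
  intro v _
  refine ContDiffAt.contDiffWithinAt ?_
  by_cases hv : v.1 ∈ U
  · exact hs.contDiffAt hU hv v.2
  · have : (fun v : Eucl n × Eucl n => b v.1 v.2) =ᶠ[nhds v] fun _ => 0 := by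
      filter_upwards [(hK.isOpen_compl.preimage continuous_fst).mem_nhds
        (show v.1 ∉ K from fun h => hv (hKU h))] with y hy using hb y.1 y.2 hy
    exact contDiffAt_const.congr_of_eventuallyEq this

lemma Smooth2.slice_left (hU : IsOpen U) {a : Eucl n → Eucl n → ℂ} (ha : Smooth2 U a) {x : Eucl n}
    (hx : x ∈ U) : ContDiff ℝ ∞ (a x) := by
  rw [contDiff_iff_contDiffAt]
  intro ξ
  exact ContDiffAt.comp (g := fun v : Eucl n × Eucl n => a v.1 v.2) (f := fun ξ => (x, ξ)) ξ
    (ha.contDiffAt hU hx ξ) (contDiffAt_const.prodMk contDiffAt_id)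

lemma Smooth2.slice_right {b : Eucl n → Eucl n → ℂ} (hb : Smooth2 Set.univ b) (ξ : Eucl n) :
    ContDiff ℝ ∞ (fun y => b y ξ) := by
  rw [contDiff_iff_contDiffAt]
  intro x
  exact ContDiffAt.comp (g := fun v : Eucl n × Eucl n => b v.1 v.2) (f := fun x => (x, ξ)) x
    (hb.contDiffAt isOpen_univ (Set.mem_univ x) ξ) (contDiffAt_id.prodMk contDiffAt_const)

lemma SuppIn.hasCompactSupport (hK : IsCompact K) {b : Eucl n → Eucl n → ℂ} (hb : SuppIn K b)
    (ξ : Eucl n) : HasCompactSupport (fun y => b y ξ) :=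
  HasCompactSupport.intro hK fun _ hx => hb _ ξ hx

end Classes

/-! ### The composition symbol as a Fourier integral -/

section Amplitude

variable {n : ℕ} {R : ℝ}

/-- The character `e^{2πi x·w}`. -/
def chr (x w : Eucl n) : ℂ := (Real.fourierChar (inner ℝ x w) : Circle)

lemma norm_chr (x w : Eucl n) : ‖chr x w‖ = 1 := Circle.norm_coe _

lemma chr_add_left (x y w : Eucl n) : chr (x + y) w = chr x w * chr y w := by
  simp [chr, inner_add_left, AddChar.map_add_eq_mul]

lemma chr_add_right (x w v : Eucl n) : chr x (w + v) = chr x w * chr x v := by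
  simp [chr, inner_add_right, AddChar.map_add_eq_mul]

lemma chr_eq_exp (x w : Eucl n) :
    chr x w = Complex.exp (2 * Real.pi * (inner ℝ x w : ℝ) * Complex.I) := by
  rw [chr, Real.fourierChar_apply]; push_cast; rfl

lemma continuous_chr : Continuous fun v : Eucl n × Eucl n => chr v.1 v.2 := by
  unfold chr
  exact continuous_subtype_val.comp (Real.continuous_fourierChar.comp continuous_inner)

lemma fourier_eq_chr (f : Eucl n → ℂ) (w : Eucl n) : 𝓕 f w = ∫ y, chr (-y) w * f y := by
  rw [Real.fourier_eq]
  simp [chr, Circle.smul_def]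

lemma osc_eq_chr {h : ℝ} (hh : h ≠ 0) (x w : Eucl n) :
    osc h x ((2 * Real.pi * h) • w) = chr x w := by
  rw [osc, chr_eq_exp, inner_smul_right]
  congr 1
  have : (2 * Real.pi * h * inner ℝ x w / h : ℝ) = 2 * Real.pi * inner ℝ x w := by
    field_simp
  rw [this]
  push_cast; ring

lemma osc_eq_chr_smul {h : ℝ} (hh : h ≠ 0) (x ξ : Eucl n) :
    osc h x ξ = chr x ((2 * Real.pi * h)⁻¹ • ξ) := by
  rw [← osc_eq_chr hh, smul_inv_smul₀ (by positivity)]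

/-- The operator `Op_h(a)` in terms of the Fourier transform of `u`. -/
lemma Op_eq {h : ℝ} (hh : 0 < h) (a : Eucl n → Eucl n → ℂ) (u : Eucl n → ℂ) (x : Eucl n) :
    Op h a u x = ∫ w, chr x w * a x ((2 * Real.pi * h) • w) * 𝓕 u w := by
  have h0 : 0 < 2 * Real.pi * h := by positivity
  obtain ⟨F, hF⟩ : ∃ F : Eucl n → ℂ,
    F = fun η : Eucl n => ∫ y : Eucl n, osc h (x - y) η * a x η * u y := ⟨_, rfl⟩
  have e : ∀ w : Eucl n, chr x w * a x ((2 * Real.pi * h) • w) * 𝓕 u w =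
      F ((2 * Real.pi * h) • w) := by
    intro w
    rw [hF]
    beta_reduce
    rw [fourier_eq_chr, ← integral_const_mul]
    congr 1; funext y
    rw [osc_eq_chr hh.ne', sub_eq_add_neg, chr_add_left]
    ring
  simp only [e]
  rw [Measure.integral_comp_smul, Op, finrank_euclideanSpace, Fintype.card_fin,
    abs_of_pos (by positivity), Complex.real_smul, hF]
  push_cast; rfl

/-- The composition symbol `∫ e^{2πi x·w} a(x, ξ + 2πh w) 𝓕(b(·, ξ))(w) dw`. -/
def amp (h : ℝ) (a b : Eucl n → Eucl n → ℂ) (x ξ : Eucl n) : ℂ :=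
  ∫ w, chr x w * a x (ξ + (2 * Real.pi * h) • w) * 𝓕 (fun y => b y ξ) w

lemma compSymbol_eq_amp (a b : SymbolFamily n R) (q : Param R) (x ξ : Eucl n) :
    compSymbol a b q x ξ = amp q.h (a q) (b q) x ξ := by
  have h0 := q.h_pos
  have hc : 2 * Real.pi * q.h ≠ 0 := by positivity
  set v := (2 * Real.pi * q.h)⁻¹ • ξ with hv
  rw [compSymbol, Op_eq h0, amp, ← integral_const_mul]
  rw [← integral_add_right_eq_self _ v]
  congr 1; funext w
  have e1 : 𝓕 (fun y => b q y ξ * osc q.h y ξ) (w + v) = 𝓕 (fun y => b q y ξ) w := by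
    rw [fourier_eq_chr, fourier_eq_chr]
    congr 1; funext y
    have e2 : chr (-y) v * chr y v = 1 := by
      rw [← chr_add_left, neg_add_cancel]; simp [chr]
    rw [osc_eq_chr_smul h0.ne', ← hv, chr_add_right]
    linear_combination (chr (-y) w * b q y ξ) * e2
  have e3 : (2 * Real.pi * q.h) • (w + v) = ξ + (2 * Real.pi * q.h) • w := by
    rw [smul_add, hv, smul_inv_smul₀ hc, add_comm]
  have e4 : chr (-x) v * chr x v = 1 := by
    rw [← chr_add_left, neg_add_cancel]; simp [chr]
  rw [e1, e3, osc_eq_chr_smul h0.ne', ← hv, chr_add_right]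
  linear_combination (chr x w * a q x (ξ + (2 * Real.pi * q.h) • w) * 𝓕 (fun y => b q y ξ) w) * e4

lemma fourier_comp_affine {c : ℝ} (hc : 0 < c) (f : Eucl n → ℂ) (x w : Eucl n) :
    𝓕 (fun y => f (x + c • y)) w = ((c ^ n : ℝ) : ℂ)⁻¹ * (chr x (c⁻¹ • w) * 𝓕 f (c⁻¹ • w)) := by
  rw [fourier_eq_chr, fourier_eq_chr]
  obtain ⟨F, hF⟩ : ∃ F : Eucl n → ℂ, F = fun Y => chr (-Y) (c⁻¹ • w) * f (x + Y) := ⟨_, rfl⟩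
  obtain ⟨G, hG⟩ : ∃ G : Eucl n → ℂ,
    G = fun y => chr x (c⁻¹ • w) * (chr (-y) (c⁻¹ • w) * f y) := ⟨_, rfl⟩
  have e : ∀ y, chr (-y) w * f (x + c • y) = F (c • y) := by
    intro y
    have : chr (-(c • y)) (c⁻¹ • w) = chr (-y) w := by
      have h1 : inner ℝ (-(c • y)) (c⁻¹ • w) = inner ℝ (-y) w := by
        rw [← smul_neg, real_inner_smul_left, real_inner_smul_right, ← mul_assoc,
          mul_inv_cancel₀ hc.ne', one_mul]
      rw [chr, h1]; rfl
    rw [hF]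
    beta_reduce
    rw [this]
  have e' : F = fun Y => G (x + Y) := by
    rw [hF, hG]
    funext Y
    have e4 : chr x (c⁻¹ • w) * chr (-(x + Y)) (c⁻¹ • w) = chr (-Y) (c⁻¹ • w) := by
      rw [← chr_add_left]; congr 1; abel
    beta_reduce
    rw [← e4, mul_assoc]
  simp only [e]
  rw [Measure.integral_comp_smul, finrank_euclideanSpace, Fintype.card_fin,
    abs_of_pos (by positivity), Complex.real_smul, e', integral_add_left_eq_self G x, hG,
    integral_const_mul]
  push_cast; rfl

/-- The composition symbol, rescaled around `x` to the length `√h`. -/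
lemma amp_eq_scaled {h : ℝ} (hh : 0 < h) (a b : Eucl n → Eucl n → ℂ) (x ξ : Eucl n) :
    amp h a b x ξ = ∫ w, a x (ξ + (2 * Real.pi * Real.sqrt h) • w) *
      𝓕 (fun y => b (x + Real.sqrt h • y) ξ) w := by
  have hc : 0 < Real.sqrt h := Real.sqrt_pos.2 hh
  obtain ⟨F, hF⟩ : ∃ F : Eucl n → ℂ,
    F = fun w => chr x w * a x (ξ + (2 * Real.pi * h) • w) * 𝓕 (fun y => b y ξ) w := ⟨_, rfl⟩
  have e : ∀ w, a x (ξ + (2 * Real.pi * Real.sqrt h) • w) *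
      𝓕 (fun y => b (x + Real.sqrt h • y) ξ) w = ((Real.sqrt h ^ n : ℝ) : ℂ)⁻¹ *
      F ((Real.sqrt h)⁻¹ • w) := by
    intro w
    have e1 : (2 * Real.pi * h) • (Real.sqrt h)⁻¹ • w = (2 * Real.pi * Real.sqrt h) • w := by
      rw [smul_smul]; congr 1
      field_simp
      rw [Real.sq_sqrt hh.le]
    rw [fourier_comp_affine hc (fun y => b y ξ), hF]
    beta_reduce
    rw [e1]
    ring
  simp only [e]
  rw [integral_const_mul, Measure.integral_comp_smul, finrank_euclideanSpace, Fintype.card_fin,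
    abs_of_pos (by positivity), Complex.real_smul, ← mul_assoc, amp, hF]
  have : ((Real.sqrt h ^ n : ℝ) : ℂ) ≠ 0 := by
    exact_mod_cast (pow_pos hc n).ne'
  rw [inv_pow, inv_inv, inv_mul_cancel₀ this, one_mul]

end Amplitude

/-! ### The bound on the remainder, without derivatives -/

section ZeroOrder

variable {n : ℕ} {R : ℝ} {U : Set (Eucl n)} {p : Eucl n → Eucl n → ℂ} {z : ℂ} {r k l : ℝ}
  {a b : SymbolFamily n R} {K : Set (Eucl n)}

/-- As `|Im w|` is bounded by `R`, the exponent of `|Im w|⁻¹` may be increased. -/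
lemma Param.inv_im_pow_le (q : Param R) {i j : ℕ} (hij : i ≤ j) :
    (|q.w.im| ^ i)⁻¹ ≤ (max 1 R) ^ (j - i) * (|q.w.im| ^ j)⁻¹ := by
  have h0 : 0 < |q.w.im| := abs_pos.2 q.im_w
  have h1 : |q.w.im| ≤ max 1 R :=
    ((Complex.abs_im_le_norm _).trans q.norm_w.le).trans (le_max_right _ _)
  rw [← div_eq_mul_inv, le_div_iff₀ (by positivity), inv_mul_le_iff₀ (by positivity)]
  calc |q.w.im| ^ j = |q.w.im| ^ i * |q.w.im| ^ (j - i) := by rw [← pow_add]; congr 1; omega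
    _ ≤ _ := by gcongr

lemma finite_setOf_mlen_le (D : ℕ) : {γ : Fin n → ℕ | mlen γ ≤ D}.Finite := by
  refine ((Finset.range (D + 1)).biUnion (multiOfLen n)).finite_toSet.subset fun γ hγ => ?_
  simp only [Finset.coe_biUnion, Set.mem_iUnion]
  exact ⟨mlen γ, by simpa [Nat.lt_succ_iff] using hγ, mem_multiOfLen.2 rfl⟩

lemma exists_nat_bound (D : ℕ) (f : (Fin n → ℕ) → ℕ) : ∃ J, ∀ γ, mlen γ ≤ D → f γ ≤ J := by
  obtain ⟨J, hJ⟩ := ((finite_setOf_mlen_le D).image f).bddAbove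
  exact ⟨J, fun γ hγ => hJ ⟨γ, hγ, rfl⟩⟩

lemma exists_real_bound (D : ℕ) (f : (Fin n → ℕ) → ℝ) :
    ∃ C, 0 ≤ C ∧ ∀ γ, mlen γ ≤ D → f γ ≤ C := by
  obtain ⟨C, hC⟩ := ((finite_setOf_mlen_le D).image f).bddAbove
  exact ⟨max 0 C, le_max_left _ _, fun γ hγ => (hC ⟨γ, hγ, rfl⟩).trans (le_max_right _ _)⟩

lemma dX_zero (a : Eucl n → Eucl n → ℂ) : dX 0 a = a := by rw [dX_eq_mop, mop_zero]

lemma dXi_zero (a : Eucl n → Eucl n → ℂ) : dXi 0 a = a := by rw [dXi_eq_mop, mop_zero]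

lemma mlen_zero : mlen (0 : Fin n → ℕ) = 0 := by simp [mlen]

lemma MemS10.exists_dXi_le (ha : MemS10 U (fun ξ => jap ξ ^ r) a) (D : ℕ) {L : Set (Eucl n)}
    (hL : IsCompact L) (hLU : L ⊆ U) : ∃ C, 0 ≤ C ∧ ∀ β, mlen β ≤ D → ∀ q, ∀ x ∈ L, ∀ ξ,
      ‖dXi β (a q) x ξ‖ ≤ C * (jap ξ ^ r * (jap ξ ^ mlen β)⁻¹) := by
  have h1 : ∀ β, ∃ C : ℝ, ∀ q, ∀ x ∈ L, ∀ ξ,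
      ‖dXi β (a q) x ξ‖ ≤ C * (jap ξ ^ r * (jap ξ ^ mlen β)⁻¹) := by
    intro β
    obtain ⟨C, hC⟩ := ha.2 0 β L hL hLU
    refine ⟨C, fun q x hx ξ => ?_⟩
    have := hC q x hx ξ
    rwa [dX_zero, mul_assoc] at this
  choose C hC using h1
  obtain ⟨C', hC', h⟩ := exists_real_bound D C
  refine ⟨C', hC', fun β hβ q x hx ξ => (hC β q x hx ξ).trans ?_⟩
  have := (jap_pos ξ)
  exact mul_le_mul_of_nonneg_right (h β hβ) (by positivity)

lemma MemSLam.exists_dX_le (hb : MemSLam U p z (wt p z R k l) b) (D : ℕ) : ∃ J : ℕ,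
    ∀ L : Set (Eucl n), IsCompact L → L ⊆ U → ∃ C, 0 ≤ C ∧ ∀ γ, mlen γ ≤ D → ∀ q, ∀ x ∈ L, ∀ ξ,
      ‖dX γ (b q) x ξ‖ ≤
        C * (wt p z R k l q x ξ * (Lam p z q.α x ξ ^ mlen γ)⁻¹ * (|q.w.im| ^ J)⁻¹) := by
  choose J hJ using fun γ => hb.2 γ 0
  obtain ⟨J', hJ'⟩ := exists_nat_bound D J
  refine ⟨J', fun L hL hLU => ?_⟩
  choose C hC using fun γ => hJ γ L hL hLU
  obtain ⟨C', hC', h⟩ := exists_real_bound D fun γ => |C γ| * (max 1 R) ^ (J' - J γ)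
  refine ⟨C', hC', fun γ hγ q x hx ξ => ?_⟩
  have h1 := hC γ q x hx ξ
  rw [dXi_zero, mlen_zero, add_zero, pow_zero, inv_one, mul_one] at h1
  have hΛ := Lam_pos (p := p) (z := z) q.α_pos x ξ
  have hw := wt_pos (p := p) (z := z) (k := k) (l := l) q x ξ
  have him : 0 < |q.w.im| := abs_pos.2 q.im_w
  calc _ ≤ |C γ| * wt p z R k l q x ξ * (Lam p z q.α x ξ ^ mlen γ)⁻¹ * (|q.w.im| ^ J γ)⁻¹ := by
        refine h1.trans ?_
        gcongr
        exact le_abs_self _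
    _ ≤ |C γ| * wt p z R k l q x ξ * (Lam p z q.α x ξ ^ mlen γ)⁻¹ *
        ((max 1 R) ^ (J' - J γ) * (|q.w.im| ^ J')⁻¹) := by
        gcongr
        exact q.inv_im_pow_le (hJ' γ hγ)
    _ = (|C γ| * (max 1 R) ^ (J' - J γ)) *
        (wt p z R k l q x ξ * (Lam p z q.α x ξ ^ mlen γ)⁻¹ * (|q.w.im| ^ J')⁻¹) := by ring
    _ ≤ _ := by
        gcongr
        exact h γ hγ

lemma contDiff_comp_affine {f : Eucl n → ℂ} (hf : ContDiff ℝ ∞ f) (x : Eucl n) (c : ℝ) :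
    ContDiff ℝ ∞ (fun y => f (x + c • y)) :=
  ContDiff.comp (g := f) (f := fun y => x + c • y) hf (by fun_prop)

lemma pderiv_comp_affine {f : Eucl n → ℂ} (hf : ContDiff ℝ ∞ f) (x : Eucl n) (c : ℝ) (i : Fin n) :
    pderiv i (fun y => f (x + c • y)) = fun y => (c : ℂ) * pderiv i f (x + c • y) := by
  funext y
  have h1 : HasFDerivAt (fun y : Eucl n => x + c • y) (c • ContinuousLinearMap.id ℝ (Eucl n)) y :=
    ((hasFDerivAt_id y).const_smul c).const_add x
  have h2 : fderiv ℝ (fun y => f (x + c • y)) y = _ :=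
    (HasFDerivAt.comp (g := f) y (hf.differentiable (by simp) _).hasFDerivAt h1).fderiv
  unfold pderiv
  rw [h2]
  simp

lemma mderiv_comp_affine {f : Eucl n → ℂ} (hf : ContDiff ℝ ∞ f) (x : Eucl n) (c : ℝ)
    (γ : Fin n → ℕ) :
    mderiv γ (fun y => f (x + c • y)) = fun y => (c : ℂ) ^ mlen γ * mderiv γ f (x + c • y) := by
  obtain ⟨m, hm⟩ : ∃ m, mlen γ = m := ⟨_, rfl⟩
  induction m generalizing γ with
  | zero =>
    obtain rfl := eq_zero_of_mlen hm
    simp [mderiv_zero, mlen_zero]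
  | succ m ih =>
    obtain ⟨i, δ, rfl, hδ⟩ := exists_eq_add_single γ hm
    rw [← pderiv_mderiv δ i (contDiff_comp_affine hf x c), ih δ hδ,
      pderiv_const_mul (contDiff_comp_affine (contDiff_mderiv δ hf) x c),
      pderiv_comp_affine (contDiff_mderiv δ hf), pderiv_mderiv δ i hf, mlen_add_single]
    funext y; ring

/-- The terms of the expansion. -/
def expTerm (h : ℝ) (a b : Eucl n → Eucl n → ℂ) (β : Fin n → ℕ) (x ξ : Eucl n) : ℂ :=
  ((h ^ mlen β / (mfact β : ℝ) : ℝ) : ℂ) * dXi β a x ξ * DX β b x ξ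

lemma expansion_eq (a b : SymbolFamily n R) (N : ℕ) (q : Param R) (x ξ : Eucl n) :
    expansion a b N q x ξ =
      ∑ j ∈ Finset.range N, ∑ β ∈ multiOfLen n j, expTerm q.h (a q) (b q) β x ξ := by
  unfold expansion expTerm
  refine Finset.sum_congr rfl fun j _ => Finset.sum_congr rfl fun β hβ => ?_
  rw [mem_multiOfLen.1 hβ]

lemma norm_expTerm_le {h : ℝ} (hh : 0 < h) (a b : Eucl n → Eucl n → ℂ) (β : Fin n → ℕ)
    (x ξ : Eucl n) : ‖expTerm h a b β x ξ‖ ≤ h ^ mlen β * ‖dXi β a x ξ‖ * ‖dX β b x ξ‖ := by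
  unfold expTerm DX
  have h1 : (1 : ℝ) ≤ mfact β := by exact_mod_cast mfact_pos β
  have h2 : ‖1 / Complex.I‖ = 1 := by simp
  rw [norm_mul, norm_mul, norm_mul, norm_pow (1 / Complex.I), h2, one_pow, one_mul,
    Complex.norm_real, Real.norm_of_nonneg (by positivity)]
  gcongr
  exact div_le_self (by positivity) h1

/-- Bounds on the derivatives of order at least `2N` of `w ↦ a(x, ξ + 2π√h w)`: each derivative
gains `√h ⟨ξ⟩⁻¹`, and Peetre's inequality moves the weight to `ξ`. -/
lemma norm_mderiv_scaled_left_le {f : Eucl n → ℂ} (hf : ContDiff ℝ ∞ f) {h C : ℝ} {N D P : ℕ}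
    (h0 : 0 < h) (h1 : h ≤ 1) (hC : 0 ≤ C) (hP : P = ⌈|r - (2 * N : ℕ)|⌉₊)
    (hfC : ∀ β, mlen β ≤ 2 * N + D → ∀ η, ‖mderiv β f η‖ ≤ C * (jap η ^ r * (jap η ^ mlen β)⁻¹))
    (ξ : Eucl n) (γ : Fin n → ℕ) (hγ1 : 2 * N ≤ mlen γ) (hγ2 : mlen γ ≤ 2 * N + D) (w : Eucl n) :
    ‖mderiv γ (fun w => f (ξ + (2 * Real.pi * Real.sqrt h) • w)) w‖ ≤
      (2 * Real.pi) ^ (2 * N + D + P) * C * (h ^ N * jap ξ ^ (r - (2 * N : ℕ))) *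
        (1 + ‖w‖) ^ P := by
  have hs : 0 < Real.sqrt h := Real.sqrt_pos.2 h0
  have hs1 : Real.sqrt h ≤ 1 := Real.sqrt_le_one.2 h1
  have hsq : Real.sqrt h ^ 2 = h := Real.sq_sqrt h0.le
  have hpi : 1 ≤ 2 * Real.pi := by linarith [Real.pi_gt_three]
  rw [mderiv_comp_affine hf]
  beta_reduce
  rw [norm_mul, norm_pow, Complex.norm_real, Real.norm_of_nonneg (by positivity), mul_pow]
  set η := ξ + (2 * Real.pi * Real.sqrt h) • w with hη
  have hj1 := jap_pos η
  have hj0 := jap_pos ξ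
  have e1 : Real.sqrt h ^ mlen γ ≤ h ^ N := by
    have : h ^ N = Real.sqrt h ^ (2 * N) := by rw [pow_mul, hsq]
    rw [this]
    exact pow_le_pow_of_le_one hs.le hs1 hγ1
  have e2 : (2 * Real.pi) ^ mlen γ ≤ (2 * Real.pi) ^ (2 * N + D) := pow_le_pow_right₀ hpi hγ2
  have e3 : jap η ^ r * (jap η ^ mlen γ)⁻¹ ≤ jap η ^ (r - (2 * N : ℕ)) := by
    rw [Real.rpow_sub hj1, Real.rpow_natCast, div_eq_mul_inv]
    gcongr
    exact one_le_jap η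
  have e4 : jap η ^ (r - (2 * N : ℕ)) ≤
      jap ξ ^ (r - (2 * N : ℕ)) * ((2 * Real.pi) * (1 + ‖w‖)) ^ P := by
    refine (jap_add_rpow_le ξ _ _).trans ?_
    have : ‖(2 * Real.pi * Real.sqrt h) • w‖ ≤ 2 * Real.pi * ‖w‖ := by
      rw [norm_smul, Real.norm_of_nonneg (by positivity)]
      exact mul_le_mul_of_nonneg_right (mul_le_of_le_one_right (by positivity) hs1)
        (norm_nonneg w)
    have h5 : 1 + ‖(2 * Real.pi * Real.sqrt h) • w‖ ≤ 2 * Real.pi * (1 + ‖w‖) := by linarith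
    rw [hP]
    gcongr
  calc (2 * Real.pi) ^ mlen γ * Real.sqrt h ^ mlen γ * ‖mderiv γ f η‖
      ≤ (2 * Real.pi) ^ (2 * N + D) * h ^ N *
        (C * (jap ξ ^ (r - (2 * N : ℕ)) * ((2 * Real.pi) * (1 + ‖w‖)) ^ P)) := by
        gcongr
        refine (hfC γ hγ2 η).trans ?_
        exact mul_le_mul_of_nonneg_left (e3.trans e4) hC
    _ = _ := by rw [mul_pow (2 * Real.pi) (1 + ‖w‖) P, pow_add _ _ P]; ring

/-- Bounds on the derivatives of `y ↦ b(x + √h y, ξ)`: each derivative costs `√h Λ⁻¹ ≤ 1`, and the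
slow variation of `Λ` moves the weight to `x`. -/
lemma norm_mderiv_scaled_right_le {f : Eucl n → ℂ} (hf : ContDiff ℝ ∞ f) {C CΛ I : ℝ} {D Q : ℕ}
    (hC : 0 ≤ C) (hI : 0 ≤ I) (hCΛ : 1 ≤ CΛ) (hQ : Q = ⌈|l|⌉₊) (q : Param R) (x ξ : Eucl n)
    (hfC : ∀ γ, mlen γ ≤ D → ∀ v ∈ K,
      ‖mderiv γ f v‖ ≤ C * (wt p z R k l q v ξ * (Lam p z q.α v ξ ^ mlen γ)⁻¹ * I))
    (hf0 : ∀ γ, ∀ v ∉ K, mderiv γ f v = 0)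
    (hΛ : ∀ v ∈ K,
      Lam p z q.α v ξ ≤ Lam p z q.α x ξ * (CΛ * (1 + ‖v - x‖ / Real.sqrt q.h)) ∧
      Lam p z q.α x ξ ≤ Lam p z q.α v ξ * (CΛ * (1 + ‖x - v‖ / Real.sqrt q.h)))
    (γ : Fin n → ℕ) (hγ : mlen γ ≤ D) (y : Eucl n) :
    ‖mderiv γ (fun y => f (x + Real.sqrt q.h • y)) y‖ ≤
      C * CΛ ^ Q * (wt p z R k l q x ξ * I) * (1 + ‖y‖) ^ Q := by
  have h0 := q.h_pos
  have hs : 0 < Real.sqrt q.h := Real.sqrt_pos.2 h0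
  have hΛ0 := Lam_pos (p := p) (z := z) q.α_pos x ξ
  have hw := wt_pos (p := p) (z := z) (k := k) (l := l) q x ξ
  have hj0 := jap_pos ξ
  rw [mderiv_comp_affine hf]
  beta_reduce
  rw [norm_mul, norm_pow, Complex.norm_real, Real.norm_of_nonneg hs.le]
  set v := x + Real.sqrt q.h • y with hv
  by_cases hvK : v ∈ K
  · have hΛv := Lam_pos (p := p) (z := z) q.α_pos v ξ
    have e1 : Real.sqrt q.h ^ mlen γ * (Lam p z q.α v ξ ^ mlen γ)⁻¹ ≤ 1 := by
      rw [← div_eq_mul_inv, ← div_pow]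
      refine pow_le_one₀ (by positivity) ?_
      rw [div_le_one hΛv]
      exact sqrt_le_Lam q.α_pos q.α_lt q.h_le v ξ
    have hd : ‖v - x‖ / Real.sqrt q.h = ‖y‖ := by
      rw [hv, add_sub_cancel_left, norm_smul, Real.norm_of_nonneg hs.le]
      field_simp
    obtain ⟨hΛ1, hΛ2⟩ := hΛ v hvK
    rw [norm_sub_rev, hd] at hΛ2
    rw [hd] at hΛ1
    have e2 : Lam p z q.α v ξ ^ l ≤ Lam p z q.α x ξ ^ l * (CΛ * (1 + ‖y‖)) ^ Q := by
      rw [hQ]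
      refine rpow_le_of_comparable hΛv hΛ0 ?_ hΛ1 hΛ2 l
      nlinarith [norm_nonneg y]
    have hwv := wt_pos (p := p) (z := z) (k := k) (l := l) q v ξ
    have e3 : wt p z R k l q v ξ ≤ wt p z R k l q x ξ * (CΛ * (1 + ‖y‖)) ^ Q := by
      unfold wt
      rw [mul_assoc]
      gcongr
    calc Real.sqrt q.h ^ mlen γ * ‖mderiv γ f v‖
        ≤ Real.sqrt q.h ^ mlen γ * (C * (wt p z R k l q v ξ *
          (Lam p z q.α v ξ ^ mlen γ)⁻¹ * I)) := by
          gcongr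
          exact hfC γ hγ v hvK
      _ = (Real.sqrt q.h ^ mlen γ * (Lam p z q.α v ξ ^ mlen γ)⁻¹) *
          (C * (wt p z R k l q v ξ * I)) := by ring
      _ ≤ 1 * (C * ((wt p z R k l q x ξ * (CΛ * (1 + ‖y‖)) ^ Q) * I)) := by
          gcongr
      _ = _ := by rw [mul_pow]; ring
  · rw [hf0 γ v hvK]
    simp only [norm_zero, mul_zero]
    positivity

/-- The expansion of the composition symbol, in terms of the rescaled functions. -/
lemma sum_scaled_eq_expansion (a b : SymbolFamily n R) (N : ℕ) (q : Param R) (x ξ : Eucl n)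
    (ha : ContDiff ℝ ∞ (a q x)) (hb : ContDiff ℝ ∞ fun y => b q y ξ) :
    ∑ j ∈ Finset.range N, ∑ β ∈ multiOfLen n j,
      mderiv β (fun w => a q x (ξ + (2 * Real.pi * Real.sqrt q.h) • w)) 0 *
        ((mfact β : ℂ)⁻¹ * (((2 * Real.pi * Complex.I) ^ j)⁻¹ *
          mderiv β (fun y => b q (x + Real.sqrt q.h • y) ξ) 0)) =
      expansion a b N q x ξ := by
  unfold expansion DX
  refine Finset.sum_congr rfl fun j _ => Finset.sum_congr rfl fun β hβ => ?_
  have e0 := mderiv_comp_affine hb x (Real.sqrt q.h) β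
  rw [mderiv_comp_affine ha, e0, mem_multiOfLen.1 hβ]
  beta_reduce
  rw [smul_zero, smul_zero, add_zero, add_zero]
  have e5 : ((2 * Real.pi * Real.sqrt q.h : ℝ) : ℂ) ^ j * ((2 * Real.pi * Complex.I) ^ j)⁻¹ *
      ((Real.sqrt q.h : ℝ) : ℂ) ^ j = (q.h : ℂ) ^ j * (1 / Complex.I) ^ j := by
    rw [← inv_pow, ← mul_pow, ← mul_pow, ← mul_pow]
    congr 1
    have e6 : ((Real.sqrt q.h : ℝ) : ℂ) ^ 2 = (q.h : ℂ) := by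
      rw [← Complex.ofReal_pow, Real.sq_sqrt q.h_pos.le]
    have hpc : (Real.pi : ℂ) ≠ 0 := by exact_mod_cast Real.pi_ne_zero
    push_cast
    rw [← e6]
    field_simp
  have e7 : ((q.h ^ j / (mfact β : ℝ) : ℝ) : ℂ) = (q.h : ℂ) ^ j * (mfact β : ℂ)⁻¹ := by
    push_cast; rw [div_eq_mul_inv]
  rw [e7]
  unfold dXi dX
  linear_combination ((mfact β : ℂ)⁻¹ * mderiv β (a q x) ξ * mderiv β (fun y => b q y ξ) x) * e5

/-- The weight `⟨ξ⟩^r ⟨ξ⟩^k Λ^l h^N (Λ⟨ξ⟩)^{-N}` of the remainder of order `N`. -/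
def remWt (p : Eucl n → Eucl n → ℂ) (z : ℂ) (R r k l : ℝ) (N : ℕ) :
    Param R → Eucl n → Eucl n → ℝ :=
  fun q x ξ => jap ξ ^ r * wt p z R k l q x ξ *
    (q.h ^ N * (Lam p z q.α x ξ ^ N)⁻¹ * (jap ξ ^ N)⁻¹)

lemma remWt_pos (N : ℕ) (q : Param R) (x ξ : Eucl n) : 0 < remWt p z R r k l N q x ξ := by
  have h0 := q.h_pos
  have hΛ0 := Lam_pos (p := p) (z := z) q.α_pos x ξ
  have hw := wt_pos (p := p) (z := z) (k := k) (l := l) q x ξ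
  have hj0 := jap_pos ξ
  unfold remWt
  positivity

lemma norm_expTerm_le_remWt {N : ℕ} {Ca Cb I : ℝ} (hCa : 0 ≤ Ca) (hCb : 0 ≤ Cb) (hI : 0 ≤ I)
    (q : Param R) (x ξ : Eucl n) (β : Fin n → ℕ) (hβ : N ≤ mlen β)
    (hA : ‖dXi β (a q) x ξ‖ ≤ Ca * (jap ξ ^ r * (jap ξ ^ mlen β)⁻¹))
    (hB : ‖dX β (b q) x ξ‖ ≤ Cb * (wt p z R k l q x ξ * (Lam p z q.α x ξ ^ mlen β)⁻¹ * I)) :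
    ‖expTerm q.h (a q) (b q) β x ξ‖ ≤ (Ca * Cb) * (remWt p z R r k l N q x ξ * I) := by
  have h0 := q.h_pos
  have h1 : q.h < 1 := q.h_le.trans_lt q.α_lt
  have hs : 0 < Real.sqrt q.h := Real.sqrt_pos.2 h0
  have hs1 : Real.sqrt q.h ≤ 1 := Real.sqrt_le_one.2 h1.le
  have hsq : Real.sqrt q.h ^ 2 = q.h := Real.sq_sqrt h0.le
  have hΛ0 := Lam_pos (p := p) (z := z) q.α_pos x ξ
  have hw := wt_pos (p := p) (z := z) (k := k) (l := l) q x ξ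
  have hj0 := jap_pos ξ
  refine (norm_expTerm_le h0 _ _ β x ξ).trans ?_
  have e8 : q.h ^ mlen β * (Lam p z q.α x ξ ^ mlen β)⁻¹ * (jap ξ ^ mlen β)⁻¹ ≤
      q.h ^ N * (Lam p z q.α x ξ ^ N)⁻¹ * (jap ξ ^ N)⁻¹ := by
    rw [← inv_pow, ← inv_pow, ← inv_pow, ← inv_pow, ← mul_pow, ← mul_pow, ← mul_pow, ← mul_pow]
    refine pow_le_pow_of_le_one (by positivity) ?_ hβ
    have b1 : q.h * (Lam p z q.α x ξ)⁻¹ ≤ 1 := by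
      rw [← div_eq_mul_inv, div_le_one hΛ0]
      refine le_trans ?_ (sqrt_le_Lam q.α_pos q.α_lt q.h_le x ξ)
      nlinarith
    have b2 : (jap ξ)⁻¹ ≤ 1 := inv_le_one_of_one_le₀ (one_le_jap ξ)
    exact mul_le_one₀ b1 (by positivity) b2
  calc q.h ^ mlen β * ‖dXi β (a q) x ξ‖ * ‖dX β (b q) x ξ‖
      ≤ q.h ^ mlen β * (Ca * (jap ξ ^ r * (jap ξ ^ mlen β)⁻¹)) *
        (Cb * (wt p z R k l q x ξ * (Lam p z q.α x ξ ^ mlen β)⁻¹ * I)) := by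
        gcongr
    _ = (Ca * Cb) * (jap ξ ^ r * wt p z R k l q x ξ *
        (q.h ^ mlen β * (Lam p z q.α x ξ ^ mlen β)⁻¹ * (jap ξ ^ mlen β)⁻¹) * I) := by ring
    _ ≤ _ := by
        unfold remWt
        gcongr

lemma norm_sum_range_sub_le {f : (Fin n → ℕ) → ℂ} {N N' : ℕ} (hN : N ≤ N') {X : ℝ} (hX : 0 ≤ X)
    (h : ∀ β, N ≤ mlen β → mlen β ≤ N' → ‖f β‖ ≤ X) :
    ‖(∑ j ∈ Finset.range N', ∑ β ∈ multiOfLen n j, f β) -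
      ∑ j ∈ Finset.range N, ∑ β ∈ multiOfLen n j, f β‖ ≤
      (∑ j ∈ Finset.range N', ∑ _β ∈ multiOfLen n j, (1 : ℝ)) * X := by
  rw [← Finset.sum_sdiff (Finset.range_mono hN), add_sub_cancel_right]
  calc _ ≤ ∑ j ∈ Finset.range N' \ Finset.range N, ∑ β ∈ multiOfLen n j, (1 : ℝ) * X := by
        refine (norm_sum_le _ _).trans (Finset.sum_le_sum fun j hj => ?_)
        refine (norm_sum_le _ _).trans (Finset.sum_le_sum fun β hβ => ?_)
        rw [one_mul]
        simp only [Finset.mem_sdiff, Finset.mem_range, not_lt] at hj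
        have := mem_multiOfLen.1 hβ
        exact h β (by omega) (by omega)
    _ ≤ ∑ j ∈ Finset.range N', ∑ β ∈ multiOfLen n j, (1 : ℝ) * X := by
        refine Finset.sum_le_sum_of_subset_of_nonneg Finset.sdiff_subset fun j _ _ => ?_
        exact Finset.sum_nonneg fun _ _ => by positivity
    _ = _ := by simp only [← Finset.sum_mul]

lemma jap_rpow_mul_le_remWt (N : ℕ) (q : Param R) (x ξ : Eucl n) :
    q.h ^ N * jap ξ ^ (r - (2 * N : ℕ)) * wt p z R k l q x ξ ≤ remWt p z R r k l N q x ξ := by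
  have h0 := q.h_pos
  have hΛ0 := Lam_pos (p := p) (z := z) q.α_pos x ξ
  have hΛ1 := Lam_le_one (p := p) (z := z) q.α_lt x ξ
  have hw := wt_pos (p := p) (z := z) (k := k) (l := l) q x ξ
  have hj0 := jap_pos ξ
  have e9 : jap ξ ^ (r - (2 * N : ℕ)) ≤
      jap ξ ^ r * ((Lam p z q.α x ξ ^ N)⁻¹ * (jap ξ ^ N)⁻¹) := by
    rw [Real.rpow_sub hj0, Real.rpow_natCast, div_eq_mul_inv]
    gcongr
    have b1 : 1 ≤ (Lam p z q.α x ξ ^ N)⁻¹ :=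
      (one_le_inv₀ (by positivity)).2 (pow_le_one₀ hΛ0.le hΛ1)
    have b2 : (jap ξ ^ (2 * N))⁻¹ ≤ (jap ξ ^ N)⁻¹ := by
      gcongr
      · exact one_le_jap ξ
      · omega
    exact b2.trans (le_mul_of_one_le_left (by positivity) b1)
  calc _ ≤ q.h ^ N * (jap ξ ^ r * ((Lam p z q.α x ξ ^ N)⁻¹ * (jap ξ ^ N)⁻¹)) *
        wt p z R k l q x ξ := by gcongr
    _ = _ := by unfold remWt; ring

/-- The remainder of the expansion is bounded by its weight, before any differentiation. -/
theorem exists_remainder_le {m : ℕ} {coef : (Fin n → ℕ) → Eucl n → ℂ} (hU : IsOpen U)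
    (hcoef : ∀ γ, mlen γ ≤ m → ContDiffOn ℝ ∞ (coef γ) U)
    (hell : ClassicallyElliptic U m coef)
    (ha : MemS10 U (fun ξ => jap ξ ^ r) a)
    (hb : MemSLam U (polySymbol m coef) z (wt (polySymbol m coef) z R k l) b)
    (hK : IsCompact K) (hKU : K ⊆ U) (hsupp : ∀ q, SuppIn K (b q)) (N : ℕ) :
    ∃ J : ℕ, ∀ L : Set (Eucl n), IsCompact L → L ⊆ U → ∃ C : ℝ, 0 ≤ C ∧
      ∀ q : Param R, ∀ x ∈ L, ∀ ξ,
        ‖amp q.h (a q) (b q) x ξ - expansion a b N q x ξ‖ ≤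
          C * (remWt (polySymbol m coef) z R r k l N q x ξ * (|q.w.im| ^ J)⁻¹) := by
  -- The rescaling by `√h` gains only `√h` for each derivative of `a`. The expansion is therefore
  -- pushed to the order `2N`, and its terms of order between `N` and `2N` are estimated one by one.
  obtain ⟨p, hp⟩ : ∃ p, p = polySymbol m coef := ⟨_, rfl⟩
  obtain ⟨P, hP⟩ : ∃ P, P = ⌈|r - (2 * N : ℕ)|⌉₊ := ⟨_, rfl⟩
  obtain ⟨Q, hQ⟩ : ∃ Q, Q = ⌈|l|⌉₊ := ⟨_, rfl⟩
  obtain ⟨D, C₀, hC₀, hpair⟩ := exists_taylor_pairing_bound n (2 * N) P Q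
  obtain ⟨J, hJ⟩ := hb.exists_dX_le (D + 2 * N)
  refine ⟨J, fun L hL hLU => ?_⟩
  have hLK : IsCompact (L ∪ K) := hL.union hK
  have hLKU : L ∪ K ⊆ U := Set.union_subset hLU hKU
  obtain ⟨Ca, hCa, hA⟩ := ha.exists_dXi_le (2 * N + D) hL hLU
  obtain ⟨Cb, hCb, hB⟩ := hJ _ hLK hLKU
  obtain ⟨CΛ, hCΛ, hΛ⟩ := exists_Lam_le hU hcoef hell z hLK hLKU
  rw [← hp] at hb hB hΛ ⊢
  obtain ⟨T, hT⟩ : ∃ T : ℝ, T = ∑ j ∈ Finset.range (2 * N), ∑ _β ∈ multiOfLen n j, (1 : ℝ) :=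
    ⟨_, rfl⟩
  have hT0 : 0 ≤ T := by
    rw [hT]; exact Finset.sum_nonneg fun _ _ => Finset.sum_nonneg fun _ _ => zero_le_one
  refine ⟨C₀ * ((2 * Real.pi) ^ (2 * N + D + P) * Ca) * (Cb * CΛ ^ Q) + T * (Ca * Cb),
    by positivity, fun q x hx ξ => ?_⟩
  have h0 := q.h_pos
  have h1 : q.h < 1 := q.h_le.trans_lt q.α_lt
  have hx' : x ∈ L ∪ K := Or.inl hx
  have him : 0 < |q.w.im| := abs_pos.2 q.im_w
  have hs : 0 < Real.sqrt q.h := Real.sqrt_pos.2 h0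
  have has : ContDiff ℝ ∞ (a q x) := (ha.smooth q).slice_left hU (hLU hx)
  have hbs : ContDiff ℝ ∞ (fun y => b q y ξ) :=
    ((hsupp q).contDiff hU hK.isClosed hKU (hb.smooth q)).slice_right ξ
  have hgc : HasCompactSupport (fun y => b q (x + Real.sqrt q.h • y) ξ) := by
    refine HasCompactSupport.intro (K := (fun y => (Real.sqrt q.h)⁻¹ • (y - x)) '' K)
      (hK.image (by fun_prop)) fun y hy => hsupp q _ ξ fun h => hy ⟨_, h, ?_⟩
    simp [hs.ne']
  have hw := wt_pos (p := p) (z := z) (k := k) (l := l) q x ξ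
  have hj0 := jap_pos ξ
  have key := hpair _ _ _ _ (contDiff_comp_affine has ξ (2 * Real.pi * Real.sqrt q.h))
    (contDiff_comp_affine hbs x (Real.sqrt q.h)) hgc (by positivity)
    (norm_mderiv_scaled_left_le has h0 h1.le hCa hP (fun β hβ η => hA β hβ q x hx η) ξ)
    (norm_mderiv_scaled_right_le (K := K) (p := p) (z := z) (k := k) (l := l) hbs hCb
      (I := (|q.w.im| ^ J)⁻¹) (by positivity) hCΛ hQ q x ξ
      (fun γ hγ v hv => hB γ (hγ.trans (Nat.le_add_right _ _)) q v (Or.inr hv) ξ)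
      (fun γ v hv => (hsupp q).dX hK.isClosed γ v ξ hv)
      (fun v hv => ⟨hΛ x hx' v (Or.inr hv) ξ q.h q.α h0 q.h_le q.α_lt,
        hΛ v (Or.inr hv) x hx' ξ q.h q.α h0 q.h_le q.α_lt⟩))
  rw [← amp_eq_scaled h0, sum_scaled_eq_expansion a b (2 * N) q x ξ has hbs] at key
  have hrem := remWt_pos (p := p) (z := z) (r := r) (k := k) (l := l) N q x ξ
  have htail : ‖expansion a b (2 * N) q x ξ - expansion a b N q x ξ‖ ≤ T * (Ca * Cb *
      (remWt p z R r k l N q x ξ * (|q.w.im| ^ J)⁻¹)) := by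
    rw [expansion_eq, expansion_eq, hT]
    refine norm_sum_range_sub_le (by omega) (by positivity) fun β h2 h3 => ?_
    exact norm_expTerm_le_remWt hCa hCb (by positivity) q x ξ β h2 (hA β (by omega) q x hx ξ)
      (hB β (by omega) q x hx' ξ)
  have e10 : ∀ c1 c2 c3 A B W I : ℝ,
      C₀ * (c1 * Ca * (A * B)) * (Cb * c3 * (W * I)) =
      (C₀ * (c1 * Ca) * (Cb * c3)) * (A * B * W * I) := by intros; ring
  have hmain := key.trans (le_of_eq (e10 _ 0 _ _ _ _ _))
  have hmain2 := hmain.trans (mul_le_mul_of_nonneg_left (mul_le_mul_of_nonneg_right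
    (jap_rpow_mul_le_remWt (p := p) (z := z) (r := r) (k := k) (l := l) N q x ξ)
      (by positivity : 0 ≤ (|q.w.im| ^ J)⁻¹))
    (by positivity : 0 ≤ C₀ * ((2 * Real.pi) ^ (2 * N + D + P) * Ca) * (Cb * CΛ ^ Q)))
  calc ‖amp q.h (a q) (b q) x ξ - expansion a b N q x ξ‖
      = ‖(amp q.h (a q) (b q) x ξ - expansion a b (2 * N) q x ξ) +
        (expansion a b (2 * N) q x ξ - expansion a b N q x ξ)‖ := by congr 1; ring
    _ ≤ _ := (norm_add_le _ _).trans (add_le_add hmain2 htail)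
    _ = _ := by ring

end ZeroOrder

/-! ### Differentiation of the composition symbol -/

section Directions

variable {n : ℕ} {U : Set (Eucl n)}

/-- The standard basis of `ℝⁿ × ℝⁿ`. -/
def ebas (j : Fin n ⊕ Fin n) : Eucl n × Eucl n :=
  Sum.elim (fun i => (bvec i, 0)) (fun i => (0, bvec i)) j

/-- The coordinates on `ℝⁿ × ℝⁿ`, dual to `ebas`. -/
def cdir (j : Fin n ⊕ Fin n) : Eucl n × Eucl n →L[ℝ] ℝ :=
  Sum.elim (fun i => (EuclideanSpace.proj i).comp (ContinuousLinearMap.fst ℝ _ _))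
    (fun i => (EuclideanSpace.proj i).comp (ContinuousLinearMap.snd ℝ _ _)) j

lemma sum_cdir_smul_ebas (v : Eucl n × Eucl n) : ∑ j, cdir j v • ebas j = v := by
  rw [Fintype.sum_sum_type]
  have h : ∀ x : Eucl n, ∑ i, x i • (bvec i : Eucl n) = x := by
    intro x; ext j; simp [Pi.single_apply]
  refine Prod.ext ?_ ?_
  · simpa [cdir, ebas, Prod.fst_sum] using h v.1
  · simpa [cdir, ebas, Prod.snd_sum] using h v.2

lemma clm_eq_sum (T : Eucl n × Eucl n →L[ℝ] ℂ) :
    T = ∑ j, (cdir j).smulRight (T (ebas j)) := by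
  refine ContinuousLinearMap.ext fun v => ?_
  conv_lhs => rw [← sum_cdir_smul_ebas v]
  simp [map_sum, sum_apply]

lemma integrable_smulRight {V : Type*} [NormedAddCommGroup V] [NormedSpace ℝ V] (c : V →L[ℝ] ℝ)
    {f : Eucl n → ℂ} (hf : Integrable f) : Integrable fun w => c.smulRight (f w) :=
  (ContinuousLinearMap.smulRightL ℝ V ℂ c).integrable_comp hf

lemma integrable_sum_of_normed {ι F : Type*} [Fintype ι] [NormedAddCommGroup F]
    {f : ι → Eucl n → F} (hf : ∀ j, Integrable (f j)) : Integrable fun w => ∑ j, f j w :=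
  integrable_finsetSum _ fun j _ => hf j

lemma integral_smulRight {V : Type*} [NormedAddCommGroup V] [NormedSpace ℝ V] (c : V →L[ℝ] ℝ)
    {f : Eucl n → ℂ} (hf : Integrable f) :
    ∫ w, c.smulRight (f w) = c.smulRight (∫ w, f w) :=
  (ContinuousLinearMap.smulRightL ℝ V ℂ c).integral_comp_comm hf

lemma dXi_congr (hU : IsOpen U) {a b : Eucl n → Eucl n → ℂ} (h : EqOn2 U a b) (γ : Fin n → ℕ) :
    EqOn2 U (dXi γ a) (dXi γ b) := by
  rw [dXi_eq_mop, dXi_eq_mop]; exact (OpOn.mop (opOn_pXi hU) γ).congr _ _ h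

/-- Symbols on `U × ℝⁿ` all of whose derivatives grow polynomially in `ξ`, at a common rate, locally
uniformly in `x ∈ U`. -/
def PolyGrowth (U : Set (Eucl n)) (a : Eucl n → Eucl n → ℂ) : Prop :=
  Smooth2 U a ∧ ∃ P : ℕ, ∀ γ β : Fin n → ℕ, ∀ L : Set (Eucl n), IsCompact L → L ⊆ U →
    ∃ C : ℝ, 0 ≤ C ∧ ∀ x ∈ L, ∀ ξ, ‖dX γ (dXi β a) x ξ‖ ≤ C * (1 + ‖ξ‖) ^ P

lemma PolyGrowth.congr (hU : IsOpen U) {a b : Eucl n → Eucl n → ℂ} (ha : PolyGrowth U a)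
    (h : EqOn2 U b a) : PolyGrowth U b := by
  refine ⟨h.smooth2 ha.1, ha.2.imp fun P hP γ β L hL hLU => ?_⟩
  obtain ⟨C, hC0, hC⟩ := hP γ β L hL hLU
  refine ⟨C, hC0, fun x hx ξ => ?_⟩
  rw [dX_congr hU (dXi_congr hU h β) γ x (hLU hx) ξ]
  exact hC x hx ξ

lemma PolyGrowth.pdir (hU : IsOpen U) {a : Eucl n → Eucl n → ℂ} (ha : PolyGrowth U a)
    (j : Fin n ⊕ Fin n) : PolyGrowth U (pdir (ebas j) a) := by
  obtain ⟨hs, P, hP⟩ := ha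
  cases j with
  | inl i =>
    refine PolyGrowth.congr hU (a := pX i a) ⟨hs.pX hU i, P, fun γ β L hL hLU => ?_⟩
      (pX_eqOn_pdir hU hs i).symm
    obtain ⟨C, hC0, hC⟩ := hP (γ + Pi.single i 1) β L hL hLU
    refine ⟨C, hC0, fun x hx ξ => ?_⟩
    rw [dX_dXi_pX hU hs γ β i x (hLU hx) ξ]
    exact hC x hx ξ
  | inr i =>
    refine PolyGrowth.congr hU (a := pXi i a) ⟨hs.pXi hU i, P, fun γ β L hL hLU => ?_⟩
      (pXi_eqOn_pdir hU hs i).symm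
    obtain ⟨C, hC0, hC⟩ := hP γ (β + Pi.single i 1) L hL hLU
    refine ⟨C, hC0, fun x hx ξ => ?_⟩
    rw [dX_dXi_pXi hU hs γ β i x (hLU hx) ξ]
    exact hC x hx ξ

lemma PolyGrowth.exists_le {a : Eucl n → Eucl n → ℂ} (ha : PolyGrowth U a) :
    ∃ P : ℕ, ∀ L : Set (Eucl n), IsCompact L → L ⊆ U → ∃ C : ℝ, 0 ≤ C ∧
      ∀ x ∈ L, ∀ ξ, ‖a x ξ‖ ≤ C * (1 + ‖ξ‖) ^ P := by
  obtain ⟨-, P, hP⟩ := ha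
  refine ⟨P, fun L hL hLU => ?_⟩
  have := hP 0 0 L hL hLU
  rwa [dXi_zero, dX_zero] at this

/-- Smooth functions of `(x, ξ)`, supported in `K × ℝⁿ`. -/
def SmoothIn (K : Set (Eucl n)) (b : Eucl n → Eucl n → ℂ) : Prop :=
  Smooth2 Set.univ b ∧ SuppIn K b

variable {K : Set (Eucl n)}

lemma EqOn2.eq {a b : Eucl n → Eucl n → ℂ} (h : EqOn2 Set.univ a b) : a = b :=
  funext fun x => funext fun ξ => h x (Set.mem_univ x) ξ

lemma SmoothIn.pX (hK : IsClosed K) {b : Eucl n → Eucl n → ℂ} (hb : SmoothIn K b) (i : Fin n) :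
    SmoothIn K (pX i b) :=
  ⟨hb.1.pX isOpen_univ i, hb.2.pX hK i⟩

lemma SmoothIn.pXi {b : Eucl n → Eucl n → ℂ} (hb : SmoothIn K b) (i : Fin n) :
    SmoothIn K (pXi i b) :=
  ⟨hb.1.pXi isOpen_univ i, hb.2.pXi i⟩

lemma SmoothIn.pdir (hK : IsClosed K) {b : Eucl n → Eucl n → ℂ} (hb : SmoothIn K b)
    (j : Fin n ⊕ Fin n) : SmoothIn K (pdir (ebas j) b) := by
  cases j with
  | inl i =>
    have : ExoticCalculus.pdir (ebas (Sum.inl i)) b = ExoticCalculus.pX i b :=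
      (pX_eqOn_pdir isOpen_univ hb.1 i).eq.symm
    rw [this]; exact hb.pX hK i
  | inr i =>
    have : ExoticCalculus.pdir (ebas (Sum.inr i)) b = ExoticCalculus.pXi i b :=
      (pXi_eqOn_pdir isOpen_univ hb.1 i).eq.symm
    rw [this]; exact hb.pXi i

end Directions

section PartialFourier

variable {n : ℕ} {K : Set (Eucl n)} {b : Eucl n → Eucl n → ℂ}

open scoped Convolution

/-- For fixed `w`, the function `e^{2πi x·w} 𝓕 f(w)` is a convolution in `x`. -/
lemma chr_mul_fourier_eq_convolution (f : Eucl n → ℂ) (x w : Eucl n) :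
    chr x w * 𝓕 f w = ((fun t => chr t w) ⋆[ContinuousLinearMap.mul ℝ ℂ] f) x := by
  rw [fourier_eq_chr, ← integral_const_mul, convolution_def,
    ← integral_sub_left_eq_self _ volume x]
  congr 1; funext t
  rw [ContinuousLinearMap.mul_apply', ← mul_assoc, ← chr_add_left]
  congr 2; abel

lemma continuous_chr_left (w : Eucl n) : Continuous fun t : Eucl n => chr t w :=
  continuous_chr.comp (continuous_id.prodMk continuous_const)

lemma continuous_chr_right (x : Eucl n) : Continuous fun w : Eucl n => chr x w :=
  continuous_chr.comp (continuous_const.prodMk continuous_id)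

lemma SmoothIn.contDiff_swap (hb : SmoothIn K b) :
    ContDiff ℝ ∞ (fun v : Eucl n × Eucl n => b v.2 v.1) := by
  have h : ContDiff ℝ ∞ (fun v : Eucl n × Eucl n => b v.1 v.2) := by
    rw [← contDiffOn_univ, ← Set.univ_prod_univ]; exact hb.1
  exact h.comp (contDiff_snd.prodMk contDiff_fst)

lemma SmoothIn.smooth_chr_mul_fourier (hK : IsCompact K) (hb : SmoothIn K b) (w : Eucl n) :
    Smooth2 Set.univ (fun x ξ => chr x w * 𝓕 (fun y => b y ξ) w) := by
  have h1 := contDiffOn_convolution_right_with_param (n := ⊤) (ContinuousLinearMap.mul ℝ ℂ)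
    (f := fun t => chr t w) (g := fun ξ y => b y ξ) (μ := volume) (s := Set.univ) isOpen_univ hK
    (fun ξ y _ hy => hb.2 y ξ hy) (continuous_chr_left w).locallyIntegrable
    hb.contDiff_swap.contDiffOn
  rw [Set.univ_prod_univ, contDiffOn_univ] at h1
  unfold Smooth2
  rw [Set.univ_prod_univ, contDiffOn_univ]
  simp only [chr_mul_fourier_eq_convolution]
  exact h1.comp (contDiff_snd.prodMk contDiff_fst)

/-- The function `e^{2πi x·w} 𝓕(b(·, ξ))(w)` is differentiated in `(x, ξ)` by differentiating
`b`. -/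
lemma SmoothIn.pdir_chr_mul_fourier (hK : IsCompact K) (hb : SmoothIn K b) (w : Eucl n)
    (e : Eucl n × Eucl n) (x ξ : Eucl n) :
    ExoticCalculus.pdir e (fun x ξ => chr x w * 𝓕 (fun y => b y ξ) w) x ξ =
      chr x w * 𝓕 (fun y => ExoticCalculus.pdir e b y ξ) w := by
  have hc := hb.contDiff_swap
  have h1 := hasFDerivAt_convolution_right_with_param (ContinuousLinearMap.mul ℝ ℂ)
    (f := fun t => chr t w) (g := fun ξ y => b y ξ) (μ := volume) (s := Set.univ) isOpen_univ hK
    (fun ξ y _ hy => hb.2 y ξ hy) (continuous_chr_left w).locallyIntegrable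
    (hc.of_le (by simp)).contDiffOn (ξ, x) (Set.mem_univ _)
  have hsw : ∀ v : Eucl n × Eucl n, HasFDerivAt (fun v : Eucl n × Eucl n => (v.2, v.1))
      ((ContinuousLinearMap.snd ℝ _ _).prod (ContinuousLinearMap.fst ℝ _ _)) v :=
    fun v => hasFDerivAt_snd.prodMk hasFDerivAt_fst
  have h2 := HasFDerivAt.comp (f := fun v : Eucl n × Eucl n => (v.2, v.1)) (x, ξ) h1 (hsw (x, ξ))
  have h3 : ∀ y, fderiv ℝ (fun v : Eucl n × Eucl n => b v.2 v.1) (ξ, y) (e.2, e.1) =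
      ExoticCalculus.pdir e b y ξ := by
    intro y
    have h4 := HasFDerivAt.comp (f := fun v : Eucl n × Eucl n => (v.2, v.1)) (y, ξ)
      (hc.differentiable (by simp) (ξ, y)).hasFDerivAt (hsw (y, ξ))
    have h5 : (fun v : Eucl n × Eucl n => b v.2 v.1) ∘ (fun v : Eucl n × Eucl n => (v.2, v.1)) =
      fun v => b v.1 v.2 := rfl
    rw [h5] at h4
    rw [ExoticCalculus.pdir, h4.fderiv]
    rfl
  have h6 : HasCompactSupport fun y => fderiv ℝ (fun v : Eucl n × Eucl n => b v.2 v.1) (ξ, y) := by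
    refine HasCompactSupport.intro hK fun y hy => ?_
    have : (fun v : Eucl n × Eucl n => b v.2 v.1) =ᶠ[nhds (ξ, y)] fun _ => 0 := by
      filter_upwards [(hK.isClosed.isOpen_compl.preimage continuous_snd).mem_nhds
        (show (ξ, y).2 ∈ Kᶜ from hy)] with v hv using hb.2 v.2 v.1 hv
    rw [this.fderiv_eq, fderiv_fun_const]; rfl
  have h7 : Continuous fun y => fderiv ℝ (fun v : Eucl n × Eucl n => b v.2 v.1) (ξ, y) :=
    (hc.continuous_fderiv (by simp)).comp (continuous_const.prodMk continuous_id)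
  rw [ExoticCalculus.pdir]
  simp only [chr_mul_fourier_eq_convolution]
  refine (congrArg (fun T => T e) h2.fderiv).trans ?_
  refine (convolution_precompR_apply (ContinuousLinearMap.mul ℝ ℂ)
    (continuous_chr_left w).locallyIntegrable h6 h7 x (e.2, e.1)).trans ?_
  congr 1
  funext y; exact h3 y

/-- Rapid decay in `w` of the partial Fourier transform, in terms of bounds on the derivatives
in `x`. -/
lemma SmoothIn.exists_norm_fourier_le (hK : IsCompact K) (hb : SmoothIn K b) {Ξ : Set (Eucl n)}
    {g : Eucl n → ℝ} (hg : ∀ ξ, 0 ≤ g ξ)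
    (hC : ∀ γ, ∃ C : ℝ, ∀ x ∈ K, ∀ ξ ∈ Ξ, ‖dX γ b x ξ‖ ≤ C * g ξ) (s : ℕ) :
    ∃ C : ℝ, 0 ≤ C ∧ ∀ ξ ∈ Ξ, ∀ w,
      ‖𝓕 (fun y => b y ξ) w‖ ≤ C * g ξ * ((1 + ‖w‖ ^ 2) ^ s)⁻¹ := by
  choose C hC using hC
  obtain ⟨C', hC', h⟩ := exists_real_bound (2 * s) C
  refine ⟨(1 + n) ^ s * C' * volume.real K, by positivity, fun ξ hξ w => ?_⟩
  have hsm := hb.1.slice_right ξ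
  have hcs := hb.2.hasCompactSupport hK ξ
  refine (norm_fourier_le (s := s) hsm (IntD.of_hasCompactSupport _ hsm hcs) w).trans ?_
  gcongr
  have h1 : Bd (2 * s) (fun _ => g ξ) C' (fun y => b y ξ) := by
    refine Bd.of_mderiv hsm fun γ hγ x => ?_
    have := hg ξ
    by_cases hx : x ∈ K
    · exact (hC γ x hx ξ hξ).trans (by gcongr; exact h γ hγ)
    · have h0 : mderiv γ (fun y => b y ξ) x = 0 := hb.2.dX hK.isClosed γ x ξ hx
      rw [h0, norm_zero]; positivity
  have h2 := (Bd.opL_iterate (D := 0) (s := s) hsm (by simpa using h1)).le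
  have h3 : ∀ x ∉ K, ExoticCalculus.opL^[s] (fun y => b y ξ) x = 0 := by
    have : ∀ (s : ℕ) (f : Eucl n → ℂ), (∀ x ∉ K, f x = 0) → ∀ x ∉ K, opL^[s] f x = 0 := by
      intro s
      induction s with
      | zero => exact fun f hf => hf
      | succ s ih =>
        intro f hf
        rw [Function.iterate_succ_apply]
        refine ih _ fun x hx => ?_
        have e1 : ∀ (f : Eucl n → ℂ), (∀ x ∉ K, f x = 0) → ∀ i, ∀ x ∉ K, pderiv i f x = 0 := by
          intro f hf i x hx
          rw [pderiv_eqOn hK.isClosed.isOpen_compl i (g := fun _ => 0) (fun y hy => hf y hy) hx,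
            pderiv_const]
        simp [opL, hf x hx, e1 _ (e1 f hf _) _ x hx]
    exact this s _ fun x hx => hb.2 x ξ hx
  rw [← setIntegral_eq_integral_of_forall_compl_eq_zero (s := K)
    (fun x hx => by rw [h3 x hx, norm_zero])]
  refine (Real.le_norm_self _).trans ?_
  refine (norm_setIntegral_le_of_norm_le_const hK.measure_lt_top
    (C := (1 + n) ^ s * C' * g ξ) fun x _ => ?_).trans (le_of_eq (by ring))
  rw [norm_norm]; exact h2 x

lemma SmoothIn.exists_norm_fourier_le_of_isCompact (hK : IsCompact K) (hb : SmoothIn K b)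
    {Ξ : Set (Eucl n)} (hΞ : IsCompact Ξ) (s : ℕ) :
    ∃ C : ℝ, 0 ≤ C ∧ ∀ ξ ∈ Ξ, ∀ w,
      ‖𝓕 (fun y => b y ξ) w‖ ≤ C * ((1 + ‖w‖ ^ 2) ^ s)⁻¹ := by
  have h : ∀ γ, ∃ C : ℝ, ∀ x ∈ K, ∀ ξ ∈ Ξ, ‖dX γ b x ξ‖ ≤ C * 1 := by
    intro γ
    have h1 : Smooth2 Set.univ (dX γ b) := hb.1.dX isOpen_univ γ
    have h2 : Continuous fun v : Eucl n × Eucl n => dX γ b v.1 v.2 := by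
      rw [← continuousOn_univ, ← Set.univ_prod_univ]; exact h1.continuousOn
    obtain ⟨C, hC⟩ := (hK.prod hΞ).exists_bound_of_continuousOn h2.continuousOn
    exact ⟨C, fun x hx ξ hξ => by simpa using hC (x, ξ) ⟨hx, hξ⟩⟩
  obtain ⟨C, hC0, hC⟩ := hb.exists_norm_fourier_le hK (fun _ => zero_le_one) h s
  exact ⟨C, hC0, fun ξ hξ w => by simpa using hC ξ hξ w⟩

end PartialFourier

section Leibniz

variable {n : ℕ} {U K : Set (Eucl n)} {a b : Eucl n → Eucl n → ℂ}

/-- The integrand in the composition symbol. The factor `e^{2πi x·w}` is grouped with the Fourier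
transform of `b`, because their product is differentiated by differentiating `b`. -/
def ampF (h : ℝ) (a b : Eucl n → Eucl n → ℂ) (w x ξ : Eucl n) : ℂ :=
  a x (ξ + (2 * Real.pi * h) • w) * (chr x w * 𝓕 (fun y => b y ξ) w)

lemma amp_eq_integral_ampF (h : ℝ) (a b : Eucl n → Eucl n → ℂ) (x ξ : Eucl n) :
    amp h a b x ξ = ∫ w, ampF h a b w x ξ := by
  unfold amp ampF
  congr 1; funext w; ring

lemma continuous_ampF (hU : IsOpen U) (ha : Smooth2 U a) (hK : IsCompact K) (hb : SmoothIn K b)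
    (h : ℝ) {x : Eucl n} (hx : x ∈ U) (ξ : Eucl n) : Continuous fun w => ampF h a b w x ξ := by
  refine Continuous.mul ?_ ((continuous_chr_right x).mul (continuous_fourier ?_))
  · exact (ha.slice_left hU hx).continuous.comp (by fun_prop)
  · exact (hb.1.slice_right ξ).continuous.integrable_of_hasCompactSupport
      (hb.2.hasCompactSupport hK ξ)

/-- Locally uniformly in `(x, ξ)`, the integrand in the composition symbol is dominated by an
integrable function. -/
lemma exists_ampF_le (ha : PolyGrowth U a) (hK : IsCompact K) (hb : SmoothIn K b)
    (h : ℝ) {L Ξ : Set (Eucl n)} (hL : IsCompact L) (hLU : L ⊆ U) (hΞ : IsCompact Ξ) :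
    ∃ G : Eucl n → ℝ, Integrable G ∧ ∀ x ∈ L, ∀ ξ ∈ Ξ, ∀ w, ‖ampF h a b w x ξ‖ ≤ G w := by
  obtain ⟨P, hP⟩ := ha.exists_le
  obtain ⟨C, hC0, hC⟩ := hP L hL hLU
  obtain ⟨C', hC'0, hC'⟩ := hb.exists_norm_fourier_le_of_isCompact hK hΞ (P + n + 1)
  obtain ⟨ρ, hρ⟩ := hΞ.isBounded.exists_norm_le
  refine ⟨_, (integrable_weight (n := n) (P := P) (s := P + n + 1) (by omega)).const_mul
    (C * (1 + |ρ| + |2 * Real.pi * h|) ^ P * C'), fun x hx ξ hξ w => ?_⟩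
  unfold ampF
  rw [norm_mul, norm_mul, norm_chr, one_mul]
  have h1 : 1 + ‖ξ + (2 * Real.pi * h) • w‖ ≤ (1 + |ρ| + |2 * Real.pi * h|) * (1 + ‖w‖) := by
    have h2 := norm_add_le ξ ((2 * Real.pi * h) • w)
    rw [norm_smul, Real.norm_eq_abs] at h2
    have h3 := (hρ ξ hξ).trans (le_abs_self ρ)
    nlinarith [norm_nonneg w, abs_nonneg ρ, abs_nonneg (2 * Real.pi * h),
      mul_nonneg (abs_nonneg ρ) (norm_nonneg w)]
  calc _ ≤ (C * ((1 + |ρ| + |2 * Real.pi * h|) * (1 + ‖w‖)) ^ P) *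
        (C' * ((1 + ‖w‖ ^ 2) ^ (P + n + 1))⁻¹) := by
        refine mul_le_mul ((hC x hx _).trans ?_) (hC' ξ hξ w) (norm_nonneg _) (by positivity)
        gcongr
    _ = _ := by rw [mul_pow]; ring

lemma integrable_ampF (hU : IsOpen U) (ha : PolyGrowth U a) (hK : IsCompact K)
    (hb : SmoothIn K b) (h : ℝ) {x : Eucl n} (hx : x ∈ U) (ξ : Eucl n) :
    Integrable fun w => ampF h a b w x ξ := by
  obtain ⟨G, hG, hle⟩ := exists_ampF_le ha hK hb h (isCompact_singleton (x := x))
    (Set.singleton_subset_iff.2 hx) (isCompact_singleton (x := ξ))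
  exact hG.mono' (continuous_ampF hU ha.1 hK hb h hx ξ).aestronglyMeasurable
    (Filter.Eventually.of_forall fun w => hle x rfl ξ rfl w)

/-- The functional on `ℝⁿ × ℝⁿ` with the values `c j` on the standard basis. -/
def ofBasis (c : Fin n ⊕ Fin n → ℂ) : Eucl n × Eucl n →L[ℝ] ℂ :=
  ∑ j, (cdir j).smulRight (c j)

lemma integrable_ofBasis {c : Eucl n → Fin n ⊕ Fin n → ℂ} (hc : ∀ j, Integrable fun w => c w j) :
    Integrable fun w => ofBasis (c w) :=
  integrable_sum_of_normed fun j => integrable_smulRight (cdir j) (hc j)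

lemma integral_ofBasis {c : Eucl n → Fin n ⊕ Fin n → ℂ} (hc : ∀ j, Integrable fun w => c w j) :
    ∫ w, ofBasis (c w) = ofBasis fun j => ∫ w, c w j := by
  unfold ofBasis
  rw [integral_finsetSum _ fun j _ => integrable_smulRight (cdir j) (hc j)]
  exact Finset.sum_congr rfl fun j _ => integral_smulRight _ (hc j)

lemma norm_ofBasis_le (c : Fin n ⊕ Fin n → ℂ) :
    ‖ofBasis c‖ ≤ ∑ j, ‖(cdir j : Eucl n × Eucl n →L[ℝ] ℝ)‖ * ‖c j‖ :=
  (norm_sum_le _ _).trans (Finset.sum_le_sum fun j _ => by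
    rw [ContinuousLinearMap.norm_smulRight_apply])

lemma ofBasis_ebas (c : Fin n ⊕ Fin n → ℂ) (j : Fin n ⊕ Fin n) : ofBasis c (ebas j) = c j := by
  rw [ofBasis, sum_apply, Finset.sum_eq_single j]
  · have : cdir j (ebas j : Eucl n × Eucl n) = 1 := by cases j <;> simp [cdir, ebas]
    simp [this]
  · intro i _ hij
    have : cdir i (ebas j : Eucl n × Eucl n) = 0 := by
      cases i <;> cases j <;> simp_all [cdir, ebas]
    simp [this]
  · simp

lemma hasFDerivAt_ampF (hU : IsOpen U) (ha : Smooth2 U a) (hK : IsCompact K)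
    (hb : SmoothIn K b) (h : ℝ) (w : Eucl n) {v : Eucl n × Eucl n} (hv : v.1 ∈ U) :
    HasFDerivAt (fun v : Eucl n × Eucl n => ampF h a b w v.1 v.2)
      (ofBasis fun j => ampF h (pdir (ebas j) a) b w v.1 v.2 +
        ampF h a (pdir (ebas j) b) w v.1 v.2) v := by
  obtain ⟨x, ξ⟩ := v
  have h1 : HasFDerivAt (fun v : Eucl n × Eucl n => (v.1, v.2 + (2 * Real.pi * h) • w))
      (ContinuousLinearMap.id ℝ (Eucl n × Eucl n)) (x, ξ) := by
    have e : (fun v : Eucl n × Eucl n => (v.1, v.2 + (2 * Real.pi * h) • w)) =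
        fun v => v + (0, (2 * Real.pi * h) • w) := by
      funext v; exact Prod.ext (by simp) rfl
    rw [e]
    exact (hasFDerivAt_id _).add_const _
  have h2 := HasFDerivAt.comp (f := fun v : Eucl n × Eucl n => (v.1, v.2 + (2 * Real.pi * h) • w))
    (x, ξ) (ha.differentiableAt hU hv (ξ + (2 * Real.pi * h) • w)).hasFDerivAt h1
  have h3 := ((hb.smooth_chr_mul_fourier hK w).differentiableAt isOpen_univ
    (Set.mem_univ x) ξ).hasFDerivAt
  refine HasFDerivAt.congr_fderiv (h2.mul h3) ?_
  refine (clm_eq_sum _).trans ?_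
  refine Finset.sum_congr rfl fun j _ => ?_
  congr 1
  have h5 := hb.pdir_chr_mul_fourier hK w (ebas j) x ξ
  rw [pdir] at h5
  simp only [add_apply, smul_apply, smul_eq_mul, h5,
    ContinuousLinearMap.comp_apply, ContinuousLinearMap.id_apply]
  unfold ampF
  simp only [pdir, Function.comp]
  ring

/-- The Leibniz rule for the composition symbol: `∂ c[a, b] = c[∂a, b] + c[a, ∂b]` for each partial
derivative. -/
theorem hasFDerivAt_amp (hU : IsOpen U) (ha : PolyGrowth U a) (hK : IsCompact K)
    (hb : SmoothIn K b) (h : ℝ) {v : Eucl n × Eucl n} (hv : v.1 ∈ U) :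
    HasFDerivAt (fun v : Eucl n × Eucl n => amp h a b v.1 v.2)
      (ofBasis fun j => amp h (pdir (ebas j) a) b v.1 v.2 +
        amp h a (pdir (ebas j) b) v.1 v.2) v := by
  obtain ⟨ρ, hρ, hρU⟩ := Metric.nhds_basis_closedBall.mem_iff.1 (hU.mem_nhds hv)
  have hga := fun j => ha.pdir hU j
  have hgb := fun j => hb.pdir hK.isClosed j
  have hL := isCompact_closedBall v.1 ρ
  have hΞ := isCompact_closedBall v.2 (1 : ℝ)
  choose G1 hG1 hG1' using fun j => exists_ampF_le (hga j) hK hb h hL hρU hΞ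
  choose G2 hG2 hG2' using fun j => exists_ampF_le ha hK (hgb j) h hL hρU hΞ
  have hint : ∀ j, Integrable fun w =>
      ampF h (pdir (ebas j) a) b w v.1 v.2 + ampF h a (pdir (ebas j) b) w v.1 v.2 :=
    fun j => (integrable_ampF hU (hga j) hK hb h hv v.2).add
      (integrable_ampF hU ha hK (hgb j) h hv v.2)
  have e : (fun v : Eucl n × Eucl n => amp h a b v.1 v.2) =
      fun v => ∫ w, ampF h a b w v.1 v.2 := funext fun v => amp_eq_integral_ampF h a b v.1 v.2
  have e' : (ofBasis fun j => amp h (pdir (ebas j) a) b v.1 v.2 +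
      amp h a (pdir (ebas j) b) v.1 v.2) = ∫ w, ofBasis fun j =>
        ampF h (pdir (ebas j) a) b w v.1 v.2 + ampF h a (pdir (ebas j) b) w v.1 v.2 := by
    rw [integral_ofBasis hint]
    congr 1; funext j
    rw [integral_add (integrable_ampF hU (hga j) hK hb h hv v.2)
      (integrable_ampF hU ha hK (hgb j) h hv v.2), ← amp_eq_integral_ampF,
      ← amp_eq_integral_ampF]
  rw [e, e']
  have hB : Integrable fun w => ∑ j, ‖(cdir j : Eucl n × Eucl n →L[ℝ] ℝ)‖ * (G1 j w + G2 j w) :=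
    integrable_finsetSum _ fun j _ => ((hG1 j).add (hG2 j)).const_mul _
  have hs : Metric.closedBall v.1 ρ ×ˢ Metric.closedBall v.2 1 ∈ nhds v :=
    prod_mem_nhds (Metric.closedBall_mem_nhds _ hρ) (Metric.closedBall_mem_nhds _ one_pos)
  refine hasFDerivAt_integral_of_dominated_of_fderiv_le
    (F' := fun v w => ofBasis fun j => ampF h (pdir (ebas j) a) b w v.1 v.2 +
        ampF h a (pdir (ebas j) b) w v.1 v.2) hs
    ?_ (integrable_ampF hU ha hK hb h hv v.2) (integrable_ofBasis hint).aestronglyMeasurable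
    (Filter.Eventually.of_forall fun w v' hv' => ?_) hB
    (Filter.Eventually.of_forall fun w v' hv' => hasFDerivAt_ampF hU ha.1 hK hb h w (hρU hv'.1))
  · filter_upwards [(hU.preimage continuous_fst).mem_nhds (show v ∈ Prod.fst ⁻¹' U from hv)]
      with v' hv'
    exact (continuous_ampF hU ha.1 hK hb h hv' v'.2).aestronglyMeasurable
  · refine (norm_ofBasis_le _).trans (Finset.sum_le_sum fun j _ => ?_)
    gcongr
    exact (norm_add_le _ _).trans (add_le_add (hG1' j _ hv'.1 _ hv'.2 w) (hG2' j _ hv'.1 _ hv'.2 w))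

lemma pdir_amp (hU : IsOpen U) (ha : PolyGrowth U a) (hK : IsCompact K)
    (hb : SmoothIn K b) (h : ℝ) (j : Fin n ⊕ Fin n) :
    EqOn2 U (pdir (ebas j) (amp h a b))
      (fun x ξ => amp h (pdir (ebas j) a) b x ξ + amp h a (pdir (ebas j) b) x ξ) := by
  intro x hx ξ
  have h1 := hasFDerivAt_amp hU ha hK hb h (v := (x, ξ)) hx
  rw [pdir, h1.fderiv, ofBasis_ebas]

/-- The composition symbol is smooth: by the Leibniz rule, its derivative is made of composition
symbols of the same type. -/
theorem smooth_amp (hU : IsOpen U) (ha : PolyGrowth U a) (hK : IsCompact K)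
    (hb : SmoothIn K b) (h : ℝ) : Smooth2 U (amp h a b) := by
  refine contDiffOn_infty.2 fun k => ?_
  induction k generalizing a b with
  | zero =>
    refine contDiffOn_zero.2 fun v hv => ?_
    exact (hasFDerivAt_amp hU ha hK hb h hv.1).continuousAt.continuousWithinAt
  | succ k ih =>
    have hO : IsOpen (U ×ˢ (Set.univ : Set (Eucl n))) := hU.prod isOpen_univ
    rw [Nat.cast_succ, contDiffOn_succ_iff_fderiv_of_isOpen hO]
    refine ⟨fun v hv => (hasFDerivAt_amp hU ha hK hb h
      hv.1).differentiableAt.differentiableWithinAt, by simp, ?_⟩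
    refine ContDiffOn.congr ?_ fun v hv => (hasFDerivAt_amp hU ha hK hb h hv.1).fderiv
    unfold ofBasis
    refine ContDiffOn.sum fun j _ => ?_
    exact (ContinuousLinearMap.smulRightL ℝ (Eucl n × Eucl n) ℂ (cdir j)).contDiff.comp_contDiffOn
      ((ih (ha.pdir hU j) hb).add (ih ha (hb.pdir hK.isClosed j)))

end Leibniz

/-! ### Symbol estimates for the remainder -/

section LeibnizRemainder

variable {n : ℕ} {U K : Set (Eucl n)} {a b : Eucl n → Eucl n → ℂ}

lemma pdir_dX (hU : IsOpen U) (ha : Smooth2 U a) (γ : Fin n → ℕ) (e : Eucl n × Eucl n) :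
    EqOn2 U (pdir e (dX γ a)) (dX γ (pdir e a)) := by
  simp only [dX_eq_mop]
  exact mop_comm (opOn_pX hU) (fun j f hf => comm_of_eqOn_pdir hU (fun _ _ _ _ _ => rfl)
    (fun _ h => pX_eqOn_pdir hU h j) hf) γ a ha

lemma pdir_dXi (hU : IsOpen U) (ha : Smooth2 U a) (γ : Fin n → ℕ) (e : Eucl n × Eucl n) :
    EqOn2 U (pdir e (dXi γ a)) (dXi γ (pdir e a)) := by
  simp only [dXi_eq_mop]
  exact mop_comm (opOn_pXi hU) (fun j f hf => comm_of_eqOn_pdir hU (fun _ _ _ _ _ => rfl)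
    (fun _ h => pXi_eqOn_pdir hU h j) hf) γ a ha

lemma smooth_expTerm (hU : IsOpen U) (ha : Smooth2 U a) (hb : Smooth2 U b) (h : ℝ)
    (β : Fin n → ℕ) : Smooth2 U (expTerm h a b β) :=
  (contDiffOn_const.mul (ha.dXi hU β)).mul (contDiffOn_const.mul (hb.dX hU β))

lemma pdir_expTerm (hU : IsOpen U) (ha : Smooth2 U a) (hb : Smooth2 U b) (h : ℝ)
    (β : Fin n → ℕ) (e : Eucl n × Eucl n) :
    EqOn2 U (pdir e (expTerm h a b β))
      (fun x ξ => expTerm h (pdir e a) b β x ξ + expTerm h a (pdir e b) β x ξ) := by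
  intro x hx ξ
  have h1 := ((ha.dXi hU β).differentiableAt hU hx ξ).hasFDerivAt
  have h2 := ((hb.dX hU β).differentiableAt hU hx ξ).hasFDerivAt
  have h3 := (h1.const_mul ((h ^ mlen β / (mfact β : ℝ) : ℝ) : ℂ)).mul
    (h2.const_mul ((1 / Complex.I) ^ mlen β))
  have h4 : pdir e (dXi β a) x ξ = _ := pdir_dXi hU ha β e x hx ξ
  have h5 : pdir e (dX β b) x ξ = _ := pdir_dX hU hb β e x hx ξ
  unfold expTerm DX
  beta_reduce
  rw [← h4, ← h5]
  refine (congrArg (fun T => T e) h3.fderiv).trans ?_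
  simp only [add_apply, smul_apply, smul_eq_mul, pdir]
  ring

/-- The remainder of the expansion of the composition symbol. -/
def remF (h : ℝ) (N : ℕ) (a b : Eucl n → Eucl n → ℂ) (x ξ : Eucl n) : ℂ :=
  amp h a b x ξ - ∑ j ∈ Finset.range N, ∑ β ∈ multiOfLen n j, expTerm h a b β x ξ

lemma remF_congr (hU : IsOpen U) {a' : Eucl n → Eucl n → ℂ} (h : EqOn2 U a a') (c : ℝ) (N : ℕ) :
    EqOn2 U (remF c N a b) (remF c N a' b) := by
  intro x hx ξ
  have h1 : ∀ η, a x η = a' x η := h x hx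
  have h2 : ∀ β, dXi β a x ξ = dXi β a' x ξ := fun β => dXi_congr hU h β x hx ξ
  simp only [remF, amp, h1, expTerm, h2]

lemma smooth_remF (hU : IsOpen U) (ha : PolyGrowth U a) (hK : IsCompact K)
    (hb : SmoothIn K b) (h : ℝ) (N : ℕ) : Smooth2 U (remF h N a b) :=
  ContDiffOn.sub (smooth_amp hU ha hK hb h) (ContDiffOn.sum fun _ _ => ContDiffOn.sum fun β _ =>
    smooth_expTerm hU ha.1 (hb.1.mono (Set.prod_mono_left (Set.subset_univ U))) h β)

/-- The remainder satisfies the Leibniz rule, like each of its terms. -/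
lemma pdir_remF (hU : IsOpen U) (ha : PolyGrowth U a) (hK : IsCompact K)
    (hb : SmoothIn K b) (h : ℝ) (N : ℕ) (j : Fin n ⊕ Fin n) :
    EqOn2 U (pdir (ebas j) (remF h N a b))
      (fun x ξ => remF h N (pdir (ebas j) a) b x ξ + remF h N a (pdir (ebas j) b) x ξ) := by
  intro x hx ξ
  have hbU : Smooth2 U b := hb.1.mono (Set.prod_mono_left (Set.subset_univ U))
  have h1 := ((smooth_amp hU ha hK hb h).differentiableAt hU hx ξ).hasFDerivAt
  have h2 := fun β => ((smooth_expTerm hU ha.1 hbU h β).differentiableAt hU hx ξ).hasFDerivAt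
  have h3 := h1.sub (HasFDerivAt.fun_sum fun j (_ : j ∈ Finset.range N) =>
    HasFDerivAt.fun_sum fun β (_ : β ∈ multiOfLen n j) => h2 β)
  refine (congrArg (fun T => T (ebas j)) h3.fderiv).trans ?_
  have h4 : fderiv ℝ (fun v : Eucl n × Eucl n => amp h a b v.1 v.2) (x, ξ) (ebas j) = _ :=
    pdir_amp hU ha hK hb h j x hx ξ
  have h5 : ∀ β, fderiv ℝ (fun v : Eucl n × Eucl n => expTerm h a b β v.1 v.2) (x, ξ) (ebas j) =
    _ := fun β => pdir_expTerm hU ha.1 hbU h β (ebas j) x hx ξ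
  simp only [sub_apply, sum_apply, h4, h5, remF, Finset.sum_add_distrib]
  ring

lemma pX_remF (hU : IsOpen U) (ha : PolyGrowth U a) (hK : IsCompact K)
    (hb : SmoothIn K b) (h : ℝ) (N : ℕ) (i : Fin n) :
    EqOn2 U (pX i (remF h N a b))
      (fun x ξ => remF h N (pX i a) b x ξ + remF h N a (pX i b) x ξ) := by
  have h1 : ExoticCalculus.pdir (ebas (Sum.inl i)) b = ExoticCalculus.pX i b :=
    (pX_eqOn_pdir isOpen_univ hb.1 i).eq.symm
  have h2 := pdir_remF hU ha hK hb h N (Sum.inl i)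
  rw [h1] at h2
  refine _root_.trans (pX_eqOn_pdir hU (smooth_remF hU ha hK hb h N) i) (_root_.trans h2 ?_)
  intro x hx ξ
  beta_reduce
  rw [remF_congr hU (pX_eqOn_pdir hU ha.1 i) h N x hx ξ]
  rfl

lemma pXi_remF (hU : IsOpen U) (ha : PolyGrowth U a) (hK : IsCompact K)
    (hb : SmoothIn K b) (h : ℝ) (N : ℕ) (i : Fin n) :
    EqOn2 U (pXi i (remF h N a b))
      (fun x ξ => remF h N (pXi i a) b x ξ + remF h N a (pXi i b) x ξ) := by
  have h1 : ExoticCalculus.pdir (ebas (Sum.inr i)) b = ExoticCalculus.pXi i b :=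
    (pXi_eqOn_pdir isOpen_univ hb.1 i).eq.symm
  have h2 := pdir_remF hU ha hK hb h N (Sum.inr i)
  rw [h1] at h2
  refine _root_.trans (pXi_eqOn_pdir hU (smooth_remF hU ha hK hb h N) i) (_root_.trans h2 ?_)
  intro x hx ξ
  beta_reduce
  rw [remF_congr hU (pXi_eqOn_pdir hU ha.1 i) h N x hx ξ]
  rfl

end LeibnizRemainder

section Growth

variable {n : ℕ} {R : ℝ} {U K : Set (Eucl n)} {p : Eucl n → Eucl n → ℂ} {z : ℂ} {r k l : ℝ}
  {a b : SymbolFamily n R}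

lemma jap_rpow_le (r : ℝ) (ξ : Eucl n) : jap ξ ^ r ≤ (1 + ‖ξ‖) ^ ⌈|r|⌉₊ := by
  calc jap ξ ^ r ≤ jap ξ ^ (⌈|r|⌉₊ : ℝ) :=
        Real.rpow_le_rpow_of_exponent_le (one_le_jap ξ) ((le_abs_self r).trans (Nat.le_ceil _))
    _ = jap ξ ^ ⌈|r|⌉₊ := Real.rpow_natCast _ _
    _ ≤ _ := pow_le_pow_left₀ (jap_pos ξ).le (jap_le_one_add ξ) _

lemma MemS10.polyGrowth (ha : MemS10 U (fun ξ => jap ξ ^ r) a) (q : Param R) :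
    PolyGrowth U (a q) := by
  refine ⟨ha.smooth q, ⌈|r|⌉₊, fun γ β L hL hLU => ?_⟩
  obtain ⟨C, hC⟩ := ha.2 γ β L hL hLU
  refine ⟨|C|, abs_nonneg C, fun x hx ξ => (hC q x hx ξ).trans ?_⟩
  have h0 := jap_pos ξ
  have h1 : (jap ξ ^ mlen β)⁻¹ ≤ 1 := inv_le_one_of_one_le₀ (one_le_pow₀ (one_le_jap ξ))
  calc C * jap ξ ^ r * (jap ξ ^ mlen β)⁻¹ ≤ |C| * (1 + ‖ξ‖) ^ ⌈|r|⌉₊ * 1 := by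
        gcongr
        · exact le_abs_self C
        · exact jap_rpow_le r ξ
    _ = _ := mul_one _

lemma Lam_rpow_le {α : ℝ} (h0 : 0 < α) (h1 : α < 1) (l : ℝ) (x ξ : Eucl n) :
    Lam p z α x ξ ^ l ≤ Real.sqrt α ^ (-|l|) := by
  have hΛ := Lam_pos (p := p) (z := z) h0 x ξ
  refine (Real.rpow_le_rpow_of_exponent_ge hΛ (Lam_le_one h1 x ξ) (neg_abs_le l)).trans ?_
  exact Real.rpow_le_rpow_of_nonpos (Real.sqrt_pos.2 h0) (sqrt_le_Lam h0 h1 le_rfl x ξ)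
    (neg_nonpos.2 (abs_nonneg l))

lemma MemSLam.polyGrowth (hb : MemSLam U p z (wt p z R k l) b) (q : Param R) :
    PolyGrowth U (b q) := by
  refine ⟨hb.smooth q, ⌈|k|⌉₊, fun γ β L hL hLU => ?_⟩
  obtain ⟨J, hJ⟩ := hb.2 γ β
  obtain ⟨C, hC⟩ := hJ L hL hLU
  have hα := q.α_pos
  have hα' := Real.sqrt_pos.2 hα
  refine ⟨|C| * Real.sqrt q.α ^ (-|l|) * (Real.sqrt q.α ^ (mlen γ + mlen β))⁻¹ * (|q.w.im| ^ J)⁻¹,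
    by positivity, fun x hx ξ => (hC q x hx ξ).trans ?_⟩
  have h0 := jap_pos ξ
  have hΛ := Lam_pos (p := p) (z := z) hα x ξ
  have h1 : (jap ξ ^ mlen β)⁻¹ ≤ 1 := inv_le_one_of_one_le₀ (one_le_pow₀ (one_le_jap ξ))
  have h2 := sqrt_le_Lam (p := p) (z := z) hα q.α_lt le_rfl x ξ
  have h3 := Lam_rpow_le (p := p) (z := z) hα q.α_lt l x ξ
  calc _ ≤ |C| * ((1 + ‖ξ‖) ^ ⌈|k|⌉₊ * Real.sqrt q.α ^ (-|l|)) *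
        (Real.sqrt q.α ^ (mlen γ + mlen β))⁻¹ * 1 * (|q.w.im| ^ J)⁻¹ := by
        unfold wt
        gcongr
        · exact le_abs_self C
        · exact jap_rpow_le k ξ
    _ = _ := by ring

lemma MemSLam.smoothIn (hU : IsOpen U) (hK : IsCompact K) (hKU : K ⊆ U)
    (hb : MemSLam U p z (wt p z R k l) b) {q : Param R} (hs : SuppIn K (b q)) :
    SmoothIn K (b q) :=
  ⟨hs.contDiff hU hK.isClosed hKU (hb.smooth q), hs⟩

end Growth

section RemainderClass

variable {n : ℕ} {R : ℝ}

/-- Iterated differentiation of a family of symbols is carried out at each value of the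
parameters. -/
lemma mop_family (T : Fin n → (Eucl n → Eucl n → ℂ) → Eucl n → Eucl n → ℂ) (γ : Fin n → ℕ)
    (f : SymbolFamily n R) :
    mop (fun i (g : SymbolFamily n R) q => T i (g q)) γ f = fun q => mop T γ (f q) := by
  have it : ∀ (i : Fin n) (m : ℕ) (g : SymbolFamily n R),
      (fun (g : SymbolFamily n R) q => T i (g q))^[m] g = fun q => (T i)^[m] (g q) := by
    intro i m
    induction m with
    | zero => exact fun g => rfl
    | succ m ih => intro g; rw [Function.iterate_succ_apply, ih]; rfl
  unfold mop
  induction List.finRange n with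
  | nil => rfl
  | cons j L ih =>
    simp only [List.foldr_cons]
    exact (congrArg _ ih).trans (it j _ _)

/-- The sums of remainders `remF h N a b` which arise from remainders of symbols in
`S_{1,0}(⟨ξ⟩^r)` and `S_Λ(⟨ξ⟩^k Λ^l)` by `c` derivatives in `x` and `d` derivatives in `ξ`. -/
inductive RemClass (U K : Set (Eucl n)) (p : Eucl n → Eucl n → ℂ) (z : ℂ) (N : ℕ) (s l : ℝ) :
    ℕ → ℕ → SymbolFamily n R → Prop
  /-- Derivatives in `ξ` may fall on `a` or on `b`, so that only the sum `r + k` is determined; a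
  loss of `Λ⁻¹` is allowed for each derivative, even if it falls on `a`. -/
  | base {c d : ℕ} {r k l' : ℝ} {a b : SymbolFamily n R} (ha : MemS10 U (fun ξ => jap ξ ^ r) a)
      (hb : MemSLam U p z (wt p z R k l') b) (hs : ∀ q, SuppIn K (b q)) (hrk : r + k = s - d)
      (hl : l' = l - (c + d)) : RemClass U K p z N s l c d (fun q => remF q.h N (a q) (b q))
  | add {c d : ℕ} {f g : SymbolFamily n R} (hf : RemClass U K p z N s l c d f)
      (hg : RemClass U K p z N s l c d g) :
      RemClass U K p z N s l c d (fun q x ξ => f q x ξ + g q x ξ)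
  | congr {c d : ℕ} {f g : SymbolFamily n R} (hf : RemClass U K p z N s l c d f)
      (h : ∀ q, EqOn2 U (g q) (f q)) : RemClass U K p z N s l c d g

variable {U K : Set (Eucl n)} {p : Eucl n → Eucl n → ℂ} {z : ℂ} {N c d : ℕ} {s l : ℝ}
  {f : SymbolFamily n R}

lemma RemClass.smooth (hU : IsOpen U) (hK : IsCompact K) (hKU : K ⊆ U)
    (hf : RemClass U K p z N s l c d f) (q : Param R) : Smooth2 U (f q) := by
  induction hf with
  | base ha hb hs _ _ =>
    exact smooth_remF hU (ha.polyGrowth q) hK (hb.smoothIn hU hK hKU (hs q)) q.h N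
  | add _ _ h1 h2 => exact ContDiffOn.add h1 h2
  | congr _ h h1 => exact (h q).smooth2 h1

lemma pX_add (hU : IsOpen U) {f g : Eucl n → Eucl n → ℂ} (hf : Smooth2 U f) (hg : Smooth2 U g)
    (i : Fin n) : EqOn2 U (pX i fun x ξ => f x ξ + g x ξ) (fun x ξ => pX i f x ξ + pX i g x ξ) := by
  intro x hx ξ
  have h1 := hf.differentiableAt hU hx ξ
  have h2 := hg.differentiableAt hU hx ξ
  beta_reduce
  rw [pX_eq_fderiv (h1.add h2), pX_eq_fderiv h1, pX_eq_fderiv h2]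
  exact congrArg (fun T => T (bvec i, 0)) (fderiv_add h1 h2)

lemma pXi_add (hU : IsOpen U) {f g : Eucl n → Eucl n → ℂ} (hf : Smooth2 U f) (hg : Smooth2 U g)
    (i : Fin n) :
    EqOn2 U (pXi i fun x ξ => f x ξ + g x ξ) (fun x ξ => pXi i f x ξ + pXi i g x ξ) := by
  intro x hx ξ
  have h1 := hf.differentiableAt hU hx ξ
  have h2 := hg.differentiableAt hU hx ξ
  beta_reduce
  rw [pXi_eq_fderiv (h1.add h2), pXi_eq_fderiv h1, pXi_eq_fderiv h2]
  exact congrArg (fun T => T (0, bvec i)) (fderiv_add h1 h2)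

lemma RemClass.pX (hU : IsOpen U) (hK : IsCompact K) (hKU : K ⊆ U)
    (hf : RemClass U K p z N s l c d f) (i : Fin n) :
    RemClass U K p z N s l (c + 1) d (fun q => pX i (f q)) := by
  induction hf with
  | base ha hb hs hrk hl =>
    refine RemClass.congr (RemClass.add
      (RemClass.base (ha.pX hU i) hb.weaken hs hrk (by rw [hl]; push_cast; ring))
      (RemClass.base ha (hb.pX hU i) (fun q => (hs q).pX hK.isClosed i) hrk
        (by rw [hl]; push_cast; ring))) fun q => ?_
    exact pX_remF hU (ha.polyGrowth q) hK (hb.smoothIn hU hK hKU (hs q)) q.h N i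
  | add hf hg h1 h2 =>
    exact RemClass.congr (RemClass.add h1 h2) fun q =>
      pX_add hU (hf.smooth hU hK hKU q) (hg.smooth hU hK hKU q) i
  | congr _ h h1 => exact RemClass.congr h1 fun q => (opOn_pX hU i).congr _ _ (h q)

lemma RemClass.pXi (hU : IsOpen U) (hK : IsCompact K) (hKU : K ⊆ U)
    (hf : RemClass U K p z N s l c d f) (i : Fin n) :
    RemClass U K p z N s l c (d + 1) (fun q => pXi i (f q)) := by
  induction hf with
  | base ha hb hs hrk hl =>
    refine RemClass.congr (RemClass.add
      (RemClass.base (ha.pXi hU i) hb.weaken hs (by push_cast; linarith)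
        (by rw [hl]; push_cast; ring))
      (RemClass.base ha (hb.pXi hU i) (fun q => (hs q).pXi i) (by push_cast; linarith)
        (by rw [hl]; push_cast; ring))) fun q => ?_
    exact pXi_remF hU (ha.polyGrowth q) hK (hb.smoothIn hU hK hKU (hs q)) q.h N i
  | add hf hg h1 h2 =>
    exact RemClass.congr (RemClass.add h1 h2) fun q =>
      pXi_add hU (hf.smooth hU hK hKU q) (hg.smooth hU hK hKU q) i
  | congr _ h h1 => exact RemClass.congr h1 fun q => (opOn_pXi hU i).congr _ _ (h q)

lemma RemClass.dX_dXi (hU : IsOpen U) (hK : IsCompact K) (hKU : K ⊆ U)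
    (hf : RemClass U K p z N s l 0 0 f) (γ β : Fin n → ℕ) :
    RemClass U K p z N s l (mlen γ) (mlen β) (fun q => dX γ (dXi β (f q))) := by
  have h1 := mop_induction (T := fun i (g : SymbolFamily n R) q => ExoticCalculus.pXi i (g q))
    (fun d g => RemClass U K p z N s l 0 d g) (fun i _ _ h => h.pXi hU hK hKU i) β 0 f hf
  have h2 := mop_induction (T := fun i (g : SymbolFamily n R) q => ExoticCalculus.pX i (g q))
    (fun c g => RemClass U K p z N s l c (0 + mlen β) g) (fun i _ _ h => h.pX hU hK hKU i) γ 0 _ h1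
  rw [mop_family, mop_family, zero_add, zero_add] at h2
  simpa only [dX_eq_mop, dXi_eq_mop] using h2

/-- The bound on the remainders, with an exponent of `|Im w|⁻¹` independent of the compact set. -/
lemma RemClass.exists_le {m : ℕ} {coef : (Fin n → ℕ) → Eucl n → ℂ} (hU : IsOpen U)
    (hcoef : ∀ γ, mlen γ ≤ m → ContDiffOn ℝ ∞ (coef γ) U)
    (hell : ClassicallyElliptic U m coef) (hK : IsCompact K) (hKU : K ⊆ U)
    (hf : RemClass U K (polySymbol m coef) z N s l c d f) :
    ∃ J : ℕ, ∀ L : Set (Eucl n), IsCompact L → L ⊆ U → ∃ C : ℝ, 0 ≤ C ∧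
      ∀ q : Param R, ∀ x ∈ L, ∀ ξ, ‖f q x ξ‖ ≤
          C * (remWt (polySymbol m coef) z R 0 (s - d) (l - (c + d)) N q x ξ *
            (|q.w.im| ^ J)⁻¹) := by
  induction hf with
  | @base r k l' a b ha hb hs hrk hl =>
    obtain ⟨J, hJ⟩ := exists_remainder_le hU hcoef hell ha hb hK hKU hs N
    refine ⟨J, fun L hL hLU => ?_⟩
    obtain ⟨C, hC0, hC⟩ := hJ L hL hLU
    refine ⟨C, hC0, fun q x hx ξ => ?_⟩
    have h1 := hC q x hx ξ
    rw [expansion_eq] at h1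
    refine h1.trans (le_of_eq ?_)
    unfold remWt wt
    rw [← hrk, ← hl, Real.rpow_add (jap_pos ξ), Real.rpow_zero]
    ring
  | @add f g hf hg h1 h2 =>
    obtain ⟨J1, hJ1⟩ := h1
    obtain ⟨J2, hJ2⟩ := h2
    refine ⟨max J1 J2, fun L hL hLU => ?_⟩
    obtain ⟨C1, hC1, h1⟩ := hJ1 L hL hLU
    obtain ⟨C2, hC2, h2⟩ := hJ2 L hL hLU
    refine ⟨C1 * (max 1 R) ^ (max J1 J2 - J1) + C2 * (max 1 R) ^ (max J1 J2 - J2),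
      by positivity, fun q x hx ξ => ?_⟩
    have hw := remWt_pos (p := polySymbol m coef) (z := z) (r := 0) (k := s - d)
      (l := l - (c + d)) N q x ξ
    have e1 := mul_le_mul_of_nonneg_left (mul_le_mul_of_nonneg_left
      (q.inv_im_pow_le (le_max_left J1 J2)) hw.le) hC1
    have e2 := mul_le_mul_of_nonneg_left (mul_le_mul_of_nonneg_left
      (q.inv_im_pow_le (le_max_right J1 J2)) hw.le) hC2
    calc _ ≤ _ := norm_add_le _ _
      _ ≤ _ := add_le_add ((h1 q x hx ξ).trans e1) ((h2 q x hx ξ).trans e2)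
      _ = _ := by ring
  | @congr f g hf h h1 =>
    obtain ⟨J, hJ⟩ := h1
    refine ⟨J, fun L hL hLU => ?_⟩
    obtain ⟨C, hC0, hC⟩ := hJ L hL hLU
    refine ⟨C, hC0, fun q x hx ξ => ?_⟩
    rw [h q x (hLU hx) ξ]
    exact hC q x hx ξ

/-- The remainder of the expansion is a symbol: its derivatives are sums of remainders, to which the
bound without derivatives applies. -/
theorem memSLam_remainder {m : ℕ} {coef : (Fin n → ℕ) → Eucl n → ℂ} {r k : ℝ}
    {a b : SymbolFamily n R} (hU : IsOpen U)
    (hcoef : ∀ γ, mlen γ ≤ m → ContDiffOn ℝ ∞ (coef γ) U)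
    (hell : ClassicallyElliptic U m coef)
    (ha : MemS10 U (fun ξ => jap ξ ^ r) a)
    (hb : MemSLam U (polySymbol m coef) z (wt (polySymbol m coef) z R k l) b)
    (hK : IsCompact K) (hKU : K ⊆ U) (hs : ∀ q, SuppIn K (b q)) (N : ℕ) :
    MemSLam U (polySymbol m coef) z
      (fun q x ξ => jap ξ ^ r * (jap ξ ^ k * Lam (polySymbol m coef) z q.α x ξ ^ l) /
          (Lam (polySymbol m coef) z q.α x ξ * jap ξ) ^ N * q.h ^ N)
      (fun q x ξ => compSymbol a b q x ξ - expansion a b N q x ξ) := by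
  have e : (fun q x ξ => compSymbol a b q x ξ - expansion a b N q x ξ) =
      fun q => remF q.h N (a q) (b q) := by
    funext q x ξ
    rw [compSymbol_eq_amp, expansion_eq, remF]
  have hR : RemClass U K (polySymbol m coef) z N (r + k) l 0 0
      fun q => remF q.h N (a q) (b q) := RemClass.base ha hb hs (by simp) (by simp)
  rw [e]
  refine ⟨fun q => hR.smooth hU hK hKU q, fun γ β => ?_⟩
  obtain ⟨J, hJ⟩ := (hR.dX_dXi hU hK hKU γ β).exists_le hU hcoef hell hK hKU
  refine ⟨J, fun L hL hLU => ?_⟩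
  obtain ⟨C, -, hC⟩ := hJ L hL hLU
  refine ⟨C, fun q x hx ξ => (hC q x hx ξ).trans (le_of_eq ?_)⟩
  have h0 := jap_pos ξ
  have hΛ := Lam_pos (p := polySymbol m coef) (z := z) q.α_pos x ξ
  unfold remWt wt
  beta_reduce
  rw [Real.rpow_zero, Real.rpow_sub h0, Real.rpow_add h0, Real.rpow_sub hΛ, Real.rpow_natCast,
    ← Nat.cast_add, Real.rpow_natCast, mul_pow, div_eq_mul_inv, div_eq_mul_inv, div_eq_mul_inv,
    mul_inv]
  ring

end RemainderClass

/-! ### Composition of the operators -/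

section Composition

variable {n : ℕ} {U K : Set (Eucl n)} {a b : Eucl n → Eucl n → ℂ} {u : Eucl n → ℂ}

lemma SmoothIn.continuous (hb : SmoothIn K b) :
    Continuous fun v : Eucl n × Eucl n => b v.1 v.2 := by
  rw [← continuousOn_univ, ← Set.univ_prod_univ]; exact hb.1.continuousOn

lemma Continuous.chr {X : Type*} [TopologicalSpace X] {f g : X → Eucl n} (hf : Continuous f)
    (hg : Continuous g) : Continuous fun t => chr (f t) (g t) :=
  continuous_chr.comp (hf.prodMk hg)

lemma SmoothIn.continuous_comp (hb : SmoothIn K b) {X : Type*} [TopologicalSpace X]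
    {f g : X → Eucl n} (hf : Continuous f) (hg : Continuous g) :
    Continuous fun t => b (f t) (g t) :=
  hb.continuous.comp (hf.prodMk hg)

lemma TestFun.smoothIn (hu : TestFun U u) : SmoothIn (tsupport u) (fun y _ => u y) :=
  ⟨(hu.1.comp contDiff_fst).contDiffOn, fun _ _ hx => image_eq_zero_of_notMem_tsupport hx⟩

lemma Op_eq_amp {h : ℝ} (hh : 0 < h) (b : Eucl n → Eucl n → ℂ) (u : Eucl n → ℂ) (x : Eucl n) :
    Op h b u x = amp h b (fun y _ => u y) x 0 := by
  rw [Op_eq hh, amp]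
  simp only [zero_add]

lemma testFun_Op (hU : IsOpen U) (hK : IsCompact K) (hKU : K ⊆ U) (hb : PolyGrowth U b)
    (hs : SuppIn K b) (hu : TestFun U u) {h : ℝ} (hh : 0 < h) : TestFun U (Op h b u) := by
  have h1 : Op h b u = fun x => amp h b (fun y _ => u y) x 0 := funext fun x => Op_eq_amp hh b u x
  have h2 : SuppIn K (amp h b (fun y _ => u y)) := by
    intro x ξ hx
    simp [amp, hs x _ hx]
  have h3 : Smooth2 Set.univ (amp h b (fun y _ => u y)) :=
    h2.contDiff hU hK.isClosed hKU (smooth_amp hU hb hu.2.1 hu.smoothIn h)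
  rw [h1]
  refine ⟨h3.slice_right 0, h2.hasCompactSupport hK 0, ?_⟩
  refine (closure_minimal (fun x hx => ?_) hK.isClosed).trans hKU
  by_contra hxK
  exact hx (h2 x 0 hxK)

lemma SmoothIn.continuous_fourier (hK : IsCompact K) (hb : SmoothIn K b) {X : Type*}
    [TopologicalSpace X] [FirstCountableTopology X] [LocallyCompactSpace X] {f g : X → Eucl n}
    (hf : Continuous f) (hg : Continuous g) : Continuous fun t => 𝓕 (fun y => b y (g t)) (f t) := by
  have h1 : ∀ t, 𝓕 (fun y => b y (g t)) (f t) = ∫ y in K, chr (-y) (f t) * b y (g t) := by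
    intro t
    rw [fourier_eq_chr]
    exact (setIntegral_eq_integral_of_forall_compl_eq_zero fun y hy => by
      rw [hb.2 y (g t) hy, mul_zero]).symm
  simp only [h1]
  refine continuous_parametric_integral_of_continuous
    (f := fun t y => chr (-y) (f t) * b y (g t)) ?_ hK
  exact (Continuous.chr (by fun_prop) (by fun_prop)).mul
    (hb.continuous_comp (by fun_prop) (by fun_prop))

/-- Rapid decay of the partial Fourier transform, with polynomial growth in `ξ`. -/
lemma SmoothIn.exists_norm_fourier_le_pow (hK : IsCompact K) (hKU : K ⊆ U) (hb : SmoothIn K b)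
    (hg : PolyGrowth U b) : ∃ P : ℕ, ∀ s : ℕ, ∃ C : ℝ, 0 ≤ C ∧ ∀ ξ w,
      ‖𝓕 (fun y => b y ξ) w‖ ≤ C * (1 + ‖ξ‖) ^ P * ((1 + ‖w‖ ^ 2) ^ s)⁻¹ := by
  obtain ⟨-, P, hP⟩ := hg
  refine ⟨P, fun s => ?_⟩
  obtain ⟨C, hC0, hC⟩ := hb.exists_norm_fourier_le hK (Ξ := Set.univ)
    (g := fun ξ => (1 + ‖ξ‖) ^ P) (fun ξ => by positivity) (fun γ => by
      obtain ⟨C, -, hC⟩ := hP γ 0 K hK hKU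
      rw [dXi_zero] at hC
      exact ⟨C, fun x hx ξ _ => hC x hx ξ⟩) s
  exact ⟨C, hC0, fun ξ w => hC ξ (Set.mem_univ ξ) w⟩

lemma one_add_norm_smul_le (c : ℝ) (w : Eucl n) : 1 + ‖c • w‖ ≤ (1 + |c|) * (1 + ‖w‖) := by
  rw [norm_smul, Real.norm_eq_abs]
  nlinarith [norm_nonneg w, abs_nonneg c]

/-- The Fourier transform of `Op_h(b) u`, where `𝓕 u` decays so rapidly that the integrals in the
position and in the frequency can be interchanged. -/
lemma fourier_Op (hK : IsCompact K) (hKU : K ⊆ U) (hb : SmoothIn K b)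
    (hg : PolyGrowth U b) (hu : TestFun U u) {h : ℝ} (hh : 0 < h) (w : Eucl n) :
    𝓕 (Op h b u) w =
      ∫ ζ, 𝓕 (fun y => b y ((2 * Real.pi * h) • ζ)) (w - ζ) * 𝓕 u ζ := by
  obtain ⟨c, hc⟩ : ∃ c, c = 2 * Real.pi * h := ⟨_, rfl⟩
  obtain ⟨P, hP⟩ := hg.exists_le
  obtain ⟨C, hC0, hC⟩ := hP K hK hKU
  have hcu : Continuous (𝓕 u) :=
    ExoticCalculus.continuous_fourier (hu.1.continuous.integrable_of_hasCompactSupport hu.2.1)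
  have hint : Integrable (fun v : Eucl n × Eucl n =>
      chr (-v.1) w * (chr v.1 v.2 * b v.1 (c • v.2) * 𝓕 u v.2)) (volume.prod volume) := by
    have h1 : Integrable (K.indicator fun _ => (1 : ℝ)) :=
      (integrable_indicator_iff hK.measurableSet).2
        (integrableOn_const hK.measure_lt_top.ne)
    obtain ⟨C', hC', hu'⟩ := exists_norm_fourier_le hu.1 hu.2.1 (P + n + 1)
    have h2 := (integrable_weight (n := n) (P := P) (s := P + n + 1) (by omega)).const_mul
      (C * (1 + |c|) ^ P * C')
    refine (h1.mul_prod h2).mono' ?_ (Filter.Eventually.of_forall fun v => ?_)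
    · refine Continuous.aestronglyMeasurable ?_
      exact (Continuous.chr (by fun_prop) (by fun_prop)).mul
        (((Continuous.chr (by fun_prop) (by fun_prop)).mul
          (hb.continuous_comp (by fun_prop) (by fun_prop))).mul (hcu.comp continuous_snd))
    · simp only [norm_mul, norm_chr, one_mul]
      by_cases hv : v.1 ∈ K
      · rw [Set.indicator_of_mem hv, one_mul]
        calc ‖b v.1 (c • v.2)‖ * ‖𝓕 u v.2‖
            ≤ (C * ((1 + |c|) * (1 + ‖v.2‖)) ^ P) * (C' * ((1 + ‖v.2‖ ^ 2) ^ (P + n + 1))⁻¹) := by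
              refine mul_le_mul ((hC _ hv _).trans ?_) (hu' _) (norm_nonneg _) (by positivity)
              gcongr
              exact one_add_norm_smul_le c v.2
          _ = _ := by rw [mul_pow]; ring
      · rw [hb.2 _ _ hv, Set.indicator_of_notMem hv]; simp
  rw [fourier_eq_chr]
  simp only [Op_eq hh, ← integral_const_mul, ← hc]
  rw [integral_integral_swap hint]
  congr 1; funext ζ
  rw [fourier_eq_chr (fun y => b y (c • ζ)), ← integral_mul_const]
  congr 1; funext y
  have e : chr (-y) w * chr y ζ = chr (-y) (w - ζ) := by
    have e1 : chr (-y) w = chr (-y) (w - ζ) * chr (-y) ζ := by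
      rw [← chr_add_right, sub_add_cancel]
    have e2 : chr (-y) ζ * chr y ζ = 1 := by
      rw [← chr_add_left, neg_add_cancel]; simp [chr]
    rw [e1, mul_assoc, e2, mul_one]
  rw [← e]; ring

/-- The composition formula. The integrals in the two frequencies are interchanged, which is allowed
by the decay of `𝓕(b(·, ξ))(w - ζ)`; then `w` is replaced by `w + ζ`. -/
theorem Op_Op (hU : IsOpen U) (ha : PolyGrowth U a) (hK : IsCompact K) (hKU : K ⊆ U)
    (hb : SmoothIn K b) (hg : PolyGrowth U b) (hu : TestFun U u) {h : ℝ} (hh : 0 < h) {x : Eucl n}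
    (hx : x ∈ U) : Op h a (Op h b u) x = Op h (amp h a b) u x := by
  obtain ⟨c, hc⟩ : ∃ c, c = 2 * Real.pi * h := ⟨_, rfl⟩
  obtain ⟨P, hP⟩ := ha.exists_le
  obtain ⟨Ca, hCa0, hCa⟩ := hP {x} isCompact_singleton (Set.singleton_subset_iff.2 hx)
  obtain ⟨Q, hQ⟩ := hb.exists_norm_fourier_le_pow hK hKU hg
  obtain ⟨Cb, hCb0, hCb⟩ := hQ (P + n + 1)
  obtain ⟨Cu, hCu0, hCu⟩ := exists_norm_fourier_le hu.1 hu.2.1 (P + Q + n + 1)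
  have hcu : Continuous (𝓕 u) :=
    ExoticCalculus.continuous_fourier (hu.1.continuous.integrable_of_hasCompactSupport hu.2.1)
  have hca : Continuous (a x) := (ha.1.slice_left hU hx).continuous
  have hint : Integrable (fun v : Eucl n × Eucl n => chr x v.1 * a x (c • v.1) *
      (𝓕 (fun y => b y (c • v.2)) (v.1 - v.2) * 𝓕 u v.2)) (volume.prod volume) := by
    have h1 := integrable_weight (n := n) (P := P) (s := P + n + 1) (by omega)
    have h2 := (integrable_weight (n := n) (P := P + Q) (s := P + Q + n + 1) (by omega)).const_mul
      (Ca * (1 + |c|) ^ P * Cb * (1 + |c|) ^ Q * Cu)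
    refine (h2.convolution_integrand (ContinuousLinearMap.mul ℝ ℝ) h1).mono' ?_
      (Filter.Eventually.of_forall fun v => ?_)
    · refine Continuous.aestronglyMeasurable ?_
      exact ((Continuous.chr (by fun_prop) (by fun_prop)).mul (hca.comp (by fun_prop))).mul
        ((hb.continuous_fourier hK (by fun_prop) (by fun_prop)).mul (hcu.comp continuous_snd))
    · obtain ⟨w, ζ⟩ := v
      simp only [norm_mul, norm_chr, one_mul, ContinuousLinearMap.mul_apply']
      have e1 : 1 + ‖w‖ ≤ (1 + ‖w - ζ‖) * (1 + ‖ζ‖) := by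
        have := norm_add_le (w - ζ) ζ
        rw [sub_add_cancel] at this
        nlinarith [norm_nonneg (w - ζ), norm_nonneg ζ,
          mul_nonneg (norm_nonneg (w - ζ)) (norm_nonneg ζ)]
      have e2 : ‖a x (c • w)‖ ≤ Ca * ((1 + |c|) * ((1 + ‖w - ζ‖) * (1 + ‖ζ‖))) ^ P := by
        refine (hCa x rfl _).trans ?_
        gcongr
        exact (one_add_norm_smul_le c w).trans (by gcongr)
      have e3 : ‖𝓕 (fun y => b y (c • ζ)) (w - ζ)‖ ≤ Cb * ((1 + |c|) * (1 + ‖ζ‖)) ^ Q *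
          ((1 + ‖w - ζ‖ ^ 2) ^ (P + n + 1))⁻¹ := by
        refine (hCb _ _).trans ?_
        gcongr
        exact one_add_norm_smul_le c ζ
      calc _ ≤ (Ca * ((1 + |c|) * ((1 + ‖w - ζ‖) * (1 + ‖ζ‖))) ^ P) *
            ((Cb * ((1 + |c|) * (1 + ‖ζ‖)) ^ Q * ((1 + ‖w - ζ‖ ^ 2) ^ (P + n + 1))⁻¹) *
              (Cu * ((1 + ‖ζ‖ ^ 2) ^ (P + Q + n + 1))⁻¹)) := by
            gcongr
            exact hCu ζ
        _ = _ := by rw [mul_pow, mul_pow, mul_pow, pow_add (1 + ‖ζ‖) P Q]; ring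
  rw [Op_eq hh, Op_eq hh]
  simp only [fourier_Op hK hKU hb hg hu hh, ← integral_const_mul, ← hc]
  rw [integral_integral_swap hint]
  congr 1; funext ζ
  rw [amp, ← integral_add_right_eq_self _ ζ, ← integral_const_mul, ← integral_mul_const]
  congr 1; funext w
  rw [chr_add_right, add_sub_cancel_right, smul_add, ← hc, add_comm (c • w)]
  ring

end Composition

end ExoticCalculus

end

theorem proposition4p5 {n : ℕ} (U : Set (Eucl n)) (hU : IsOpen U)
    (m : ℕ) (coef : (Fin n → ℕ) → Eucl n → ℂ)
    (hcoef : ∀ γ, mlen γ ≤ m → ContDiffOn ℝ ∞ (coef γ) U)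
    (hell : ClassicallyElliptic U m coef)
    (z : ℂ) (R : ℝ) (r k l : ℝ)
    (a b : SymbolFamily n R)
    (ha : MemS10 U (fun ξ => jap ξ ^ r) a)
    (hb : MemSLam U (polySymbol m coef) z
      (fun q x ξ => jap ξ ^ k * Lam (polySymbol m coef) z q.α x ξ ^ l) b)
    (K : Set (Eucl n)) (hK : IsCompact K) (hKU : K ⊆ U)
    (hsupp : ∀ q x ξ, x ∉ K → b q x ξ = 0) :
    (∀ q : Param R, ∀ u : Eucl n → ℂ, TestFun U u →
      TestFun U (Op q.h (b q) u) ∧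
      ∀ x ∈ U, Op q.h (a q) (Op q.h (b q) u) x = Op q.h (compSymbol a b q) u x) ∧
    MemSLam U (polySymbol m coef) z
      (fun q x ξ => jap ξ ^ r *
        (jap ξ ^ k * Lam (polySymbol m coef) z q.α x ξ ^ l)) (compSymbol a b) ∧
    ∀ N : ℕ, MemSLam U (polySymbol m coef) z
      (fun q x ξ => jap ξ ^ r *
        (jap ξ ^ k * Lam (polySymbol m coef) z q.α x ξ ^ l) /
          (Lam (polySymbol m coef) z q.α x ξ * jap ξ) ^ N * q.h ^ N)
      (fun q x ξ => compSymbol a b q x ξ - expansion a b N q x ξ) := by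
  have hs : ∀ q, SuppIn K (b q) := hsupp
  have hb' : MemSLam U (polySymbol m coef) z (wt (polySymbol m coef) z R k l) b := hb
  have hrem := memSLam_remainder hU hcoef hell ha hb' hK hKU hs
  refine ⟨fun q u hu => ⟨testFun_Op hU hK hKU (hb'.polyGrowth q) (hs q) hu q.h_pos,
    fun x hx => ?_⟩, ?_, hrem⟩
  · have e : compSymbol a b q = amp q.h (a q) (b q) :=
      funext fun x => funext fun ξ => compSymbol_eq_amp a b q x ξ
    rw [e]
    exact Op_Op hU (ha.polyGrowth q) hK hKU (hb'.smoothIn hU hK hKU (hs q)) (hb'.polyGrowth q) hu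
      q.h_pos hx
  · -- The case `N = 0` of the expansion is the statement about the composition symbol itself.
    simpa [expansion] using hrem 0
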